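/- Let $X$ be the Banach space of functions $f(z)=\sum_{k\ge 0}a_kz^k$ on the unit disk with $a_k\in\mathbb R$ and $\|f\|=\sum|a_k|<\infty$, and let $Y=X\times X$ with $\|(f,g)\|=\|f\|+\|g\|$. Put $s=2.2$, $t=0.5$. For $F=(f,g)\in Y$ let $$\lambda=-f\big([f(0)^2-1]/s\big),\quad p(w)=\lambda^2(w+\tfrac1s)-\tfrac1s,\quad q(w)=\lambda^2tw\,g(\lambda^2w),$$ and define $T(f,g)=(\hat f,\hat g)$ by $$\hat f(w)=\lambda^{-1}\Big\{-1+f(p(w))^2\,g\big(\tfrac1t f(p(w))^2\big)\Big\},\qquad \hat g(w)=\frac1{tw}\Big\{1+\lambda^{-1}f\Big(\tfrac1s f\big(\tfrac1s q(w)[q(w)-2]\big)^2-\tfrac1s\Big)\Big\}$$ (the singularity of $\hat g$ at $w=0$ is removable). The domain of $T$ consists of the $F\in Y$ with $\lambda\ne0$ and $|[f(0)^2-1]/s|<1$ for which, for all $|w|\le1$, the arguments $p(w)$, $\lambda^2w$, $\tfrac1tf(p(w))^2$, $\tfrac1sq(w)[q(w)-2]$ and $\tfrac1s[f(\tfrac1sq(w)[q(w)-2])^2-1]$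 of $f$ and $g$ lie in the open unit disk, and for which $\hat f,\hat g\in X$. This $T$ is the renormalization operator of type $(\{0,1\},\{1,0,0\})$ on Lorenz maps with critical exponent $2$, in the following coordinates: $(f,g)$ represents the map $x\mapsto\phi(x^2)$ for $x<0$, $x\mapsto\psi(x^2)$ for $x>0$, where $\phi(z)=f([z-1]/s)$ and $\psi(z)=-1+z\,g(z/t)$. A real $26\times26$ matrix acts on $Y$ through the basis vectors $(z^k,0),(0,z^k)$, $0\le k\le12$, and annihilates $(z^k,0),(0,z^k)$ for $k\ge13$. A Lorenz map on $[l,r]$, $l<0<r$, with critical exponent $\rho>1$ is a continuous map $[l,r]\setminus\{0\}\to[l,r]$ that is strictly increasing on each side of $0$, with $f(0^-)=r$ and $f(0^+)=l$, and that is equal to $\phi(|x|^\rho)$ on $(l,0)$ and to $\psi(|x|^\rho)$ on $(0,r)$, where $\phi,\psi$ are analytic and commute with complex conjugation on complex neighbourhoods of $[0,|l|^\rho]$ and $[0,r^\rho]$ respectively. Theorem. There exist a pair $F_0\in Y$ of polynomials of degree at most $12$, which represents a Lorenz map on $[-1,r]$ with critical exponent $2$ for some $r>0$, and a real $26\times 26$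 matrix $\Gamma$ such that $\Gamma-I$ is invertible on $Y$, the closed ball $B=\{F\in Y:\|F-F_0\|\le10^{-7}\}$ is contained in the interior of the domain of $T$, $T$ and the simplified Newton operator $\Phi=(\Gamma-I)^{-1}(\Gamma-T)$ are Fréchet differentiable at every point of $B$, and 1. $\|D\Phi_F\|<0.2$ for all $F\in B$; 2. $\|\Phi F_0-F_0\|<5\cdot10^{-9}$; 3. for all $\theta\in\mathbb R$, $\Gamma-e^{i\theta}I$ is invertible on the complexification of $Y$ (pairs of series with complex coefficients, with the same norm), and $\|(\Gamma-e^{i\theta}I)^{-1}(\Gamma-DT_F)\|<0.9$ for all $F\in B$, in the operator norm of the complexification. -/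

import Mathlib

open Set Filter Topology

noncomputable section

namespace Lorenz

/-! ### The Banach spaces -/

/-- Absolutely summable sequences of Taylor coefficients; `L1 ℝ` is the space `X` of functions
`f(z) = ∑ a_k z^k` on the unit disk with real `a_k` and norm `∑ |a_k| < ∞`. -/
abbrev L1 (𝕜 : Type) [RCLike 𝕜] : Type := lp (fun _ : ℕ => 𝕜) 1

abbrev X : Type := L1 ℝ

/-- `Y = X × X` with the norm `‖(f, g)‖ = ‖f‖ + ‖g‖`. -/
abbrev Y : Type := WithLp 1 (X × X)

/-- The complexification of `Y`: pairs of series with complex coefficients, with the same norm. -/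
abbrev YC : Type := WithLp 1 (L1 ℂ × L1 ℂ)

/-- The value of `f(z) = ∑ a_k z^k` at a complex number. -/
def ev (f : X) (z : ℂ) : ℂ := ∑' k : ℕ, (f k : ℂ) * z ^ k

/-! ### Lorenz maps -/

/-- `φ` is analytic and symmetric (`φ (conj z) = conj (φ z)`) on some complex neighbourhood
of the set `K` of real numbers. -/
def SymmAnalyticNear (φ : ℂ → ℂ) (K : Set ℝ) : Prop :=
  ∃ U : Set ℂ, IsOpen U ∧ (∀ x ∈ K, (x : ℂ) ∈ U) ∧ DifferentiableOn ℂ φ U ∧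
    ∀ z ∈ U, starRingEnd ℂ z ∈ U ∧ φ (starRingEnd ℂ z) = starRingEnd ℂ (φ z)

/-- `F` is a Lorenz map on `[l, r]` with critical exponent `ρ`; its value at the jump point `0`
plays no role. -/
structure IsLorenzMap (l r ρ : ℝ) (F : ℝ → ℝ) : Prop where
  left_neg : l < 0
  right_pos : 0 < r
  one_lt_exponent : 1 < ρ
  mapsTo : MapsTo F (Icc l r \ {0}) (Icc l r)
  continuousOn : ContinuousOn F (Icc l r \ {0})
  strictMonoOn_left : StrictMonoOn F (Ico l 0)
  strictMonoOn_right : StrictMonoOn F (Ioc 0 r)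
  tendsto_left : Tendsto F (𝓝[<] 0) (𝓝 r)
  tendsto_right : Tendsto F (𝓝[>] 0) (𝓝 l)
  analytic_left : ∃ φ : ℂ → ℂ, SymmAnalyticNear φ (Icc 0 (|l| ^ ρ)) ∧
    ∀ x ∈ Ioo l 0, (F x : ℂ) = φ ((|x| ^ ρ : ℝ) : ℂ)
  analytic_right : ∃ ψ : ℂ → ℂ, SymmAnalyticNear ψ (Icc 0 (|r| ^ ρ)) ∧
    ∀ x ∈ Ioo 0 r, (F x : ℂ) = ψ ((|x| ^ ρ : ℝ) : ℂ)

/-- The constants of the coordinate change. -/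
def s : ℂ := 11 / 5

def t : ℂ := 1 / 2

/-- `φ(z) = f((z - 1) / s)`. -/
def phi (F : Y) (z : ℂ) : ℂ := ev F.fst ((z - 1) / s)

/-- `ψ(z) = -1 + z g(z / t)`. -/
def psi (F : Y) (z : ℂ) : ℂ := -1 + z * ev F.snd (z / t)

/-- The map on the line with coordinates `F = (f, g) ∈ Y`: it is `φ(x²)` for `x < 0` and `ψ(x²)`
for `x > 0` (both are real numbers). -/
def toMap (F : Y) (x : ℝ) : ℝ :=
  if x < 0 then (phi F ((x : ℂ) ^ 2)).re else (psi F ((x : ℂ) ^ 2)).re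

/-! ### The renormalization operator of type `({0, 1}, {1, 0, 0})` -/

/-- The rescaling factor `λ = -f([f(0)² - 1] / s)`. -/
def lam (F : Y) : ℂ := -ev F.fst ((ev F.fst 0 ^ 2 - 1) / s)

/-- The arguments at which `f` and `g` are evaluated in the definition of the operator. -/
def pf (F : Y) (w : ℂ) : ℂ := lam F ^ 2 * (w + 1 / s) - 1 / s

def pg (F : Y) (w : ℂ) : ℂ := lam F ^ 2 * w

def f2 (F : Y) (w : ℂ) : ℂ := ev F.fst (pf F w) ^ 2

def f3 (F : Y) (w : ℂ) : ℂ := f2 F w / t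

def g2 (F : Y) (w : ℂ) : ℂ := t * pg F w * ev F.snd (pg F w)

def g3 (F : Y) (w : ℂ) : ℂ := g2 F w * (g2 F w - 2) / s

def g5 (F : Y) (w : ℂ) : ℂ := (ev F.fst (g3 F w) ^ 2 - 1) / s

/-- All compositions are well defined: `λ ≠ 0`, and `f` and `g` are only evaluated inside the unit
disk, at points of the images of the closed unit disk. -/
structure CompositionsDefined (F : Y) : Prop where
  lam_ne_zero : lam F ≠ 0
  lam_arg : ‖(ev F.fst 0 ^ 2 - 1) / s‖ < 1
  pf_lt : ∀ w : ℂ, ‖w‖ ≤ 1 → ‖pf F w‖ < 1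
  pg_lt : ∀ w : ℂ, ‖w‖ ≤ 1 → ‖pg F w‖ < 1
  f3_lt : ∀ w : ℂ, ‖w‖ ≤ 1 → ‖f3 F w‖ < 1
  g3_lt : ∀ w : ℂ, ‖w‖ ≤ 1 → ‖g3 F w‖ < 1
  g5_lt : ∀ w : ℂ, ‖w‖ ≤ 1 → ‖g5 F w‖ < 1

/-- `G = T F`: the renormalization of `F = (f, g)` is defined and is `G ∈ Y`. The second component
has a removable singularity at `w = 0`. -/
structure IsRenormalization (F G : Y) : Prop where
  defined : CompositionsDefined F
  fst_eq : ∀ w : ℂ, ‖w‖ < 1 →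
    ev G.fst w = (lam F)⁻¹ * (-1 + f2 F w * ev F.snd (f3 F w))
  snd_eq : ∀ w : ℂ, ‖w‖ < 1 → w ≠ 0 →
    ev G.snd w = 1 / (t * w) * (1 + (lam F)⁻¹ * ev F.fst (g5 F w))

/-- The domain of `T`. -/
def domT : Set Y := {F | ∃ G, IsRenormalization F G}

open Classical in
/-- The operator `T`, extended by zero outside its domain. -/
def T (F : Y) : Y := if h : ∃ G, IsRenormalization F G then h.choose else 0

/-! ### Matrices as finite-rank operators, and the simplified Newton operator -/

/-- The coefficients of degree less than `d` of `f` (left) and of `g` (right). -/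
def coeffs (d : ℕ) : Y →L[ℝ] (Fin d ⊕ Fin d → ℝ) :=
  ContinuousLinearMap.pi (Sum.elim
    (fun k => (lp.evalCLM ℝ (fun _ : ℕ => ℝ) 1 (k : ℕ)).comp (WithLp.fstL 1 ℝ X X))
    (fun k => (lp.evalCLM ℝ (fun _ : ℕ => ℝ) 1 (k : ℕ)).comp (WithLp.sndL 1 ℝ X X)))

/-- The pair of polynomials of degree less than `d` with the given coefficients. -/
def ofCoeffs (d : ℕ) : (Fin d ⊕ Fin d → ℝ) →ₗ[ℝ] Y where
  toFun v := WithLp.toLp 1 (∑ k : Fin d, lp.single 1 (k : ℕ) (v (Sum.inl k)),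
    ∑ k : Fin d, lp.single 1 (k : ℕ) (v (Sum.inr k)))
  map_add' u v := by
    simp only [Pi.add_apply, lp.single_add, Finset.sum_add_distrib]
    rfl
  map_smul' c v := by
    simp only [Pi.smul_apply, lp.single_smul, ← Finset.smul_sum]
    rfl

/-- The operator on `Y` given by a `2d × 2d` matrix `M` with respect to the basis vectors
`(z^k, 0)`, `(0, z^k)`, `k < d`; it annihilates `(z^k, 0)` and `(0, z^k)` for `k ≥ d`. -/
def matrixOp {d : ℕ} (M : Matrix (Fin d ⊕ Fin d) (Fin d ⊕ Fin d) ℝ) : Y →L[ℝ] Y :=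
  ((ofCoeffs d).comp M.mulVecLin).toContinuousLinearMap.comp (coeffs d)

/-- The simplified Newton operator `Φ = (Γ - I)⁻¹ (Γ - T)`. -/
def newtonOp (Γ : Y →L[ℝ] Y) (F : Y) : Y := Ring.inverse (Γ - 1) (Γ F - T F)

/-! ### Complexification of operators -/

theorem summable_norm {𝕜 : Type} [RCLike 𝕜] (a : L1 𝕜) : Summable fun k => ‖a k‖ := by
  simpa using (memℓp_gen_iff (by simp)).1 (lp.memℓp a)

theorem norm_eq_tsum {𝕜 : Type} [RCLike 𝕜] (a : L1 𝕜) : ‖a‖ = ∑' k, ‖a k‖ := by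
  simpa using lp.norm_eq_tsum_rpow (p := 1) (by simp) a

/-- Applying a real-linear map that does not increase absolute values to all the coefficients. -/
def mapCoeff {𝕜 𝕜' : Type} [RCLike 𝕜] [RCLike 𝕜'] (A : 𝕜 →ₗ[ℝ] 𝕜') (hA : ∀ x, ‖A x‖ ≤ ‖x‖) :
    L1 𝕜 →L[ℝ] L1 𝕜' :=
  LinearMap.mkContinuous
    { toFun := fun a => ⟨fun k => A (a k), (memℓp_gen_iff (by simp)).2 (by
        simpa using (summable_norm a).of_nonneg_of_le (fun _ => norm_nonneg _) fun k => hA (a k))⟩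
      map_add' := fun a b => lp.ext (funext fun k => map_add A (a k) (b k))
      map_smul' := fun c a => lp.ext (funext fun k => map_smul A c (a k)) } 1
    (fun a => by
      rw [one_mul, norm_eq_tsum, norm_eq_tsum]
      exact Summable.tsum_le_tsum (fun k => hA (a k))
        ((summable_norm a).of_nonneg_of_le (fun _ => norm_nonneg _) fun k => hA (a k))
        (summable_norm a))

/-- Applying an operator to both components. -/
def onPairs {𝕜 𝕜' : Type} [RCLike 𝕜] [RCLike 𝕜'] (A : L1 𝕜 →L[ℝ] L1 𝕜') :
    WithLp 1 (L1 𝕜 × L1 𝕜) →L[ℝ] WithLp 1 (L1 𝕜' × L1 𝕜') :=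
  (WithLp.prodContinuousLinearEquiv 1 ℝ (L1 𝕜') (L1 𝕜')).symm.toContinuousLinearMap.comp
    ((A.prodMap A).comp
      (WithLp.prodContinuousLinearEquiv 1 ℝ (L1 𝕜) (L1 𝕜)).toContinuousLinearMap)

/-- Real parts of the coefficients. -/
def reY : YC →L[ℝ] Y := onPairs (mapCoeff Complex.reLm Complex.abs_re_le_norm)

/-- Imaginary parts of the coefficients. -/
def imY : YC →L[ℝ] Y := onPairs (mapCoeff Complex.imLm Complex.abs_im_le_norm)

/-- The inclusion of `Y` in its complexification. -/
def inclY : Y →L[ℝ] YC :=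
  onPairs (mapCoeff Complex.ofRealAm.toLinearMap fun x => (Complex.norm_real x).le)

theorem reY_smul (c : ℂ) (h : YC) : reY (c • h) = c.re • reY h - c.im • imY h :=
  WithLp.ofLp_injective 1 (Prod.ext (lp.ext (funext fun k => Complex.mul_re c (h.fst k)))
    (lp.ext (funext fun k => Complex.mul_re c (h.snd k))))

theorem imY_smul (c : ℂ) (h : YC) : imY (c • h) = c.re • imY h + c.im • reY h :=
  WithLp.ofLp_injective 1 (Prod.ext (lp.ext (funext fun k => Complex.mul_im c (h.fst k)))
    (lp.ext (funext fun k => Complex.mul_im c (h.snd k))))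

/-- The complex-linear extension of `L`: `u + i v ↦ L u + i L v` for `u, v ∈ Y`. -/
def complexify (L : Y →L[ℝ] Y) : YC →L[ℂ] YC where
  toFun h := inclY (L (reY h)) + Complex.I • inclY (L (imY h))
  map_add' h h' := by
    simp only [map_add, smul_add]
    abel
  map_smul' c h := by
    have hc : ∀ (x : ℝ) (v : YC), x • v = (x : ℂ) • v := fun x v => rfl
    simp only [reY_smul, imY_smul, map_add, map_sub, map_smul, hc, RingHom.id_apply]
    conv_rhs => rw [← Complex.re_add_im c]
    match_scalars
    · ring
    · linear_combination (-(c.im : ℂ)) * Complex.I_mul_I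
  cont := by fun_prop

end Lorenz

end

noncomputable section

namespace Lorenz

/-! ### The Banach algebra of absolutely convergent power series -/

theorem memℓp_one_of_summable {a : ℕ → ℝ} (h : Summable fun k => ‖a k‖) :
    Memℓp a (1 : ENNReal) :=
  (memℓp_gen_iff (by simp)).2 (by simpa using h)

/-- The power series of an element of `X`. -/
def toPS (a : X) : PowerSeries ℝ := PowerSeries.mk a

theorem toPS_injective : Function.Injective toPS := fun a b h => lp.ext (funext fun k => by
  simpa [toPS] using congrArg (PowerSeries.coeff k) h)

scoped instance : Mul X := ⟨fun a b =>
  ⟨fun n => ∑ p ∈ Finset.HasAntidiagonal.antidiagonal n, a p.1 * b p.2,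
  memℓp_one_of_summable (summable_norm_sum_mul_antidiagonal_of_summable_norm
    (summable_norm a) (summable_norm b))⟩⟩

scoped instance : One X := ⟨lp.single 1 0 1⟩

theorem mul_coeff (a b : X) (n : ℕ) :
    (a * b) n = ∑ p ∈ Finset.HasAntidiagonal.antidiagonal n, a p.1 * b p.2 := rfl

theorem toPS_mul (a b : X) : toPS (a * b) = toPS a * toPS b :=
  PowerSeries.ext fun n => by simp [toPS, PowerSeries.coeff_mul, mul_coeff]

theorem toPS_one : toPS 1 = 1 := PowerSeries.ext fun n => by
  rw [toPS, PowerSeries.coeff_mk, PowerSeries.coeff_one]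
  exact Pi.single_apply 0 (1 : ℝ) n

theorem toPS_add (a b : X) : toPS (a + b) = toPS a + toPS b := rfl

theorem toPS_zero : toPS 0 = 0 := rfl

theorem toPS_smul (c : ℝ) (a : X) : toPS (c • a) = c • toPS a := rfl

scoped instance : CommRing X :=
  { (inferInstance : AddCommGroup X) with
    mul := (· * ·)
    one := 1
    left_distrib := fun a b c => toPS_injective (by simp only [toPS_mul, toPS_add]; ring)
    right_distrib := fun a b c => toPS_injective (by simp only [toPS_mul, toPS_add]; ring)
    zero_mul := fun a => toPS_injective (by simp only [toPS_mul, toPS_zero]; ring)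
    mul_zero := fun a => toPS_injective (by simp only [toPS_mul, toPS_zero]; ring)
    mul_assoc := fun a b c => toPS_injective (by simp only [toPS_mul]; ring)
    one_mul := fun a => toPS_injective (by simp only [toPS_mul, toPS_one]; ring)
    mul_one := fun a => toPS_injective (by simp only [toPS_mul, toPS_one]; ring)
    mul_comm := fun a b => toPS_injective (by simp only [toPS_mul]; ring) }

theorem norm_mul_le_X (a b : X) : ‖a * b‖ ≤ ‖a‖ * ‖b‖ := by
  have ha := summable_norm a
  have hb := summable_norm b
  have ha' : Summable fun k => ‖‖a k‖‖ := by simpa using ha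
  have hb' : Summable fun k => ‖‖b k‖‖ := by simpa using hb
  have h := summable_norm_sum_mul_antidiagonal_of_summable_norm ha' hb'
  rw [norm_eq_tsum (a * b), norm_eq_tsum a, norm_eq_tsum b,
    tsum_mul_tsum_eq_tsum_sum_antidiagonal_of_summable_norm ha' hb']
  refine Summable.tsum_le_tsum (fun n => ?_) (summable_norm (a * b)) h.of_norm
  rw [mul_coeff]
  exact (norm_sum_le _ _).trans (le_of_eq (by simp))

scoped instance : NormedCommRing X :=
  { (inferInstance : NormedAddCommGroup X), (inferInstance : CommRing X) with
    norm_mul_le := norm_mul_le_X }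

scoped instance : Algebra ℝ X := Algebra.ofModule
  (fun c a b => toPS_injective (by simp only [toPS_mul, toPS_smul, smul_mul_assoc]))
  (fun c a b => toPS_injective (by simp only [toPS_mul, toPS_smul, mul_smul_comm]))

scoped instance : NormedAlgebra ℝ X where
  norm_smul_le := norm_smul_le

theorem norm_single_X (k : ℕ) (c : ℝ) : ‖(lp.single 1 k c : X)‖ = |c| := by
  simp

scoped instance : NormOneClass X := ⟨(norm_single_X 0 1).trans abs_one⟩

theorem one_coeff (k : ℕ) : (1 : X) k = if k = 0 then 1 else 0 :=
  Pi.single_apply 0 (1 : ℝ) k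

/-- The monomial `z`. -/
def zX : X := lp.single 1 1 1

theorem norm_zX : ‖zX‖ = 1 := (norm_single_X 1 1).trans abs_one

theorem toPS_zX : toPS zX = PowerSeries.X := PowerSeries.ext fun n => by
  rw [toPS, PowerSeries.coeff_mk, PowerSeries.coeff_X]
  exact Pi.single_apply 1 (1 : ℝ) n

theorem zX_mul_zero (a : X) : (zX * a) 0 = 0 := by
  have := congrArg (PowerSeries.coeff 0) (toPS_mul zX a)
  rw [toPS_zX, PowerSeries.coeff_zero_X_mul] at this
  simpa [toPS] using this

theorem zX_mul_succ (a : X) (k : ℕ) : (zX * a) (k + 1) = a k := by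
  have := congrArg (PowerSeries.coeff (k + 1)) (toPS_mul zX a)
  rw [toPS_zX, PowerSeries.coeff_succ_X_mul] at this
  simpa [toPS] using this

theorem zX_pow (k : ℕ) : zX ^ k = (lp.single 1 k 1 : X) := by
  induction k with
  | zero => rfl
  | succ k ih =>
    refine lp.ext (funext fun n => ?_)
    rw [pow_succ', ih, lp.single_apply]
    cases n with
    | zero => simp [zX_mul_zero]
    | succ n => rw [zX_mul_succ, lp.single_apply]; simp [Pi.single_apply]

theorem add_coeff (a b : X) (k : ℕ) : (a + b) k = a k + b k := rfl

theorem smul_coeff (c : ℝ) (a : X) (k : ℕ) : (c • a) k = c * a k := rfl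

theorem abs_coeff_le (a : X) (k : ℕ) : |a k| ≤ ‖a‖ :=
  lp.norm_apply_le_norm (by simp) a k

theorem algebraMap_coeff_zero (c : ℝ) : (algebraMap ℝ X c) 0 = c := by
  rw [Algebra.algebraMap_eq_smul_one, smul_coeff, one_coeff]; simp

/-- Division by `z` of a series without constant term. -/
def shift : X →L[ℝ] X :=
  LinearMap.mkContinuous
    { toFun := fun a => ⟨fun k => a (k + 1),
        memℓp_one_of_summable ((summable_nat_add_iff 1).2 (summable_norm a))⟩
      map_add' := fun a b => rfl
      map_smul' := fun c a => rfl } 1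
    (fun a => by
      rw [one_mul, norm_eq_tsum, norm_eq_tsum, (summable_norm a).tsum_eq_zero_add]
      exact le_add_of_nonneg_left (norm_nonneg _))

theorem shift_coeff (a : X) (k : ℕ) : shift a k = a (k + 1) := rfl

theorem norm_shift_le (a : X) : ‖shift a‖ ≤ ‖a‖ := by
  simpa using (LinearMap.mkContinuous_norm_le _ zero_le_one _ : ‖shift‖ ≤ 1) |>
    fun h => shift.le_of_opNorm_le h a

theorem eq_const_add_zX_mul_shift (a : X) : a = algebraMap ℝ X (a 0) + zX * shift a := by
  refine lp.ext (funext fun k => ?_)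
  rw [add_coeff, Algebra.algebraMap_eq_smul_one, smul_coeff, one_coeff]
  cases k with
  | zero => simp [zX_mul_zero]
  | succ k => simp [zX_mul_succ, shift_coeff]

theorem shift_zX_mul (a : X) : shift (zX * a) = a :=
  lp.ext (funext fun k => by rw [shift_coeff, zX_mul_succ])

theorem shift_const (c : ℝ) : shift (algebraMap ℝ X c) = 0 :=
  lp.ext (funext fun k => by
    rw [shift_coeff, Algebra.algebraMap_eq_smul_one, smul_coeff, one_coeff]; simp)

end Lorenz
end

noncomputable section

namespace Lorenz

/-! ### Substitution into a power series -/

section Comp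

set_option linter.unusedSectionVars false

variable {A : Type*} [NormedCommRing A] [NormedAlgebra ℝ A] [CompleteSpace A] [NormOneClass A]

/-- Substitution of `p` into the series `f`. -/
def comp (f : X) (p : A) : A := ∑' k, f k • p ^ k

/-- Substitution of `p` into the derivative of the series `f`. -/
def dcomp (f : X) (p : A) : A := ∑' k : ℕ, (((k : ℝ) + 1) * f (k + 1)) • p ^ k

theorem norm_comp_term_le (f : X) {p : A} (hp : ‖p‖ ≤ 1) (k : ℕ) : ‖f k • p ^ k‖ ≤ ‖f k‖ := by
  rw [norm_smul]
  exact mul_le_of_le_one_right (norm_nonneg _)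
    ((norm_pow_le p k).trans (pow_le_one₀ (norm_nonneg _) hp))

theorem summable_norm_comp (f : X) {p : A} (hp : ‖p‖ ≤ 1) : Summable fun k => ‖f k • p ^ k‖ :=
  (summable_norm f).of_nonneg_of_le (fun _ => norm_nonneg _) (norm_comp_term_le f hp)

theorem hasSum_comp (f : X) {p : A} (hp : ‖p‖ ≤ 1) : HasSum (fun k => f k • p ^ k) (comp f p) :=
  (summable_norm_comp f hp).of_norm.hasSum

theorem norm_comp_le (f : X) {p : A} (hp : ‖p‖ ≤ 1) : ‖comp f p‖ ≤ ‖f‖ := by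
  rw [norm_eq_tsum f]
  have h1 : ‖comp f p‖ ≤ ∑' k, ‖f k • p ^ k‖ :=
    norm_tsum_le_tsum_norm (E := A) (f := fun k => f k • p ^ k) (summable_norm_comp f hp)
  have h2 : ∑' k, ‖f k • p ^ k‖ ≤ ∑' k, ‖f k‖ :=
    Summable.tsum_le_tsum (norm_comp_term_le f hp) (summable_norm_comp f hp) (summable_norm f)
  exact h1.trans h2

theorem comp_add (f g : X) {p : A} (hp : ‖p‖ ≤ 1) : comp (f + g) p = comp f p + comp g p := by
  have h := (hasSum_comp f hp).add (hasSum_comp g hp)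
  simp only [← add_smul] at h
  exact (hasSum_comp (f + g) hp).unique h

theorem comp_smul (c : ℝ) (f : X) {p : A} (hp : ‖p‖ ≤ 1) : comp (c • f) p = c • comp f p := by
  have h := (hasSum_comp f hp).const_smul c
  simp only [smul_smul] at h
  exact (hasSum_comp (c • f) hp).unique h

/-- Substitution of a fixed `p` as an operator. -/
def compL (p : A) (hp : ‖p‖ ≤ 1) : X →L[ℝ] A :=
  LinearMap.mkContinuous
    { toFun := fun f => comp f p
      map_add' := fun f g => comp_add f g hp
      map_smul' := fun c f => comp_smul c f hp } 1
    (fun f => by simpa using norm_comp_le f hp)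

theorem compL_apply (p : A) (hp : ‖p‖ ≤ 1) (f : X) : compL p hp f = comp f p := rfl

theorem comp_const (c : ℝ) (p : A) : comp (algebraMap ℝ X c) p = algebraMap ℝ A c := by
  rw [comp, tsum_eq_single 0]
  · simp [algebraMap_coeff_zero, Algebra.algebraMap_eq_smul_one (A := A)]
  · intro k hk
    rw [Algebra.algebraMap_eq_smul_one, smul_coeff, one_coeff, if_neg hk]; simp

theorem comp_zX_mul (a : X) {p : A} (hp : ‖p‖ ≤ 1) : comp (zX * a) p = p * comp a p := by
  have h : HasSum (fun k => (zX * a) (k + 1) • p ^ (k + 1)) (p * comp a p) := by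
    have := (hasSum_comp a hp).mul_left p
    refine this.congr_fun ?_
    intro k
    simp only [zX_mul_succ, pow_succ']
    rw [mul_smul_comm]
  have h' := (hasSum_nat_add_iff (f := fun k => (zX * a) k • p ^ k) 1).1 h
  simpa [zX_mul_zero] using (hasSum_comp (zX * a) hp).unique h'

theorem comp_zX_pow (k : ℕ) {p : A} (hp : ‖p‖ ≤ 1) : comp (zX ^ k) p = p ^ k := by
  induction k with
  | zero => simpa using comp_const (A := A) 1 p
  | succ k ih => rw [pow_succ', comp_zX_mul _ hp, ih, pow_succ']

theorem map_comp {A' : Type*} [NormedCommRing A'] [NormedAlgebra ℝ A'] [CompleteSpace A']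
    [NormOneClass A'] (φ : A →ₐ[ℝ] A') (hφ : Continuous φ) (f : X) {p : A} (hp : ‖p‖ ≤ 1)
    (hp' : ‖φ p‖ ≤ 1) : φ (comp f p) = comp f (φ p) := by
  have h := (hasSum_comp f hp).map φ hφ
  refine (h.congr_fun ?_).unique (hasSum_comp f hp')
  intro k
  simp

theorem succ_mul_pow_le {ρ : ℝ} (h0 : 0 ≤ ρ) (h1 : ρ < 1) (k : ℕ) :
    ((k : ℝ) + 1) * ρ ^ k ≤ (1 - ρ)⁻¹ := by
  have h2 : ((k : ℝ) + 1) * ρ ^ k ≤ ∑ i ∈ Finset.range (k + 1), ρ ^ i := by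
    have : ∑ _i ∈ Finset.range (k + 1), ρ ^ k ≤ ∑ i ∈ Finset.range (k + 1), ρ ^ i :=
      Finset.sum_le_sum fun i hi =>
        pow_le_pow_of_le_one h0 h1.le (Nat.lt_succ_iff.1 (Finset.mem_range.1 hi))
    simpa using this
  refine h2.trans ?_
  rw [← tsum_geometric_of_lt_one h0 h1]
  exact (summable_geometric_of_lt_one h0 h1).sum_le_tsum _ fun i _ => pow_nonneg h0 i

theorem norm_dcomp_term_le (f : X) {p : A} (hp : ‖p‖ < 1) (k : ℕ) :
    ‖(((k : ℝ) + 1) * f (k + 1)) • p ^ k‖ ≤ (1 - ‖p‖)⁻¹ * ‖f (k + 1)‖ := by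
  have h := succ_mul_pow_le (norm_nonneg p) hp k
  have h3 : (0 : ℝ) ≤ (k : ℝ) + 1 := by positivity
  calc ‖(((k : ℝ) + 1) * f (k + 1)) • p ^ k‖
      ≤ ‖((k : ℝ) + 1) * f (k + 1)‖ * ‖p‖ ^ k := by
        rw [norm_smul]
        exact mul_le_mul_of_nonneg_left (norm_pow_le p k) (norm_nonneg _)
    _ = (((k : ℝ) + 1) * ‖p‖ ^ k) * ‖f (k + 1)‖ := by
        rw [norm_mul, Real.norm_of_nonneg h3]; ring
    _ ≤ _ := mul_le_mul_of_nonneg_right h (norm_nonneg _)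

theorem summable_norm_dcomp (f : X) {p : A} (hp : ‖p‖ < 1) :
    Summable fun k : ℕ => ‖(((k : ℝ) + 1) * f (k + 1)) • p ^ k‖ :=
  (((summable_nat_add_iff 1).2 (summable_norm f)).mul_left _).of_nonneg_of_le
    (fun _ => norm_nonneg _) (norm_dcomp_term_le f hp)

theorem hasSum_dcomp (f : X) {p : A} (hp : ‖p‖ < 1) :
    HasSum (fun k : ℕ => (((k : ℝ) + 1) * f (k + 1)) • p ^ k) (dcomp f p) :=
  (summable_norm_dcomp f hp).of_norm.hasSum

theorem norm_dcomp_le (f : X) {p : A} (hp : ‖p‖ < 1) : ‖dcomp f p‖ ≤ (1 - ‖p‖)⁻¹ * ‖f‖ := by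
  have hs := (summable_nat_add_iff 1).2 (summable_norm f)
  have h1 : ‖dcomp f p‖ ≤ ∑' k : ℕ, ‖(((k : ℝ) + 1) * f (k + 1)) • p ^ k‖ :=
    norm_tsum_le_tsum_norm (E := A) (f := fun k : ℕ => (((k : ℝ) + 1) * f (k + 1)) • p ^ k)
      (summable_norm_dcomp f hp)
  have h2 : ∑' k : ℕ, ‖(((k : ℝ) + 1) * f (k + 1)) • p ^ k‖ ≤
      ∑' k : ℕ, (1 - ‖p‖)⁻¹ * ‖f (k + 1)‖ :=
    Summable.tsum_le_tsum (norm_dcomp_term_le f hp) (summable_norm_dcomp f hp) (hs.mul_left _)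
  refine (h1.trans h2).trans ?_
  rw [tsum_mul_left]
  refine mul_le_mul_of_nonneg_left ?_ (inv_nonneg.2 (sub_nonneg.2 hp.le))
  rw [norm_eq_tsum f, (summable_norm f).tsum_eq_zero_add]
  exact le_add_of_nonneg_left (norm_nonneg _)

theorem dcomp_add (f g : X) {p : A} (hp : ‖p‖ < 1) :
    dcomp (f + g) p = dcomp f p + dcomp g p := by
  have h := (hasSum_dcomp f hp).add (hasSum_dcomp g hp)
  simp only [← add_smul, ← mul_add] at h
  exact (hasSum_dcomp (f + g) hp).unique h

theorem dcomp_const (c : ℝ) (p : A) : dcomp (algebraMap ℝ X c) p = 0 := by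
  rw [dcomp]
  convert! tsum_zero with k
  rw [Algebra.algebraMap_eq_smul_one, smul_coeff, one_coeff]; simp

theorem dcomp_zX_mul (a : X) {p : A} (hp : ‖p‖ < 1) :
    dcomp (zX * a) p = comp a p + p * dcomp a p := by
  have h1 := (hasSum_dcomp a hp).mul_left p
  have h2 : HasSum (fun k : ℕ => ((k : ℝ) * a k) • p ^ k) (p * dcomp a p) := by
    refine (hasSum_nat_add_iff' (f := fun k : ℕ => ((k : ℝ) * a k) • p ^ k) 1).1 ?_
    simp only [Finset.range_one, Finset.sum_singleton, Nat.cast_zero, zero_mul, zero_smul,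
      sub_zero]
    refine h1.congr_fun ?_
    intro k
    rw [pow_succ', mul_smul_comm, Nat.cast_succ]
  refine (hasSum_dcomp (zX * a) hp).unique (((hasSum_comp a hp.le).add h2).congr_fun ?_)
  intro k
  rw [zX_mul_succ, ← add_smul]
  ring_nf

/-- The derivative of the `n`-th term of the series of `comp`. -/
def compTermD (n : ℕ) (q : X × A) : X × A →L[ℝ] A :=
  ((lp.evalCLM ℝ (fun _ : ℕ => ℝ) 1 n).comp (ContinuousLinearMap.fst ℝ X A)).smulRight (q.2 ^ n) +
    (q.1 n) • ((n • q.2 ^ (n - 1)) • ContinuousLinearMap.snd ℝ X A)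

theorem compTermD_apply (n : ℕ) (q h : X × A) :
    compTermD n q h = h.1 n • q.2 ^ n + q.1 n • ((n • q.2 ^ (n - 1)) * h.2) := rfl

theorem hasFDerivAt_compTerm (n : ℕ) (q : X × A) :
    HasFDerivAt (fun q : X × A => q.1 n • q.2 ^ n) (compTermD n q) q := by
  have h1 : HasFDerivAt (fun q : X × A => q.1 n)
      ((lp.evalCLM ℝ (fun _ : ℕ => ℝ) 1 n).comp (ContinuousLinearMap.fst ℝ X A)) q :=
    ((lp.evalCLM ℝ (fun _ : ℕ => ℝ) 1 n).comp (ContinuousLinearMap.fst ℝ X A)).hasFDerivAt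
  have h2 : HasFDerivAt (fun q : X × A => q.2 ^ n) _ q :=
    (hasFDerivAt_snd (𝕜 := ℝ) (p := q)).pow n
  refine (h1.smul h2).congr_fderiv ?_
  ext h <;> simp [compTermD, add_comm]

theorem norm_compTermD_le (n : ℕ) (q : X × A) {R ρ : ℝ} (hR : ‖q.1‖ ≤ R) (hρ : ‖q.2‖ ≤ ρ) :
    ‖compTermD n q‖ ≤ ρ ^ n + R * (n * ρ ^ (n - 1)) := by
  have hρ0 := (norm_nonneg _).trans hρ
  have hR0 := (norm_nonneg _).trans hR
  refine ContinuousLinearMap.opNorm_le_bound _ (by positivity) fun h => ?_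
  rw [compTermD_apply, add_mul]
  refine (norm_add_le _ _).trans (add_le_add ?_ ?_)
  · rw [norm_smul, mul_comm]
    exact mul_le_mul ((norm_pow_le _ _).trans (pow_le_pow_left₀ (norm_nonneg _) hρ n))
      ((abs_coeff_le _ _).trans (norm_fst_le h)) (norm_nonneg _) (by positivity)
  · rw [norm_smul, mul_assoc]
    refine mul_le_mul ((abs_coeff_le _ _).trans hR) ?_ (norm_nonneg _) hR0
    refine (norm_mul_le _ _).trans (mul_le_mul ?_ (norm_snd_le h) (norm_nonneg _) (by positivity))
    refine (norm_nsmul_le).trans ?_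
    gcongr
    exact (norm_pow_le _ _).trans (pow_le_pow_left₀ (norm_nonneg _) hρ _)

theorem summable_compTermD_bound {R ρ : ℝ} (h0 : 0 ≤ ρ) (h1 : ρ < 1) :
    Summable fun n : ℕ => ρ ^ n + R * (n * ρ ^ (n - 1)) := by
  refine (summable_geometric_of_lt_one h0 h1).add (Summable.mul_left R ?_)
  refine (summable_nat_add_iff 1).1 ?_
  have hn : ‖ρ‖ < 1 := by rwa [Real.norm_of_nonneg h0]
  have := (summable_pow_mul_geometric_of_norm_lt_one 1 hn).add
    (summable_geometric_of_lt_one h0 h1)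
  refine this.congr fun n => ?_
  simp; ring

theorem hasFDerivAt_comp (f : X) (p : A) (hp : ‖p‖ < 1) :
    ∃ L : X × A →L[ℝ] A, HasFDerivAt (fun q : X × A => comp q.1 q.2) L (f, p) ∧
      ∀ h, L h = comp h.1 p + dcomp f p * h.2 := by
  obtain ⟨ρ, hρ, hρ1⟩ := exists_between hp
  have hρ0 : 0 ≤ ρ := (norm_nonneg _).trans hρ.le
  set R := ‖f‖ + 1
  set t : Set (X × A) := Metric.ball (0 : X) R ×ˢ Metric.ball (0 : A) ρ
  have ht : (f, p) ∈ t := ⟨by simp [R], by simpa using hρ⟩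
  have hu := summable_compTermD_bound (R := R) hρ0 hρ1
  have hb : ∀ (n : ℕ) (x : X × A), x ∈ t → ‖compTermD n x‖ ≤ ρ ^ n + R * (n * ρ ^ (n - 1)) :=
    fun n x hx => norm_compTermD_le n x (mem_ball_zero_iff.1 hx.1).le (mem_ball_zero_iff.1 hx.2).le
  refine ⟨_, hasFDerivAt_tsum_of_isPreconnected (f := fun n (q : X × A) => q.1 n • q.2 ^ n)
    (f' := fun n q => compTermD n q) hu
    (Metric.isOpen_ball.prod Metric.isOpen_ball)
    ((convex_ball _ _).prod (convex_ball _ _)).isPreconnected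
    (fun n x _ => hasFDerivAt_compTerm n x) hb ht (hasSum_comp f hp.le).summable ht, fun h => ?_⟩
  have hs : Summable fun n => compTermD n (f, p) := .of_norm_bounded hu fun n => hb n _ ht
  have h1 := (hs.hasSum.mapL (ContinuousLinearMap.apply ℝ A h))
  refine h1.unique ?_
  have h2 : HasSum (fun n : ℕ => f n • ((n • p ^ (n - 1)) * h.2)) (dcomp f p * h.2) := by
    refine (hasSum_nat_add_iff' (f := fun n : ℕ => f n • ((n • p ^ (n - 1)) * h.2)) 1).1 ?_
    simp only [Finset.range_one, Finset.sum_singleton, zero_smul, zero_mul, smul_zero, sub_zero]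
    refine ((hasSum_dcomp f hp).mul_right h.2).congr_fun ?_
    intro k
    rw [Nat.add_sub_cancel, ← Nat.cast_smul_eq_nsmul ℝ, smul_mul_assoc, smul_mul_assoc, smul_smul]
    push_cast
    ring_nf
  exact (hasSum_comp h.1 hp.le).add h2

end Comp

/-! ### Evaluation on the unit disk -/

theorem ev_eq_comp (f : X) (w : ℂ) : ev f w = comp f w := by
  simp [ev, comp, Complex.real_smul]

theorem summable_norm_ev (f : X) {w : ℂ} (hw : ‖w‖ ≤ 1) :
    Summable fun k => ‖(f k : ℂ) * w ^ k‖ := by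
  simpa [Complex.real_smul] using summable_norm_comp f hw

theorem ev_mul (a b : X) {w : ℂ} (hw : ‖w‖ ≤ 1) : ev (a * b) w = ev a w * ev b w := by
  rw [ev, ev, ev, tsum_mul_tsum_eq_tsum_sum_antidiagonal_of_summable_norm
    (summable_norm_ev a hw) (summable_norm_ev b hw)]
  refine tsum_congr fun n => ?_
  rw [mul_coeff, Complex.ofReal_sum, Finset.sum_mul]
  refine Finset.sum_congr rfl fun p hp => ?_
  rw [← Finset.HasAntidiagonal.mem_antidiagonal.1 hp, pow_add]
  push_cast
  ring

/-- Evaluation at a point of the closed unit disk. -/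
def evHom (w : ℂ) (hw : ‖w‖ ≤ 1) : X →ₐ[ℝ] ℂ :=
  AlgHom.ofLinearMap (compL w hw).toLinearMap
    (by simpa [compL_apply] using comp_const (A := ℂ) 1 w)
    (fun a b => by simpa [ev_eq_comp, compL_apply] using ev_mul a b hw)

theorem evHom_apply (w : ℂ) (hw : ‖w‖ ≤ 1) (a : X) : evHom w hw a = ev a w :=
  (ev_eq_comp a w).symm

theorem continuous_evHom (w : ℂ) (hw : ‖w‖ ≤ 1) : Continuous (evHom w hw) :=
  (compL w hw).continuous

theorem norm_ev_le (a : X) {w : ℂ} (hw : ‖w‖ ≤ 1) : ‖ev a w‖ ≤ ‖a‖ := by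
  rw [ev_eq_comp]; exact norm_comp_le a hw

theorem ev_comp (f p : X) (hp : ‖p‖ ≤ 1) {w : ℂ} (hw : ‖w‖ ≤ 1) :
    ev (comp f p) w = ev f (ev p w) := by
  rw [← evHom_apply w hw, map_comp _ (continuous_evHom w hw) f hp, ev_eq_comp, evHom_apply]
  rw [evHom_apply]
  exact (norm_ev_le p hw).trans hp

theorem ev_zX {w : ℂ} (hw : ‖w‖ ≤ 1) : ev zX w = w := by
  simpa [ev_eq_comp] using comp_zX_pow 1 hw

theorem ev_zero (f : X) : ev f 0 = (f 0 : ℝ) := by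
  rw [ev, tsum_eq_single 0]
  · simp
  · intro k hk; simp [hk]

theorem ev_ofReal (f : X) {x : ℝ} (hx : ‖x‖ ≤ 1) : ev f x = (comp f x : ℝ) := by
  have := map_comp Complex.ofRealAm Complex.continuous_ofReal f hx
    (by simpa using hx)
  simpa [ev_eq_comp] using this.symm

theorem algebraMap_comp (f : X) {x : ℝ} (hx : ‖x‖ ≤ 1) :
    algebraMap ℝ X (comp f x) = comp f (algebraMap ℝ X x) :=
  map_comp (Algebra.ofId ℝ X) (algebraMapCLM ℝ X).continuous f hx
    (by simpa [Algebra.ofId_apply] using hx)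

theorem algebraMap_dcomp (f : X) {x : ℝ} (hx : ‖x‖ < 1) :
    algebraMap ℝ X (dcomp f x) = dcomp f (algebraMap ℝ X x) := by
  have h := (hasSum_dcomp f hx).mapL (algebraMapCLM ℝ X)
  refine h.unique ((hasSum_dcomp f (by simpa using hx)).congr_fun ?_)
  intro k
  simp [Algebra.smul_def]

theorem hasFPowerSeriesOnBall_ev (f : X) :
    HasFPowerSeriesOnBall (ev f)
      (FormalMultilinearSeries.ofScalars ℂ fun k => (f k : ℂ)) 0 1 where
  r_le := by
    refine ENNReal.le_of_forall_nnreal_lt fun r hr => ?_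
    refine FormalMultilinearSeries.le_radius_of_bound _ ‖f‖ fun n => ?_
    have hr1 : (r : ℝ) ≤ 1 := by exact_mod_cast (ENNReal.coe_lt_one_iff.1 hr).le
    rw [FormalMultilinearSeries.ofScalars_norm]
    refine (mul_le_of_le_one_right (norm_nonneg _) (pow_le_one₀ r.2 hr1)).trans ?_
    simpa using abs_coeff_le f n
  r_pos := one_pos
  hasSum := by
    intro y hy
    have hy' : ‖y‖ ≤ 1 := by
      have : ‖y‖ₑ < 1 := by simpa using hy
      have h1 : ‖y‖₊ ≤ 1 := (enorm_le_coe (r := 1)).1 (by simpa using this.le)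
      exact h1
    have := (summable_norm_ev f hy').of_norm.hasSum
    simpa [FormalMultilinearSeries.ofScalars_apply_eq, ev, mul_comm] using this

theorem continuousAt_ev (f : X) : ContinuousAt (ev f) 0 :=
  (hasFPowerSeriesOnBall_ev f).hasFPowerSeriesAt.continuousAt

theorem eq_of_ev_eq {f g : X} (h : ∀ w : ℂ, ‖w‖ < 1 → w ≠ 0 → ev f w = ev g w) : f = g := by
  have h1 : ev f =ᶠ[𝓝[≠] 0] ev g := by
    have : Metric.ball (0 : ℂ) 1 ∈ 𝓝[≠] (0 : ℂ) :=
      mem_nhdsWithin_of_mem_nhds (Metric.ball_mem_nhds _ one_pos)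
    filter_upwards [this, self_mem_nhdsWithin] with w hw hw'
    exact h w (mem_ball_zero_iff.1 hw) hw'
  have h2 : ev f =ᶠ[𝓝 0] ev g :=
    ((continuousAt_ev f).eventuallyEq_nhds_iff_eventuallyEq_nhdsNE (continuousAt_ev g)).1 h1
  have h3 := (hasFPowerSeriesOnBall_ev f).hasFPowerSeriesAt.eq_formalMultilinearSeries
    ((hasFPowerSeriesOnBall_ev g).hasFPowerSeriesAt.congr h2.symm)
  have h4 := FormalMultilinearSeries.ofScalars_series_injective ℂ ℂ h3
  exact lp.ext (funext fun k => by exact_mod_cast congrFun h4 k)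

end Lorenz
end

noncomputable section

namespace Lorenz

/-! ### The operator on coefficient sequences -/

/-- A constant as an element of `X`. -/
abbrev cst (x : ℝ) : X := algebraMap ℝ X x

/-- The argument at which `λ` is computed. -/
def laR (F : Y) : ℝ := 5 / 11 * (F.fst 0 ^ 2 - 1)

def lamR (F : Y) : ℝ := -comp F.fst (laR F)

def pX (F : Y) : X := cst (lamR F ^ 2) * (zX + cst (5 / 11)) - cst (5 / 11)

def aX (F : Y) : X := comp F.fst (pX F)

def f3X (F : Y) : X := 2 * aX F ^ 2

def gfX (F : Y) : X := comp F.snd (f3X F)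

def fhatX (F : Y) : X := cst (lamR F)⁻¹ * (aX F ^ 2 * gfX F - 1)

def pgX (F : Y) : X := cst (lamR F ^ 2) * zX

def gpX (F : Y) : X := comp F.snd (pgX F)

def qX (F : Y) : X := cst (1 / 2) * (pgX F * gpX F)

def g3X (F : Y) : X := cst (5 / 11) * (qX F * (qX F - 2))

def cX (F : Y) : X := comp F.fst (g3X F)

def g5X (F : Y) : X := cst (5 / 11) * (cX F ^ 2 - 1)

def hX (F : Y) : X := comp F.fst (g5X F)

def ghatX (F : Y) : X := (2 : ℝ) • shift (cst (lamR F)⁻¹ * hX F)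

/-- The operator `T` as a map of coefficient sequences. -/
def TX (F : Y) : Y := WithLp.toLp 1 (fhatX F, ghatX F)

/-- All the substitutions are into series of norm less than `1`. -/
structure Good (F : Y) : Prop where
  lam_ne : lamR F ≠ 0
  la_lt : |laR F| < 1
  p_lt : ‖pX F‖ < 1
  f3_lt : ‖f3X F‖ < 1
  pg_lt : ‖pgX F‖ < 1
  g3_lt : ‖g3X F‖ < 1
  g5_lt : ‖g5X F‖ < 1

section Eval

variable {F : Y} (hF : Good F)

theorem inv_s : (1 : ℂ) / s = 5 / 11 := by norm_num [s]

theorem lam_arg_eq (F : Y) : (ev F.fst 0 ^ 2 - 1) / s = (laR F : ℝ) := by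
  rw [ev_zero, laR, s]; push_cast; ring

include hF

theorem lam_eq : lam F = (lamR F : ℝ) := by
  rw [lam, lam_arg_eq, ev_ofReal _ hF.la_lt.le, lamR]; push_cast; ring

variable {w : ℂ} (hw : ‖w‖ ≤ 1)

include hw

theorem pf_eq : pf F w = ev (pX F) w := by
  rw [pf, lam_eq hF, inv_s, ← evHom_apply w hw, pX]
  simp only [map_sub, map_mul, map_add, AlgHom.commutes, evHom_apply, ev_zX hw]
  simp

theorem pg_eq : pg F w = ev (pgX F) w := by
  rw [pg, lam_eq hF, ← evHom_apply w hw, pgX]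
  simp only [map_mul, AlgHom.commutes, evHom_apply, ev_zX hw]
  simp

theorem f2_eq : f2 F w = ev (aX F ^ 2) w := by
  rw [f2, pf_eq hF hw, ← ev_comp _ _ hF.p_lt.le hw, ← evHom_apply w hw, ← evHom_apply w hw,
    map_pow, aX]

theorem f3_eq : f3 F w = ev (f3X F) w := by
  rw [f3, f2_eq hF hw, ← evHom_apply w hw, ← evHom_apply w hw, f3X, t]
  simp only [map_mul, map_pow, map_ofNat]
  ring

theorem g2_eq : g2 F w = ev (qX F) w := by
  rw [g2, pg_eq hF hw, ← ev_comp _ _ hF.pg_lt.le hw, ← evHom_apply w hw, ← evHom_apply w hw,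
    ← evHom_apply w hw, qX, t, gpX]
  simp only [map_mul, AlgHom.commutes]
  simp
  ring

theorem g3_eq : g3 F w = ev (g3X F) w := by
  rw [g3, g2_eq hF hw, ← evHom_apply w hw, ← evHom_apply w hw, g3X, s]
  simp only [map_mul, map_sub, AlgHom.commutes, map_ofNat]
  simp
  ring

theorem g5_eq : g5 F w = ev (g5X F) w := by
  rw [g5, g3_eq hF hw, ← ev_comp _ _ hF.g3_lt.le hw, ← evHom_apply w hw, ← evHom_apply w hw,
    g5X, s, cX]
  simp only [map_mul, map_sub, map_pow, AlgHom.commutes, map_one]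
  simp
  ring

end Eval

theorem Good.compositionsDefined {F : Y} (hF : Good F) : CompositionsDefined F where
  lam_ne_zero := by rw [lam_eq hF]; exact_mod_cast hF.lam_ne
  lam_arg := by rw [lam_arg_eq]; simpa using hF.la_lt
  pf_lt w hw := by rw [pf_eq hF hw]; exact (norm_ev_le _ hw).trans_lt hF.p_lt
  pg_lt w hw := by rw [pg_eq hF hw]; exact (norm_ev_le _ hw).trans_lt hF.pg_lt
  f3_lt w hw := by rw [f3_eq hF hw]; exact (norm_ev_le _ hw).trans_lt hF.f3_lt
  g3_lt w hw := by rw [g3_eq hF hw]; exact (norm_ev_le _ hw).trans_lt hF.g3_lt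
  g5_lt w hw := by rw [g5_eq hF hw]; exact (norm_ev_le _ hw).trans_lt hF.g5_lt

theorem hX_coeff_zero {F : Y} (hF : Good F) : hX F 0 = -lamR F := by
  have h0 : ‖(0 : ℂ)‖ ≤ 1 := by simp
  have h1 : ev (hX F) 0 = ev F.fst (g5 F 0) := by
    rw [hX, ev_comp _ _ hF.g5_lt.le h0, g5_eq hF h0]
  have h2 : g5 F 0 = (laR F : ℝ) := by
    have : g3 F 0 = 0 := by simp [g3, g2, pg]
    rw [g5, this, lam_arg_eq]
  rw [h2, ev_ofReal _ hF.la_lt.le, ev_zero] at h1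
  rw [lamR, neg_neg]
  exact_mod_cast h1

theorem Good.isRenormalization {F : Y} (hF : Good F) : IsRenormalization F (TX F) where
  defined := hF.compositionsDefined
  fst_eq w hw := by
    rw [lam_eq hF, f2_eq hF hw.le, f3_eq hF hw.le, ← ev_comp _ _ hF.f3_lt.le hw.le]
    change ev (fhatX F) w = _
    rw [← evHom_apply w hw.le, ← evHom_apply w hw.le, ← evHom_apply w hw.le, fhatX, gfX]
    simp only [map_mul, map_sub, map_pow, AlgHom.commutes, map_one, Complex.coe_algebraMap,
      Complex.ofReal_inv]
    ring
  snd_eq w hw hw0 := by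
    rw [lam_eq hF, g5_eq hF hw.le, ← ev_comp _ _ hF.g5_lt.le hw.le]
    change ev (ghatX F) w = 1 / (t * w) * (1 + _ * ev (hX F) w)
    have h1 := eq_const_add_zX_mul_shift (cst (lamR F)⁻¹ * hX F)
    have h2 : (cst (lamR F)⁻¹ * hX F) 0 = -1 := by
      rw [← Algebra.smul_def, smul_coeff, hX_coeff_zero hF, mul_neg, inv_mul_cancel₀ hF.lam_ne]
    rw [h2] at h1
    have h3 := congrArg (evHom w hw.le) h1
    simp only [map_mul, map_add, AlgHom.commutes, evHom_apply, ev_zX hw.le] at h3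
    have h4 : ev (ghatX F) w = 2 * ev (shift (cst (lamR F)⁻¹ * hX F)) w := by
      rw [← evHom_apply w hw.le, ghatX, map_smul, evHom_apply]; simp
    simp only [Complex.coe_algebraMap, Complex.ofReal_inv, Complex.ofReal_neg,
      Complex.ofReal_one] at h3
    rw [h4, h3, t]
    field_simp
    ring

theorem IsRenormalization.unique {F G G' : Y} (h : IsRenormalization F G)
    (h' : IsRenormalization F G') : G = G' := by
  refine WithLp.ofLp_injective 1 (Prod.ext ?_ ?_)
  · exact eq_of_ev_eq fun w hw _ => (h.fst_eq w hw).trans (h'.fst_eq w hw).symm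
  · exact eq_of_ev_eq fun w hw hw0 => (h.snd_eq w hw hw0).trans (h'.snd_eq w hw hw0).symm

theorem Good.T_eq {F : Y} (hF : Good F) : T F = TX F := by
  have h : ∃ G, IsRenormalization F G := ⟨_, hF.isRenormalization⟩
  rw [T, dif_pos h]
  exact h.choose_spec.unique hF.isRenormalization

/-! ### Derivatives -/

/-- `φ` is differentiable at `F` with derivative `h ↦ φ' h`. -/
def HasD {E : Type*} [NormedAddCommGroup E] [NormedSpace ℝ E] (φ φ' : Y → E) (F : Y) : Prop :=
  ∃ L : Y →L[ℝ] E, HasFDerivAt φ L F ∧ ∀ h, L h = φ' h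

namespace HasD

variable {E : Type*} [NormedAddCommGroup E] [NormedSpace ℝ E] {F : Y}

theorem continuousAt {φ φ' : Y → E} (h : HasD φ φ' F) : ContinuousAt φ F := by
  obtain ⟨L, h1, -⟩ := h
  exact h1.continuousAt

theorem of_clm (L : Y →L[ℝ] E) : HasD (fun F => L F) (fun h => L h) F :=
  ⟨L, L.hasFDerivAt, fun _ => rfl⟩

theorem clm {E' : Type*} [NormedAddCommGroup E'] [NormedSpace ℝ E'] (M : E →L[ℝ] E')
    {φ φ' : Y → E} (h : HasD φ φ' F) : HasD (fun F => M (φ F)) (fun h => M (φ' h)) F := by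
  obtain ⟨L, h1, h2⟩ := h
  exact ⟨M.comp L, M.hasFDerivAt.comp F h1, fun x => by simp [h2]⟩

theorem const (c : E) : HasD (fun _ => c) (fun _ => 0) F :=
  ⟨0, hasFDerivAt_const c F, fun _ => rfl⟩

theorem sub {φ φ' ψ ψ' : Y → E} (h : HasD φ φ' F) (k : HasD ψ ψ' F) :
    HasD (fun F => φ F - ψ F) (fun x => φ' x - ψ' x) F := by
  obtain ⟨L, h1, h2⟩ := h
  obtain ⟨M, k1, k2⟩ := k
  exact ⟨L - M, h1.sub k1, fun x => by simp [h2, k2]⟩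

theorem mul {A : Type*} [NormedCommRing A] [NormedAlgebra ℝ A] {φ φ' ψ ψ' : Y → A}
    (h : HasD φ φ' F) (k : HasD ψ ψ' F) :
    HasD (fun F => φ F * ψ F) (fun x => φ' x * ψ F + φ F * ψ' x) F := by
  obtain ⟨L, h1, h2⟩ := h
  obtain ⟨M, k1, k2⟩ := k
  refine ⟨_, h1.mul k1, fun x => ?_⟩
  simp [h2, k2]
  ring

theorem sq {A : Type*} [NormedCommRing A] [NormedAlgebra ℝ A] {φ φ' : Y → A}
    (h : HasD φ φ' F) : HasD (fun F => φ F ^ 2) (fun x => 2 * φ F * φ' x) F := by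
  obtain ⟨L, h1, h2⟩ := h.mul h
  simp only [pow_two]
  exact ⟨L, h1, fun x => by rw [h2]; ring⟩

theorem inv {φ φ' : Y → ℝ} (h : HasD φ φ' F) (h0 : φ F ≠ 0) :
    HasD (fun F => (φ F)⁻¹) (fun x => -((φ F)⁻¹ ^ 2 * φ' x)) F := by
  obtain ⟨L, h1, h2⟩ := h
  refine ⟨_, (hasDerivAt_inv h0).comp_hasFDerivAt F h1, fun x => ?_⟩
  simp [h2]

theorem subst {A : Type*} [NormedCommRing A] [NormedAlgebra ℝ A] [CompleteSpace A]
    [NormOneClass A] {φ φ' : Y → X} {p p' : Y → A} (h : HasD φ φ' F) (k : HasD p p' F)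
    (hp : ‖p F‖ < 1) :
    HasD (fun F => Lorenz.comp (φ F) (p F))
      (fun x => Lorenz.comp (φ' x) (p F) + dcomp (φ F) (p F) * p' x) F := by
  obtain ⟨L, h1, h2⟩ := h
  obtain ⟨M, k1, k2⟩ := k
  obtain ⟨N, n1, n2⟩ := hasFDerivAt_comp (φ F) (p F) hp
  refine ⟨N.comp (L.prod M), HasFDerivAt.comp (f := fun F => (φ F, p F)) F n1 (h1.prodMk k1),
    fun x => ?_⟩
  rw [ContinuousLinearMap.comp_apply, n2]
  simp [h2, k2]

theorem pair {φ φ' ψ ψ' : Y → X} (h : HasD φ φ' F) (k : HasD ψ ψ' F) :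
    HasD (fun F => (WithLp.toLp 1 (φ F, ψ F) : Y)) (fun x => WithLp.toLp 1 (φ' x, ψ' x)) F := by
  obtain ⟨L, h1, h2⟩ := h
  obtain ⟨M, k1, k2⟩ := k
  let e := (WithLp.prodContinuousLinearEquiv 1 ℝ X X).symm.toContinuousLinearMap
  refine ⟨e.comp (L.prod M), (e.hasFDerivAt (x := (φ F, ψ F))).comp F (h1.prodMk k1), fun x => ?_⟩
  change WithLp.toLp 1 (L x, M x) = _
  rw [h2, k2]

theorem congr {φ φ' ψ' : Y → E} (h : HasD φ φ' F) (hd : ∀ x, φ' x = ψ' x) : HasD φ ψ' F := by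
  obtain ⟨L, h1, h2⟩ := h
  exact ⟨L, h1, fun x => (h2 x).trans (hd x)⟩

end HasD

section Derivative

variable {F : Y}

theorem hasD_fst : HasD (fun F : Y => F.fst) (fun h => h.fst) F :=
  HasD.of_clm (WithLp.fstL 1 ℝ X X)

theorem hasD_snd : HasD (fun F : Y => F.snd) (fun h => h.snd) F :=
  HasD.of_clm (WithLp.sndL 1 ℝ X X)

theorem HasD.cst {φ φ' : Y → ℝ} (h : HasD φ φ' F) :
    HasD (fun F => Lorenz.cst (φ F)) (fun x => Lorenz.cst (φ' x)) F :=
  h.clm (algebraMapCLM ℝ X)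

def dlaR (F h : Y) : ℝ := 5 / 11 * (2 * F.fst 0 * h.fst 0)

theorem hasD_laR : HasD laR (dlaR F) F := by
  have h := hasD_fst (F := F) |>.clm (lp.evalCLM ℝ (fun _ : ℕ => ℝ) 1 0)
  refine ((HasD.const (5 / 11 : ℝ)).mul (h.sq.sub (HasD.const (1 : ℝ)))).congr fun x => ?_
  change 0 * _ + 5 / 11 * (2 * F.fst 0 * x.fst 0 - 0) = _
  rw [dlaR]; ring

/-- The derivative of `λ`. -/
def dlamR (F h : Y) : ℝ := -comp h.fst (laR F) - dcomp F.fst (laR F) * dlaR F h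

variable (hF : Good F)

include hF

theorem hasD_lamR : HasD lamR (dlamR F) F := by
  have h := (HasD.const (0 : ℝ)).sub (hasD_fst.subst (hasD_laR (F := F)) hF.la_lt)
  simp only [zero_sub] at h
  exact h.congr fun x => by rw [dlamR]; ring

theorem hasD_pX : HasD pX (fun h => cst (2 * lamR F * dlamR F h) * (zX + cst (5 / 11))) F :=
  (((hasD_lamR hF).sq.cst.mul (HasD.const (zX + cst (5 / 11)))).sub
    (HasD.const (cst (5 / 11)))).congr fun x => by ring

def daX (F h : Y) : X := comp h.fst (pX F) +
  dcomp F.fst (pX F) * (cst (2 * lamR F * dlamR F h) * (zX + cst (5 / 11)))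

theorem hasD_aX : HasD aX (daX F) F := hasD_fst.subst (hasD_pX hF) hF.p_lt

theorem hasD_f3X : HasD f3X (fun h => 2 * (2 * aX F * daX F h)) F :=
  ((HasD.const (2 : X)).mul (hasD_aX hF).sq).congr fun x => by ring

theorem hasD_gfX : HasD gfX (fun h => comp h.snd (f3X F) +
    dcomp F.snd (f3X F) * (2 * (2 * aX F * daX F h))) F :=
  hasD_snd.subst (hasD_f3X hF) hF.f3_lt

theorem hasD_cst_inv : HasD (fun F => cst (lamR F)⁻¹)
    (fun h => -(cst (lamR F)⁻¹ ^ 2 * cst (dlamR F h))) F :=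
  ((hasD_lamR hF).inv hF.lam_ne).cst.congr fun x => by simp only [map_neg, map_mul, map_pow]

theorem hasD_pgX : HasD pgX (fun h => cst (2 * lamR F * dlamR F h) * zX) F :=
  ((hasD_lamR hF).sq.cst.mul (HasD.const zX)).congr fun x => by ring

theorem hasD_gpX : HasD gpX (fun h => comp h.snd (pgX F) +
    dcomp F.snd (pgX F) * (cst (2 * lamR F * dlamR F h) * zX)) F :=
  hasD_snd.subst (hasD_pgX hF) hF.pg_lt

def dqX (F h : Y) : X := cst (1 / 2) * (cst (2 * lamR F * dlamR F h) * zX * gpX F +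
  pgX F * (comp h.snd (pgX F) + dcomp F.snd (pgX F) * (cst (2 * lamR F * dlamR F h) * zX)))

theorem hasD_qX : HasD qX (dqX F) F :=
  ((HasD.const (cst (1 / 2))).mul ((hasD_pgX hF).mul (hasD_gpX hF))).congr fun x => by
    rw [dqX]; ring

theorem hasD_g3X : HasD g3X (fun h => cst (5 / 11) * (2 * (qX F - 1) * dqX F h)) F :=
  ((HasD.const (cst (5 / 11))).mul ((hasD_qX hF).mul
    ((hasD_qX hF).sub (HasD.const (2 : X))))).congr fun x => by ring

def dcX (F h : Y) : X := comp h.fst (g3X F) +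
  dcomp F.fst (g3X F) * (cst (5 / 11) * (2 * (qX F - 1) * dqX F h))

theorem hasD_cX : HasD cX (dcX F) F := hasD_fst.subst (hasD_g3X hF) hF.g3_lt

theorem hasD_g5X : HasD g5X (fun h => cst (5 / 11) * (2 * cX F * dcX F h)) F :=
  ((HasD.const (cst (5 / 11))).mul ((hasD_cX hF).sq.sub (HasD.const (1 : X)))).congr
    fun x => by ring

theorem hasD_hX : HasD hX (fun h => comp h.fst (g5X F) +
    dcomp F.fst (g5X F) * (cst (5 / 11) * (2 * cX F * dcX F h))) F :=
  hasD_fst.subst (hasD_g5X hF) hF.g5_lt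

omit hF

/-! The derivative of the operator is
`(a, b) ↦ (a₁ · a∘p + c₁ · b∘f₃ + δλ · b₁, 2 S(λ⁻¹ · a∘g₅ + a₂ · a∘g₃ + c₂ · b∘p_g + δλ · b₂))`. -/

def coefA1 (F : Y) : X :=
  2 * (cst (lamR F)⁻¹ * (aX F * (gfX F + 2 * (aX F ^ 2 * dcomp F.snd (f3X F)))))

def coefC1 (F : Y) : X := cst (lamR F)⁻¹ * aX F ^ 2

def coefB1 (F : Y) : X :=
  coefA1 F * (dcomp F.fst (pX F) * (2 * cst (lamR F) * (zX + cst (5 / 11)))) -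
    cst (lamR F)⁻¹ * fhatX F

def coefA2 (F : Y) : X :=
  cst (lamR F)⁻¹ * (dcomp F.fst (g5X F) * (2 * cst (5 / 11) * cX F))

def coefW (F : Y) : X :=
  coefA2 F * (dcomp F.fst (g3X F) * (cst (5 / 11) * (qX F - 1)))

def coefC2 (F : Y) : X := coefW F * pgX F

def coefB2 (F : Y) : X :=
  coefW F * (2 * cst (lamR F) * (zX * (gpX F + pgX F * dcomp F.snd (pgX F)))) -
    cst (lamR F)⁻¹ * (cst (lamR F)⁻¹ * hX F)

def dfst (F h : Y) : X :=
  coefA1 F * comp h.fst (pX F) + coefC1 F * comp h.snd (f3X F) + cst (dlamR F h) * coefB1 F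

def dsnd (F h : Y) : X :=
  (2 : ℝ) • shift (cst (lamR F)⁻¹ * comp h.fst (g5X F) + coefA2 F * comp h.fst (g3X F) +
    coefC2 F * comp h.snd (pgX F) + cst (dlamR F h) * coefB2 F)

include hF

theorem hasD_fhatX : HasD fhatX (dfst F) F := by
  refine ((hasD_cst_inv hF).mul (((hasD_aX hF).sq.mul (hasD_gfX hF)).sub
    (HasD.const (1 : X)))).congr fun x => ?_
  simp only [dfst, coefA1, coefC1, coefB1, daX, map_mul, map_ofNat, fhatX]
  ring

theorem hasD_ghatX : HasD ghatX (dsnd F) F := by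
  refine (((hasD_cst_inv hF).mul (hasD_hX hF)).clm ((2 : ℝ) • shift)).congr fun x => ?_
  have h2 : cst (1 / 2) * 2 = 1 := by
    rw [← map_ofNat (algebraMap ℝ X) 2, ← map_mul]; norm_num
  simp only [dsnd, smul_apply]
  congr 2
  simp only [coefA2, coefC2, coefB2, coefW, dcX, dqX, map_mul, map_ofNat]
  linear_combination (dcomp F.fst (g5X F) * cst (lamR F)⁻¹ * cst (5 / 11) ^ 2 * 2 * cX F *
    dcomp F.fst (g3X F) * (qX F - 1) * (2 * cst (lamR F) * cst (dlamR F x) * zX * gpX F +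
    pgX F * (comp x.snd (pgX F) + dcomp F.snd (pgX F) *
      (2 * cst (lamR F) * cst (dlamR F x) * zX)))) * h2

/-- The derivative of the operator. -/
theorem hasD_TX : HasD TX (fun h => WithLp.toLp 1 (dfst F h, dsnd F h)) F :=
  (hasD_fhatX hF).pair (hasD_ghatX hF)

theorem Good.eventually : ∀ᶠ G in 𝓝 F, Good G := by
  have e1 := (hasD_lamR hF).continuousAt.eventually_ne hF.lam_ne
  have e2 := (hasD_laR (F := F)).continuousAt.abs.eventually_lt continuousAt_const hF.la_lt
  have e3 := (hasD_pX hF).continuousAt.norm.eventually_lt continuousAt_const hF.p_lt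
  have e4 := (hasD_f3X hF).continuousAt.norm.eventually_lt continuousAt_const hF.f3_lt
  have e5 := (hasD_pgX hF).continuousAt.norm.eventually_lt continuousAt_const hF.pg_lt
  have e6 := (hasD_g3X hF).continuousAt.norm.eventually_lt continuousAt_const hF.g3_lt
  have e7 := (hasD_g5X hF).continuousAt.norm.eventually_lt continuousAt_const hF.g5_lt
  filter_upwards [e1, e2, e3, e4, e5, e6, e7] with G h1 h2 h3 h4 h5 h6 h7
  exact ⟨h1, h2, h3, h4, h5, h6, h7⟩

theorem Good.mem_interior : F ∈ interior domT :=
  mem_interior_iff_mem_nhds.2 (hF.eventually.mono fun _ hG => ⟨_, hG.isRenormalization⟩)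

theorem Good.hasD_T : HasD T (fun h => WithLp.toLp 1 (dfst F h, dsnd F h)) F := by
  obtain ⟨L, h1, h2⟩ := hasD_TX hF
  exact ⟨L, h1.congr_of_eventuallyEq (hF.eventually.mono fun _ hG => hG.T_eq), h2⟩

theorem Good.differentiableAt_T : DifferentiableAt ℝ T F := by
  obtain ⟨L, h1, -⟩ := hF.hasD_T
  exact h1.differentiableAt

theorem Good.fderiv_T_apply (h : Y) :
    fderiv ℝ T F h = WithLp.toLp 1 (dfst F h, dsnd F h) := by
  obtain ⟨L, h1, h2⟩ := hF.hasD_T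
  rw [h1.fderiv, h2]

end Derivative

end Lorenz
end

noncomputable section

namespace Lorenz

/-! ### Resolvents of finite-rank operators -/

section Resolvent

variable {𝕜 : Type*} [RCLike 𝕜] {ι : Type*} [Fintype ι] [DecidableEq ι]

/-- Row `i` of the matrix `K` stays at distance at least `μ i` from diagonal degeneracy of
`z - K`, for all `z` on the unit circle. -/
def RowDominant (K : Matrix ι ι 𝕜) (μ : ι → ℝ) : Prop :=
  ∀ i, 0 < μ i ∧ μ i + ∑ j ∈ Finset.univ.erase i, ‖K i j‖ ≤ |1 - ‖K i i‖|

theorem RowDominant.norm_le {K : Matrix ι ι 𝕜} {μ : ι → ℝ} (hK : RowDominant K μ) {z : 𝕜}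
    (hz : ‖z‖ = 1) {x : ι → 𝕜} {c : ℝ}
    (h : ∀ i, ‖z * x i - ∑ j, K i j * x j‖ ≤ c * μ i) (i : ι) : ‖x i‖ ≤ c := by
  obtain ⟨m, -, hm⟩ := Finset.exists_max_image Finset.univ (fun i => ‖x i‖) ⟨i, Finset.mem_univ i⟩
  refine (hm i (Finset.mem_univ i)).trans ?_
  have h1 : |1 - ‖K m m‖| ≤ ‖z - K m m‖ := by
    rw [← hz]; exact abs_norm_sub_norm_le z (K m m)
  have h2 : ‖∑ j ∈ Finset.univ.erase m, K m j * x j‖ ≤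
      (∑ j ∈ Finset.univ.erase m, ‖K m j‖) * ‖x m‖ := by
    rw [Finset.sum_mul]
    refine (norm_sum_le _ _).trans (Finset.sum_le_sum fun j _ => ?_)
    rw [norm_mul]
    exact mul_le_mul_of_nonneg_left (hm j (Finset.mem_univ j)) (norm_nonneg _)
  have h3 : z * x m - ∑ j, K m j * x j =
      (z - K m m) * x m - ∑ j ∈ Finset.univ.erase m, K m j * x j := by
    rw [← Finset.add_sum_erase _ _ (Finset.mem_univ m)]; ring
  have h4 := norm_sub_norm_le ((z - K m m) * x m) (∑ j ∈ Finset.univ.erase m, K m j * x j)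
  rw [← h3, norm_mul] at h4
  have h5 := h m
  obtain ⟨h6, h7⟩ := hK m
  have h8 : (μ m + ∑ j ∈ Finset.univ.erase m, ‖K m j‖) * ‖x m‖ ≤ ‖z - K m m‖ * ‖x m‖ :=
    mul_le_mul_of_nonneg_right (h7.trans h1) (norm_nonneg _)
  have h9 : ‖x m‖ * μ m ≤ c * μ m := by nlinarith
  exact le_of_mul_le_mul_right h9 h6

theorem smul_one_sub_mulVec (K : Matrix ι ι 𝕜) (z : 𝕜) (x : ι → 𝕜) (i : ι) :
    ((z • (1 : Matrix ι ι 𝕜) - K).mulVec x) i = z * x i - ∑ j, K i j * x j := by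
  rw [Matrix.sub_mulVec, Matrix.smul_mulVec, Matrix.one_mulVec]; rfl

theorem RowDominant.isUnit {K : Matrix ι ι 𝕜} {μ : ι → ℝ} (hK : RowDominant K μ) {z : 𝕜}
    (hz : ‖z‖ = 1) : IsUnit (z • (1 : Matrix ι ι 𝕜) - K) := by
  rw [← Matrix.mulVec_injective_iff_isUnit]
  refine (injective_iff_map_eq_zero (Matrix.mulVecLin (z • (1 : Matrix ι ι 𝕜) - K))).2 ?_
  intro x hx
  funext i
  refine norm_le_zero_iff.1 (hK.norm_le hz (x := x) (c := 0) (fun i => ?_) i)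
  rw [← smul_one_sub_mulVec, ← Matrix.mulVecLin_apply, hx]; simp

variable {E : Type*} [NormedAddCommGroup E] [NormedSpace 𝕜 E]

/-- The operator `y ↦ ∑ i, v i y • u i`. -/
def finRank (u : ι → E) (v : ι → E →L[𝕜] 𝕜) : E →L[𝕜] E := ∑ i, (v i).smulRight (u i)

omit [DecidableEq ι] in
theorem finRank_apply (u : ι → E) (v : ι → E →L[𝕜] 𝕜) (y : E) :
    finRank u v y = ∑ i, v i y • u i := by
  simp [finRank]

theorem resolvent_bound (u : ι → E) (v : ι → E →L[𝕜] 𝕜) {μ : ι → ℝ}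
    (hK : RowDominant (Matrix.of fun i j => v i (u j)) μ) {z : 𝕜} (hz : ‖z‖ = 1) :
    IsUnit (finRank u v - z • 1) ∧ ∀ (y : E) (c : ℝ), (∀ i, ‖v i y‖ ≤ c * μ i) →
      ‖Ring.inverse (finRank u v - z • 1) y‖ ≤ ‖y‖ + c * ∑ i, ‖u i‖ := by
  set K : Matrix ι ι 𝕜 := Matrix.of fun i j => v i (u j)
  set B := z • (1 : Matrix ι ι 𝕜) - K
  have hz0 : z ≠ 0 := fun h => by simp [h] at hz
  have hB : IsUnit B.det := (Matrix.isUnit_iff_isUnit_det _).1 (hK.isUnit hz)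
  have hBv : ∀ (x : ι → 𝕜) i, (B.mulVec x) i = z * x i - ∑ j, K i j * x j :=
    smul_one_sub_mulVec K z
  let w : ι → E →L[𝕜] 𝕜 := fun j => ∑ i, B⁻¹ j i • v i
  have hw : ∀ y j, w j y = (B⁻¹.mulVec fun i => v i y) j := fun y j => by
    simp [w, Matrix.mulVec, dotProduct]
  have hBw : ∀ y i, z * w i y - ∑ j, K i j * w j y = v i y := fun y i => by
    rw [← hBv (fun j => w j y) i]
    simp only [hw]
    rw [Matrix.mulVec_mulVec, Matrix.mul_nonsing_inv _ hB, Matrix.one_mulVec]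
  let R : E →L[𝕜] E := -z⁻¹ • (1 + finRank u w)
  have hR : ∀ y, R y = -z⁻¹ • (y + ∑ i, w i y • u i) := fun y => by
    simp [R, finRank_apply]
  have h1 : (finRank u v - z • 1) * R = 1 := by
    ext y
    have hv : ∀ i, v i (R y) = -w i y := fun i => by
      have h := hBw y i
      have : ∑ j, w j y * v i (u j) = ∑ j, K i j * w j y :=
        Finset.sum_congr rfl fun j _ => mul_comm _ _
      rw [hR, map_smul, map_add, map_sum]
      simp only [map_smul, smul_eq_mul]
      rw [this, ← h]
      field_simp
      ring
    change finRank u v (R y) - z • R y = y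
    rw [finRank_apply]
    simp only [hv, neg_smul, Finset.sum_neg_distrib]
    rw [hR, smul_smul, mul_neg, mul_inv_cancel₀ hz0, neg_smul, one_smul]
    abel
  have h2 : R * (finRank u v - z • 1) = 1 := by
    ext y
    have hww : ∀ j, w j (finRank u v y - z • y) = -v j y := fun j => by
      rw [hw]
      have : (fun i => v i (finRank u v y - z • y)) = B.mulVec fun i => -v i y := by
        funext i
        rw [hBv, finRank_apply, map_sub, map_sum, map_smul]
        simp only [map_smul, smul_eq_mul, mul_neg, Finset.sum_neg_distrib]
        have : ∑ j, v j y * v i (u j) = ∑ j, K i j * v j y :=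
          Finset.sum_congr rfl fun j _ => mul_comm _ _
        rw [this]; ring
      rw [this, Matrix.mulVec_mulVec, Matrix.nonsing_inv_mul _ hB, Matrix.one_mulVec]
    change R (finRank u v y - z • y) = y
    rw [hR]
    simp only [hww, neg_smul, Finset.sum_neg_distrib]
    rw [finRank_apply, ← sub_eq_add_neg, sub_sub_cancel_left, smul_neg, smul_smul,
      inv_mul_cancel₀ hz0]
    simp
  have hinv : Ring.inverse (finRank u v - z • 1) = R :=
    Ring.inverse_unit (⟨finRank u v - z • 1, R, h1, h2⟩ : (E →L[𝕜] E)ˣ)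
  refine ⟨⟨⟨finRank u v - z • 1, R, h1, h2⟩, rfl⟩, fun y c hc => ?_⟩
  rw [hinv, hR, norm_smul, norm_neg, norm_inv, hz, inv_one, one_mul]
  have hx : ∀ i, ‖w i y‖ ≤ c := hK.norm_le hz (x := fun i => w i y) fun i => by
    rw [hBw]; exact hc i
  refine (norm_add_le _ _).trans (add_le_add le_rfl ((norm_sum_le _ _).trans ?_))
  rw [Finset.mul_sum]
  refine Finset.sum_le_sum fun i _ => ?_
  rw [norm_smul]
  exact mul_le_mul_of_nonneg_right (hx i) (norm_nonneg _)

end Resolvent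

/-! ### Operator norms through columns -/

section Columns

variable {𝕜 : Type} [RCLike 𝕜] {E : Type*} [NormedAddCommGroup E] [NormedSpace 𝕜 E]

theorem norm_pair (a b : L1 𝕜) : ‖(WithLp.toLp 1 (a, b) : WithLp 1 (L1 𝕜 × L1 𝕜))‖ = ‖a‖ + ‖b‖ := by
  simp [WithLp.prod_norm_eq_of_L1]

theorem norm_map_le_of_single {L : L1 𝕜 →L[𝕜] E} {C : ℝ}
    (h : ∀ k, ‖L (lp.single 1 k 1)‖ ≤ C) (a : L1 𝕜) : ‖L a‖ ≤ C * ‖a‖ := by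
  have h1 := (lp.hasSum_single (by simp) a).mapL L
  have h2 : ∀ k, ‖L (lp.single 1 k (a k))‖ ≤ C * ‖a k‖ := fun k => by
    have : lp.single 1 k (a k) = a k • (lp.single 1 k 1 : L1 𝕜) := by
      rw [← lp.single_smul]; simp
    rw [this, map_smul, norm_smul, mul_comm]
    exact mul_le_mul_of_nonneg_right (h k) (norm_nonneg _)
  have h3 := (summable_norm a).mul_left C
  rw [← h1.tsum_eq, norm_eq_tsum, ← tsum_mul_left]
  exact tsum_of_norm_bounded h3.hasSum h2

theorem opNorm_le_of_columns {L : WithLp 1 (L1 𝕜 × L1 𝕜) →L[𝕜] E} {C : ℝ} (hC : 0 ≤ C)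
    (h1 : ∀ k, ‖L (WithLp.toLp 1 (lp.single 1 k 1, 0))‖ ≤ C)
    (h2 : ∀ k, ‖L (WithLp.toLp 1 (0, lp.single 1 k 1))‖ ≤ C) : ‖L‖ ≤ C := by
  let e := (WithLp.prodContinuousLinearEquiv 1 𝕜 (L1 𝕜) (L1 𝕜)).symm.toContinuousLinearMap
  refine L.opNorm_le_bound hC fun y => ?_
  have hy : y = e (ContinuousLinearMap.inl 𝕜 _ _ y.fst) + e (ContinuousLinearMap.inr 𝕜 _ _ y.snd) := by
    rw [← map_add]
    exact WithLp.ofLp_injective 1 (Prod.ext (by simp [e]) (by simp [e]))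
  have k1 := norm_map_le_of_single (L := L.comp (e.comp (ContinuousLinearMap.inl 𝕜 _ _))) h1 y.fst
  have k2 := norm_map_le_of_single (L := L.comp (e.comp (ContinuousLinearMap.inr 𝕜 _ _))) h2 y.snd
  calc ‖L y‖ ≤ C * ‖y.fst‖ + C * ‖y.snd‖ := by
        conv_lhs => rw [hy, map_add]
        exact (norm_add_le _ _).trans (add_le_add k1 k2)
    _ = C * ‖y‖ := by rw [WithLp.prod_norm_eq_of_L1]; ring

end Columns

/-! ### Complexification -/

theorem reY_inclY (y : Y) : reY (inclY y) = y :=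
  WithLp.ofLp_injective 1 (Prod.ext (lp.ext (funext fun k => Complex.ofReal_re (y.fst k)))
    (lp.ext (funext fun k => Complex.ofReal_re (y.snd k))))

theorem imY_inclY (y : Y) : imY (inclY y) = 0 :=
  WithLp.ofLp_injective 1 (Prod.ext (lp.ext (funext fun k => Complex.ofReal_im (y.fst k)))
    (lp.ext (funext fun k => Complex.ofReal_im (y.snd k))))

theorem complexify_inclY (L : Y →L[ℝ] Y) (y : Y) : complexify L (inclY y) = inclY (L y) := by
  change inclY (L (reY (inclY y))) + Complex.I • inclY (L (imY (inclY y))) = _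
  rw [reY_inclY, imY_inclY]; simp

theorem norm_inclY (y : Y) : ‖inclY y‖ = ‖y‖ := by
  rw [WithLp.prod_norm_eq_of_L1, WithLp.prod_norm_eq_of_L1, norm_eq_tsum, norm_eq_tsum,
    norm_eq_tsum, norm_eq_tsum]
  congr 1
  · exact tsum_congr fun k => Complex.norm_real (y.fst k)
  · exact tsum_congr fun k => Complex.norm_real (y.snd k)

theorem inclY_single_fst (k : ℕ) :
    inclY (WithLp.toLp 1 (lp.single 1 k 1, 0)) = WithLp.toLp 1 (lp.single 1 k 1, 0) := by
  refine WithLp.ofLp_injective 1 (Prod.ext (lp.ext (funext fun n => ?_))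
    (lp.ext (funext fun n => Complex.ofReal_zero)))
  change (((lp.single 1 k (1 : ℝ) : L1 ℝ) n : ℝ) : ℂ) = (lp.single 1 k (1 : ℂ) : L1 ℂ) n
  rw [lp.single_apply, lp.single_apply, Pi.single_apply, Pi.single_apply]
  split_ifs <;> simp

theorem inclY_single_snd (k : ℕ) :
    inclY (WithLp.toLp 1 (0, lp.single 1 k 1)) = WithLp.toLp 1 (0, lp.single 1 k 1) := by
  refine WithLp.ofLp_injective 1 (Prod.ext (lp.ext (funext fun n => Complex.ofReal_zero))
    (lp.ext (funext fun n => ?_)))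
  change (((lp.single 1 k (1 : ℝ) : L1 ℝ) n : ℝ) : ℂ) = (lp.single 1 k (1 : ℂ) : L1 ℂ) n
  rw [lp.single_apply, lp.single_apply, Pi.single_apply, Pi.single_apply]
  split_ifs <;> simp

/-- The complex-linear extension of a functional. -/
def complexifyFn (v : Y →L[ℝ] ℝ) : YC →L[ℂ] ℂ where
  toFun h := (v (reY h) : ℂ) + Complex.I * (v (imY h) : ℂ)
  map_add' h h' := by
    simp only [map_add, Complex.ofReal_add]; ring
  map_smul' c h := by
    simp only [reY_smul, imY_smul, map_add, map_sub, map_smul, RingHom.id_apply, smul_eq_mul]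
    conv_rhs => rw [← Complex.re_add_im c]
    push_cast
    linear_combination (-(c.im : ℂ) * v (imY h)) * Complex.I_mul_I
  cont := by fun_prop

theorem complexifyFn_inclY (v : Y →L[ℝ] ℝ) (y : Y) : complexifyFn v (inclY y) = (v y : ℝ) := by
  change (v (reY (inclY y)) : ℂ) + Complex.I * (v (imY (inclY y)) : ℂ) = _
  rw [reY_inclY, imY_inclY]; simp

theorem complexify_finRank {ι : Type*} [Fintype ι] (u : ι → Y) (v : ι → Y →L[ℝ] ℝ) :
    complexify (finRank u v) = finRank (fun i => inclY (u i)) (fun i => complexifyFn (v i)) := by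
  ext h : 1
  have hc : ∀ (x : ℝ) (v : YC), x • v = (x : ℂ) • v := fun x v => rfl
  change inclY (finRank u v (reY h)) + Complex.I • inclY (finRank u v (imY h)) = _
  rw [finRank_apply, finRank_apply, finRank_apply, map_sum, map_sum, Finset.smul_sum,
    ← Finset.sum_add_distrib]
  refine Finset.sum_congr rfl fun i _ => ?_
  change _ = ((v i (reY h) : ℂ) + Complex.I * (v i (imY h) : ℂ)) • _
  rw [map_smul, map_smul, hc, hc, smul_smul, ← add_smul]

/-- The basis vectors `(z^k, 0)` and `(0, z^k)`. -/
def basisY : Set Y := {e | ∃ k : ℕ, e = WithLp.toLp 1 (lp.single 1 k 1, 0) ∨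
  e = WithLp.toLp 1 (0, lp.single 1 k 1)}

/-- If every column `y` of `L` satisfies the resolvent estimate, the preconditioned operators have
small norm, for all `z` on the unit circle. -/
theorem norm_resolvent_mul_le {ι : Type*} [Fintype ι] [DecidableEq ι] (u : ι → Y)
    (v : ι → Y →L[ℝ] ℝ) {μ : ι → ℝ} (hK : RowDominant (Matrix.of fun i j => v i (u j)) μ)
    {L : Y →L[ℝ] Y} {C : ℝ} (hC : 0 ≤ C)
    (h : ∀ e ∈ basisY,
      ∃ c : ℝ, (∀ i, |v i (L e)| ≤ c * μ i) ∧ ‖L e‖ + c * ∑ i, ‖u i‖ ≤ C) :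
    ‖Ring.inverse (finRank u v - 1) * L‖ ≤ C ∧ ∀ z : ℂ, ‖z‖ = 1 →
      IsUnit (complexify (finRank u v) - z • 1) ∧
      ‖Ring.inverse (complexify (finRank u v) - z • 1) * complexify L‖ ≤ C := by
  constructor
  · have hR := (resolvent_bound u v hK (z := (1 : ℝ)) (by simp)).2
    rw [one_smul] at hR
    have : ∀ e ∈ basisY, ‖(Ring.inverse (finRank u v - 1) * L) e‖ ≤ C :=
      fun e he => by
        obtain ⟨c, h1, h2⟩ := h e he
        exact (hR (L e) c h1).trans h2
    exact opNorm_le_of_columns hC (fun k => this _ ⟨k, Or.inl rfl⟩) fun k => this _ ⟨k, Or.inr rfl⟩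
  · intro z hz
    rw [complexify_finRank]
    have hK' : RowDominant
        (Matrix.of fun i j => complexifyFn (v i) (inclY (u j))) μ := fun i => by
      have := hK i
      simpa [complexifyFn_inclY] using this
    obtain ⟨hU, hR⟩ := resolvent_bound (fun i => inclY (u i)) (fun i => complexifyFn (v i)) hK' hz
    refine ⟨hU, ?_⟩
    have : ∀ e ∈ basisY,
      ‖(Ring.inverse (finRank (fun i => inclY (u i)) (fun i => complexifyFn (v i)) - z • 1) *
        complexify L) (inclY e)‖ ≤ C := fun e he => by
      obtain ⟨c, h1, h2⟩ := h e he
      rw [ContinuousLinearMap.mul_def, ContinuousLinearMap.comp_apply, complexify_inclY]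
      refine (hR (inclY (L e)) c fun i => ?_).trans ?_
      · rw [complexifyFn_inclY, Complex.norm_real]; exact h1 i
      · simpa only [norm_inclY] using h2
    refine opNorm_le_of_columns hC (fun k => ?_) fun k => ?_
    · rw [← inclY_single_fst]; exact this _ ⟨k, Or.inl rfl⟩
    · rw [← inclY_single_snd]; exact this _ ⟨k, Or.inr rfl⟩

end Lorenz
end

noncomputable section

namespace Lorenz

/-! ### Ball arithmetic in the Banach algebra

A ball has a polynomial with coefficients in `2⁻⁶⁴ ℤ` as its centre, and a radius in `2⁻⁶⁴ ℕ`. All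
operations are computed by the kernel; `force` makes it evaluate shared values only once. -/

/-- The common denominator `2 ^ 64`. -/
def scale : ℕ := 18446744073709551616

theorem scale_pos : (0 : ℝ) < scale := by norm_num [scale]

def forceNat {α : Type} (n : ℕ) (k : ℕ → α) : α :=
  match n with
  | 0 => k 0
  | Nat.succ m => k (Nat.succ m)

theorem forceNat_eq {α : Type} (n : ℕ) (k : ℕ → α) : forceNat n k = k n := by
  cases n <;> rfl

def forceInt {α : Type} (z : ℤ) (k : ℤ → α) : α :=
  match z with
  | Int.ofNat n => forceNat n fun n => k (Int.ofNat n)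
  | Int.negSucc n => forceNat n fun n => k (Int.negSucc n)

theorem forceInt_eq {α : Type} (z : ℤ) (k : ℤ → α) : forceInt z k = k z := by
  cases z <;> simp [forceInt, forceNat_eq]

def forceList {α : Type} (l : List ℤ) (k : List ℤ → α) : α :=
  match l with
  | [] => k []
  | x :: xs => forceInt x fun x => forceList xs fun xs => k (x :: xs)

theorem forceList_eq {α : Type} (l : List ℤ) (k : List ℤ → α) : forceList l k = k l := by
  induction l generalizing k with
  | nil => rfl
  | cons x xs ih => rw [forceList, forceInt_eq, ih]

def addL : List ℤ → List ℤ → List ℤ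
  | [], b => b
  | x :: a, [] => x :: a
  | x :: a, y :: b => (x + y) :: addL a b

def smulL (c : ℤ) : List ℤ → List ℤ
  | [] => []
  | x :: a => (c * x) :: smulL c a

/-- Multiplication by `z`. -/
def consZ : List ℤ → List ℤ
  | [] => []
  | x :: a => 0 :: x :: a

/-- The product of two polynomials. -/
def conv : List ℤ → List ℤ → List ℤ
  | [], _ => []
  | x :: a, b => addL (smulL x b) (consZ (conv a b))

/-- The sum of the absolute values of the coefficients. -/
def nrm : List ℤ → ℕ
  | [] => 0
  | x :: a => x.natAbs + nrm a

/-- Truncation to `N` coefficients and division by the common denominator. -/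
def roundL : ℕ → List ℤ → List ℤ
  | 0, _ => []
  | _ + 1, [] => []
  | n + 1, x :: a => (x / Int.ofNat scale) :: roundL n a

/-- The polynomial with the given coefficients. -/
def poly : List ℤ → X
  | [] => 0
  | x :: a => cst x + zX * poly a

theorem poly_addL (a b : List ℤ) : poly (addL a b) = poly a + poly b := by
  induction a generalizing b with
  | nil => simp [addL, poly]
  | cons x a ih =>
    cases b with
    | nil => simp [addL, poly]
    | cons y b => simp only [addL, poly, ih, Int.cast_add, map_add]; ring

theorem poly_smulL (c : ℤ) (a : List ℤ) : poly (smulL c a) = cst c * poly a := by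
  induction a with
  | nil => simp [smulL, poly]
  | cons x a ih => simp only [smulL, poly, ih, Int.cast_mul, map_mul]; ring

theorem poly_consZ (a : List ℤ) : poly (consZ a) = zX * poly a := by
  cases a <;> simp [consZ, poly]

theorem poly_conv (a b : List ℤ) : poly (conv a b) = poly a * poly b := by
  induction a with
  | nil => simp [conv, poly]
  | cons x a ih => rw [conv, poly_addL, poly_smulL, poly_consZ, ih, poly]; ring

theorem norm_cst (x : ℝ) : ‖cst x‖ = |x| := by simp

theorem norm_poly_le (a : List ℤ) : ‖poly a‖ ≤ nrm a := by
  induction a with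
  | nil => simp [poly, nrm]
  | cons x a ih =>
    rw [poly, nrm, Nat.cast_add, Nat.cast_natAbs, Int.cast_abs]
    refine (norm_add_le _ _).trans (add_le_add (norm_cst _).le ((norm_mul_le _ _).trans ?_))
    rwa [norm_zX, one_mul]

theorem poly_coeff_zero (a : List ℤ) : poly a 0 = a.headD 0 := by
  cases a with
  | nil => simp [poly]
  | cons x a => rw [poly, add_coeff, algebraMap_coeff_zero, zX_mul_zero]; simp

theorem shift_poly (a : List ℤ) : shift (poly a) = poly a.tail := by
  cases a with
  | nil => simp [poly]
  | cons x a => rw [poly, map_add, shift_const, shift_zX_mul]; simp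

/-- A ball in `X`. -/
structure Ball where
  c : List ℤ
  e : ℕ

namespace Ball

/-- `b.Mem a`: the series `a` lies in the ball `b`. -/
def Mem (b : Ball) (a : X) : Prop := ‖(scale : ℝ) • a - poly b.c‖ ≤ b.e

def force {α : Type} (b : Ball) (k : Ball → α) : α :=
  forceList b.c fun c => forceNat b.e fun e => k ⟨c, e⟩

theorem force_eq {α : Type} (b : Ball) (k : Ball → α) : b.force k = k b := by
  rw [force, forceList_eq, forceNat_eq]

def norm (b : Ball) : ℕ := nrm b.c + b.e

def zero : Ball := ⟨[], 0⟩

def one : Ball := ⟨[Int.ofNat scale], 0⟩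

def z : Ball := ⟨[0, Int.ofNat scale], 0⟩

/-- The constant `5 / 11`. -/
def invS : Ball := ⟨[8384883669867978007], 1⟩

def half : Ball := ⟨[9223372036854775808], 0⟩

def add (x y : Ball) : Ball := ⟨addL x.c y.c, x.e + y.e⟩

def neg (x : Ball) : Ball := ⟨smulL (-1) x.c, x.e⟩

def sub (x y : Ball) : Ball := x.add y.neg

def dbl (x : Ball) : Ball := ⟨smulL 2 x.c, 2 * x.e⟩

def mul (N : ℕ) (x y : Ball) : Ball :=
  x.force fun x => y.force fun y => forceList (conv x.c y.c) fun p => forceList (roundL N p) fun r =>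
    ⟨r, (nrm (addL p (smulL (-Int.ofNat scale) r)) +
      (x.norm * y.e + x.e * nrm y.c)) / scale + 1⟩

def shift (x : Ball) : Ball := ⟨x.c.tail, x.e⟩

/-- The inverse of a constant. -/
def inv (x : Ball) : Ball :=
  let c := x.c.headD 0
  let m := Int.ofNat (scale * scale) / c
  ⟨[m], ((Int.ofNat (scale * scale) - c * m).natAbs + x.e * m.natAbs) / (c.natAbs - x.e) + 1⟩

theorem div_le_natDiv (m n : ℕ) : (m : ℝ) / n ≤ ((m / n + 1 : ℕ) : ℝ) := by
  rcases Nat.eq_zero_or_pos n with rfl | hn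
  · simp
  · rw [div_le_iff₀ (by exact_mod_cast hn), ← Nat.cast_mul]
    exact_mod_cast (Nat.lt_div_mul_add hn (a := m)).le.trans (by rw [add_mul, one_mul])

variable {x y : Ball} {a b : X}

theorem Mem.norm_le (h : x.Mem a) : (scale : ℝ) * ‖a‖ ≤ x.norm := by
  have h1 : (scale : ℝ) * ‖a‖ = ‖(scale : ℝ) • a‖ := by rw [norm_smul]; simp
  have h2 := norm_add_le ((scale : ℝ) • a - poly x.c) (poly x.c)
  rw [sub_add_cancel] at h2
  have h3 := norm_poly_le x.c
  have h4 : ‖(scale : ℝ) • a - poly x.c‖ ≤ x.e := h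
  rw [h1, norm, Nat.cast_add]
  linarith

theorem Mem.norm_lt (h : x.Mem a) (h1 : x.norm < scale) : ‖a‖ < 1 := by
  have h2 := h.norm_le
  have h3 : (x.norm : ℝ) < scale := by exact_mod_cast h1
  by_contra h4
  nlinarith [scale_pos]

theorem mem_of_norm_le {e : ℕ} (h : (scale : ℝ) * ‖a‖ ≤ e) : (⟨[], e⟩ : Ball).Mem a := by
  rw [Mem, poly, sub_zero, norm_smul]
  simpa using h

theorem mem_zero : zero.Mem 0 := by simp [Mem, zero, poly]

theorem mem_int (c : ℤ) : (⟨[c], 0⟩ : Ball).Mem (cst (c / scale)) := by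
  have : (scale : ℝ) • cst (c / scale) = cst c := by
    rw [Algebra.smul_def, ← map_mul, mul_div_cancel₀ _ scale_pos.ne']
  simp [Mem, poly, this]

theorem mem_one : one.Mem 1 := by
  simp [Mem, one, poly, Algebra.smul_def]

theorem mem_z : z.Mem zX := by
  simp [Mem, z, poly, Algebra.smul_def, mul_comm]

theorem mem_cst {c : ℤ} {e : ℕ} {r : ℝ} (h : |scale * r - c| ≤ e) :
    (⟨[c], e⟩ : Ball).Mem (cst r) := by
  rw [Mem, poly, poly, mul_zero, add_zero, Algebra.smul_def, ← map_mul, ← map_sub, norm_cst]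
  exact h

theorem mem_invS : invS.Mem (cst (5 / 11)) :=
  mem_cst (by rw [abs_le]; constructor <;> norm_num [scale])

theorem mem_half : half.Mem (cst (1 / 2)) :=
  mem_cst (by rw [abs_le]; constructor <;> norm_num [scale])

theorem Mem.add (hx : x.Mem a) (hy : y.Mem b) : (x.add y).Mem (a + b) := by
  rw [Mem, Ball.add, poly_addL, smul_add, add_sub_add_comm, Nat.cast_add]
  exact (norm_add_le _ _).trans (add_le_add hx hy)

theorem Mem.neg (hx : x.Mem a) : x.neg.Mem (-a) := by
  have : (scale : ℝ) • -a - poly (smulL (-1) x.c) = -((scale : ℝ) • a - poly x.c) := by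
    rw [poly_smulL]; simp [sub_eq_add_neg, add_comm]
  rw [Mem, Ball.neg, this, norm_neg]
  exact hx

theorem Mem.sub (hx : x.Mem a) (hy : y.Mem b) : (x.sub y).Mem (a - b) := by
  rw [sub_eq_add_neg]; exact hx.add hy.neg

theorem Mem.dbl (hx : x.Mem a) : x.dbl.Mem (2 * a) := by
  have : (scale : ℝ) • (2 * a) - poly (smulL 2 x.c) = 2 * ((scale : ℝ) • a - poly x.c) := by
    rw [poly_smulL, mul_sub, mul_smul_comm, Int.cast_ofNat, cst, map_ofNat]
  rw [Mem, Ball.dbl, this, Nat.cast_mul, ← map_ofNat (algebraMap ℝ X) 2]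
  refine (norm_mul_le _ _).trans ?_
  rw [norm_cst, abs_of_pos (by norm_num)]
  exact mul_le_mul_of_nonneg_left hx (by norm_num)

theorem Mem.shift (hx : x.Mem a) : x.shift.Mem (Lorenz.shift a) := by
  rw [Mem, Ball.shift, ← shift_poly, ← map_smul, ← map_sub]
  exact (norm_shift_le _).trans hx

theorem Mem.mul (N : ℕ) (hx : x.Mem a) (hy : y.Mem b) : (Ball.mul N x y).Mem (a * b) := by
  rw [Ball.mul, force_eq, force_eq, forceList_eq, forceList_eq]
  set r := roundL N (conv x.c y.c)
  set T := nrm (addL (conv x.c y.c) (smulL (-Int.ofNat scale) r)) +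
      (x.norm * y.e + x.e * nrm y.c)
  have key : ‖(scale : ℝ) • ((scale : ℝ) • (a * b) - poly r)‖ ≤ T := by
    have e1 : (scale : ℝ) • ((scale : ℝ) • (a * b) - poly r) =
        poly (addL (conv x.c y.c) (smulL (-Int.ofNat scale) r)) +
        (((scale : ℝ) • a) * ((scale : ℝ) • b - poly y.c) +
          ((scale : ℝ) • a - poly x.c) * poly y.c) := by
      rw [poly_addL, poly_smulL, poly_conv]
      simp only [Algebra.smul_def, Int.cast_neg, Int.ofNat_eq_natCast, Int.cast_natCast, map_neg]
      ring
    have h1 : ‖((scale : ℝ) • a) * ((scale : ℝ) • b - poly y.c)‖ ≤ x.norm * y.e := by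
      refine (norm_mul_le _ _).trans (mul_le_mul ?_ hy (norm_nonneg _) (Nat.cast_nonneg _))
      rw [norm_smul]; simpa using hx.norm_le
    have h2 : ‖((scale : ℝ) • a - poly x.c) * poly y.c‖ ≤ x.e * nrm y.c :=
      (norm_mul_le _ _).trans (mul_le_mul hx (norm_poly_le _) (norm_nonneg _) (Nat.cast_nonneg _))
    rw [e1]
    refine (norm_add_le _ _).trans ?_
    simp only [T, Nat.cast_add, Nat.cast_mul]
    exact add_le_add (norm_poly_le _) ((norm_add_le _ _).trans (add_le_add h1 h2))
  rw [norm_smul, Real.norm_of_nonneg scale_pos.le] at key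
  refine le_trans ?_ (div_le_natDiv T scale)
  rw [le_div_iff₀ scale_pos, mul_comm]
  exact key

theorem Mem.coeff_zero (hx : x.Mem a) : |scale * a 0 - x.c.headD 0| ≤ x.e := by
  refine le_trans ?_ (show ‖(scale : ℝ) • a - poly x.c‖ ≤ x.e from hx)
  have := abs_coeff_le ((scale : ℝ) • a - poly x.c) 0
  rwa [← poly_coeff_zero]

theorem Mem.const {r : ℝ} (hx : x.Mem (cst r)) : (⟨[x.c.headD 0], x.e⟩ : Ball).Mem (cst r) := by
  refine mem_cst ?_
  simpa [algebraMap_coeff_zero] using hx.coeff_zero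

theorem Mem.inv {r : ℝ} (hx : x.Mem (cst r)) (h : x.e < (x.c.headD 0).natAbs) :
    r ≠ 0 ∧ x.inv.Mem (cst r⁻¹) := by
  have h1 := hx.coeff_zero
  rw [algebraMap_coeff_zero] at h1
  set c := x.c.headD 0
  have hc : ((c.natAbs : ℕ) : ℝ) = |(c : ℝ)| := by rw [Nat.cast_natAbs, Int.cast_abs]
  have h2 : (x.e : ℝ) < |(c : ℝ)| := by rw [← hc]; exact_mod_cast h
  have h3 : |(c : ℝ)| - x.e ≤ |scale * r| := by
    have := abs_sub_abs_le_abs_sub (c : ℝ) (scale * r)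
    rw [abs_sub_comm] at this
    linarith
  have h4 : 0 < |scale * r| := by linarith
  have hr : r ≠ 0 := fun h => by simp [h] at h4
  refine ⟨hr, mem_cst ?_⟩
  set m := Int.ofNat (scale * scale) / c
  set n := (Int.ofNat (scale * scale) - c * m).natAbs + x.e * m.natAbs
  refine le_trans ?_ (div_le_natDiv n (c.natAbs - x.e))
  have hn : |(scale : ℝ) * scale - scale * r * m| ≤ n := by
    have e1 : (scale : ℝ) * scale - scale * r * m =
        ((scale : ℝ) * scale - c * m) + -((scale * r - c) * m) := by ring
    rw [e1]
    refine (abs_add_le _ _).trans ?_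
    rw [abs_neg, abs_mul]
    simp only [n, Nat.cast_add, Nat.cast_mul, Nat.cast_natAbs, Int.cast_abs]
    refine add_le_add (le_of_eq ?_) (mul_le_mul_of_nonneg_right h1 (abs_nonneg _))
    push_cast [Int.ofNat_eq_natCast]
    rfl
  have e2 : (scale : ℝ) * r⁻¹ - m = (scale * scale - scale * r * m) / (scale * r) := by
    have := scale_pos.ne'
    field_simp
  rw [e2, abs_div, Nat.cast_sub h.le, hc]
  exact div_le_div₀ (Nat.cast_nonneg _) hn (by linarith) h3

/-- Horner evaluation of a polynomial with coefficients in `2⁻⁶⁴ ℤ` and of its derivative. -/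
def horner {α : Type} (N : ℕ) (p : Ball) : List ℤ → (Ball → Ball → α) → α
  | [], k => k zero zero
  | c :: l, k => horner N p l fun v d =>
      ((⟨[c], 0⟩ : Ball).add (mul N p v)).force fun v' => (v.add (mul N p d)).force fun d' => k v' d'

theorem horner_sound {α : Type} (N : ℕ) {p : Ball} {a : X} (hp : p.Mem a) (ha : ‖a‖ < 1)
    (l : List ℤ) (k : Ball → Ball → α) : ∃ v d : Ball,
      v.Mem (comp ((scale : ℝ)⁻¹ • poly l) a) ∧ d.Mem (dcomp ((scale : ℝ)⁻¹ • poly l) a) ∧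
      horner N p l k = k v d := by
  induction l generalizing k with
  | nil =>
    refine ⟨zero, zero, ?_, ?_, rfl⟩
    · have := comp_const 0 a
      simp only [map_zero] at this
      simpa [poly, this] using mem_zero
    · have := dcomp_const 0 a
      simp only [map_zero] at this
      simpa [poly, this] using mem_zero
  | cons c l ih =>
    obtain ⟨v, d, hv, hd, hk⟩ := ih fun v d =>
      ((⟨[c], 0⟩ : Ball).add (Ball.mul N p v)).force fun v' =>
        (v.add (Ball.mul N p d)).force fun d' => k v' d'
    have e : (scale : ℝ)⁻¹ • poly (c :: l) = cst (c / scale) + zX * ((scale : ℝ)⁻¹ • poly l) := by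
      rw [poly, smul_add, mul_smul_comm, Algebra.smul_def, ← map_mul, div_eq_inv_mul]
    refine ⟨_, _, ?_, ?_, by rw [horner, hk, force_eq, force_eq]⟩
    · rw [e, comp_add _ _ ha.le, comp_const, comp_zX_mul _ ha.le]
      exact (mem_int c).add (hp.mul N hv)
    · rw [e, dcomp_add _ _ ha, dcomp_const, zero_add, dcomp_zX_mul _ ha]
      exact hv.add (hp.mul N hd)

/-- Substitution of `p` into a series within `ε` of the polynomial `l`, and into its derivative. -/
def subst (N : ℕ) (l : List ℤ) (ε : ℕ) (p : Ball) (k : Ball → Ball → Bool) : Bool :=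
  Nat.blt p.norm scale && horner N p l fun v d =>
    (⟨v.c, v.e + ε⟩ : Ball).force fun v =>
      (⟨d.c, d.e + ε * (scale / (scale - p.norm) + 1)⟩ : Ball).force fun d => k v d

theorem Mem.enlarge {ε : ℕ} {δ : X} (hx : x.Mem a) (hδ : (scale : ℝ) * ‖δ‖ ≤ ε) :
    (⟨x.c, x.e + ε⟩ : Ball).Mem (a + δ) := by
  have : (scale : ℝ) • (a + δ) - poly x.c = ((scale : ℝ) • a - poly x.c) + (scale : ℝ) • δ := by
    rw [smul_add]; abel
  rw [Mem, this, Nat.cast_add]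
  refine (norm_add_le _ _).trans (add_le_add hx ?_)
  rw [norm_smul]; simpa using hδ

theorem subst_sound {N : ℕ} {l : List ℤ} {ε : ℕ} {p : Ball} {k : Ball → Ball → Bool} {f : X}
    (hf : (⟨l, ε⟩ : Ball).Mem f) (hp : p.Mem a) (h : subst N l ε p k = true) :
    ‖a‖ < 1 ∧ ∃ v d : Ball, v.Mem (comp f a) ∧ d.Mem (dcomp f a) ∧ k v d = true := by
  rw [subst, Bool.and_eq_true, Nat.blt_eq] at h
  obtain ⟨h1, h2⟩ := h
  have ha := hp.norm_lt h1
  refine ⟨ha, ?_⟩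
  obtain ⟨v, d, hv, hd, hk⟩ := horner_sound N hp ha l fun v d =>
    (⟨v.c, v.e + ε⟩ : Ball).force fun v =>
      (⟨d.c, d.e + ε * (scale / (scale - p.norm) + 1)⟩ : Ball).force fun d => k v d
  rw [hk, force_eq, force_eq] at h2
  set f₀ := (scale : ℝ)⁻¹ • poly l
  have hfe : f = f₀ + (f - f₀) := by abel
  have hfn : (scale : ℝ) * ‖f - f₀‖ ≤ ε := by
    have : (scale : ℝ) * ‖f - f₀‖ = ‖(scale : ℝ) • (f - f₀)‖ := by rw [norm_smul]; simp
    rw [this, smul_sub, smul_smul, mul_inv_cancel₀ scale_pos.ne', one_smul]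
    exact hf
  refine ⟨_, _, ?_, ?_, h2⟩
  · rw [hfe, comp_add _ _ ha.le]
    exact hv.enlarge ((mul_le_mul_of_nonneg_left (norm_comp_le _ ha.le) scale_pos.le).trans hfn)
  · rw [hfe, dcomp_add _ _ ha]
    refine hd.enlarge ?_
    have h3 := norm_dcomp_le (f - f₀) ha
    have h4 : (1 - ‖a‖)⁻¹ ≤ ((scale / (scale - p.norm) + 1 : ℕ) : ℝ) := by
      refine le_trans ?_ (div_le_natDiv _ _)
      have h5 : (p.norm : ℝ) < scale := by exact_mod_cast h1
      rw [Nat.cast_sub h1.le, inv_eq_one_div, div_le_div_iff₀ (by linarith) (by linarith)]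
      have := hp.norm_le
      linarith
    calc (scale : ℝ) * ‖dcomp (f - f₀) a‖ ≤ (scale * ‖f - f₀‖) * (1 - ‖a‖)⁻¹ := by
          have := mul_le_mul_of_nonneg_left h3 scale_pos.le
          linarith
      _ ≤ ε * ((scale / (scale - p.norm) + 1 : ℕ) : ℝ) :=
          mul_le_mul hfn h4 (inv_nonneg.2 (by linarith)) (Nat.cast_nonneg _)
      _ = _ := by push_cast; ring

end Ball

end Lorenz
end

noncomputable section

namespace Lorenz

open Ball

/-! ### Enclosures of the operator and of its derivative -/

theorem cst_mul (x y : ℝ) : cst (x * y) = cst x * cst y := map_mul _ _ _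

theorem cst_sub (x y : ℝ) : cst (x - y) = cst x - cst y := map_sub _ _ _

theorem cst_neg (x : ℝ) : cst (-x) = -cst x := map_neg _ _

theorem cst_pow (x : ℝ) (n : ℕ) : cst (x ^ n) = cst x ^ n := map_pow _ _ _

theorem cst_zero : cst 0 = 0 := map_zero _

theorem cst_one : cst 1 = 1 := map_one _

theorem cst_two : cst 2 = 2 := map_ofNat _ 2

theorem Ball.force_sound {b : Ball} {a : X} {k : Ball → Bool} (hb : b.Mem a)
    (hk : b.force k = true) : ∃ b' : Ball, b'.Mem a ∧ k b' = true :=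
  ⟨b, hb, by rwa [force_eq] at hk⟩

/-- Enclosures of the intermediate quantities in the definition of the operator. -/
structure Stage where
  f0 : Ball
  la : Ball
  dla : Ball
  lam : Ball
  il : Ball
  p : Ball
  a : Ball
  df : Ball
  f2 : Ball
  f3 : Ball
  gf : Ball
  dg : Ball
  fhat : Ball
  pg : Ball
  gp : Ball
  dgp : Ball
  q : Ball
  g3 : Ball
  c : Ball
  dc : Ball
  g5 : Ball
  h : Ball
  dh : Ball

/-- The enclosures hold for `F`. -/
structure Stage.Sound (s : Stage) (F : Y) : Prop where
  f0 : s.f0.Mem (cst (F.fst 0))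
  la : s.la.Mem (cst (laR F))
  dla : s.dla.Mem (cst (dcomp F.fst (laR F)))
  lam : s.lam.Mem (cst (lamR F))
  il : s.il.Mem (cst (lamR F)⁻¹)
  p : s.p.Mem (pX F)
  a : s.a.Mem (aX F)
  df : s.df.Mem (dcomp F.fst (pX F))
  f2 : s.f2.Mem (aX F ^ 2)
  f3 : s.f3.Mem (f3X F)
  gf : s.gf.Mem (gfX F)
  dg : s.dg.Mem (dcomp F.snd (f3X F))
  fhat : s.fhat.Mem (fhatX F)
  pg : s.pg.Mem (pgX F)
  gp : s.gp.Mem (gpX F)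
  dgp : s.dgp.Mem (dcomp F.snd (pgX F))
  q : s.q.Mem (qX F)
  g3 : s.g3.Mem (g3X F)
  c : s.c.Mem (cX F)
  dc : s.dc.Mem (dcomp F.fst (g3X F))
  g5 : s.g5.Mem (g5X F)
  h : s.h.Mem (hX F)
  dh : s.dh.Mem (dcomp F.fst (g5X F))

/-- Computes the enclosures, for all pairs within `ε` of the pair of polynomials `(fc, gc)`. -/
def evalStages (N : ℕ) (fc gc : List ℤ) (ε : ℕ) (k : Stage → Bool) : Bool :=
  (⟨[fc.headD 0], ε⟩ : Ball).force fun f0 =>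
  (mul N invS ((mul N f0 f0).sub one)).force fun la =>
  subst N fc ε la fun v dla =>
  (⟨[v.neg.c.headD 0], v.neg.e⟩ : Ball).force fun lam =>
  Nat.blt lam.e (lam.c.headD 0).natAbs && lam.inv.force fun il =>
  (mul N lam lam).force fun l2 =>
  ((mul N l2 (z.add invS)).sub invS).force fun p =>
  subst N fc ε p fun a df =>
  (mul N a a).force fun f2 =>
  f2.dbl.force fun f3 =>
  subst N gc ε f3 fun gf dg =>
  (mul N il ((mul N f2 gf).sub one)).force fun fhat =>
  (mul N l2 z).force fun pg =>
  subst N gc ε pg fun gp dgp =>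
  (mul N half (mul N pg gp)).force fun q =>
  (mul N invS (mul N q (q.sub one.dbl))).force fun g3 =>
  subst N fc ε g3 fun c dc =>
  (mul N invS ((mul N c c).sub one)).force fun g5 =>
  subst N fc ε g5 fun h dh =>
  k ⟨f0, la, dla, lam, il, p, a, df, f2, f3, gf, dg, fhat, pg, gp, dgp, q, g3, c, dc, g5, h, dh⟩

theorem evalStages_sound {N : ℕ} {fc gc : List ℤ} {ε : ℕ} {k : Stage → Bool} {F : Y}
    (hf : (⟨fc, ε⟩ : Ball).Mem F.fst) (hg : (⟨gc, ε⟩ : Ball).Mem F.snd)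
    (hk : evalStages N fc gc ε k = true) : Good F ∧ ∃ s : Stage, s.Sound F ∧ k s = true := by
  rw [evalStages] at hk
  obtain ⟨f0, hf0, hk⟩ := force_sound (a := cst (F.fst 0)) (mem_cst hf.coeff_zero) hk
  obtain ⟨la, hla, hk⟩ := force_sound (a := cst (laR F)) (by
    rw [laR, cst_mul, cst_sub, cst_pow, cst_one, pow_two]
    exact mem_invS.mul N ((hf0.mul N hf0).sub mem_one)) hk
  obtain ⟨gla, v, dla, hv, hdla, hk⟩ := subst_sound hf hla hk
  rw [norm_cst] at gla
  rw [← algebraMap_comp _ gla.le] at hv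
  rw [← algebraMap_dcomp _ gla] at hdla
  obtain ⟨lam, hlam, hk⟩ := force_sound (a := cst (lamR F)) (Mem.const (by
    rw [lamR, cst_neg]; exact hv.neg)) hk
  rw [Bool.and_eq_true, Nat.blt_eq] at hk
  obtain ⟨hlt, hk⟩ := hk
  obtain ⟨glam, hil⟩ := hlam.inv hlt
  obtain ⟨il, hil, hk⟩ := force_sound hil hk
  obtain ⟨l2, hl2, hk⟩ := force_sound (a := cst (lamR F ^ 2)) (by
    rw [pow_two, cst_mul]; exact hlam.mul N hlam) hk
  obtain ⟨p, hp, hk⟩ := force_sound (a := pX F)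
    ((hl2.mul N (mem_z.add mem_invS)).sub mem_invS) hk
  obtain ⟨gp, a, df, ha, hdf, hk⟩ := subst_sound hf hp hk
  obtain ⟨f2, hf2, hk⟩ := force_sound (a := aX F ^ 2) (by rw [pow_two]; exact ha.mul N ha) hk
  obtain ⟨f3, hf3, hk⟩ := force_sound (a := f3X F) hf2.dbl hk
  obtain ⟨gf3, gf, dg, hgf, hdg, hk⟩ := subst_sound hg hf3 hk
  obtain ⟨fhat, hfhat, hk⟩ := force_sound (a := fhatX F)
    (hil.mul N ((hf2.mul N hgf).sub mem_one)) hk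
  obtain ⟨pg, hpg, hk⟩ := force_sound (a := pgX F) (hl2.mul N mem_z) hk
  obtain ⟨gpg, gp', dgp, hgp, hdgp, hk⟩ := subst_sound hg hpg hk
  obtain ⟨q, hq, hk⟩ := force_sound (a := qX F) (mem_half.mul N (hpg.mul N hgp)) hk
  obtain ⟨g3, hg3, hk⟩ := force_sound (a := g3X F) (by
    have := mem_invS.mul N (hq.mul N (hq.sub mem_one.dbl))
    rwa [mul_one] at this) hk
  obtain ⟨gg3, c, dc, hc, hdc, hk⟩ := subst_sound hf hg3 hk
  obtain ⟨g5, hg5, hk⟩ := force_sound (a := g5X F) (by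
    rw [g5X, pow_two]; exact mem_invS.mul N ((hc.mul N hc).sub mem_one)) hk
  obtain ⟨gg5, h, dh, hh, hdh, hk⟩ := subst_sound hf hg5 hk
  exact ⟨⟨glam, gla, gp, gf3, gpg, gg3, gg5⟩, ⟨f0, la, dla, lam, il, p, a, df, f2, f3, gf, dg, fhat,
    pg, gp', dgp, q, g3, c, dc, g5, h, dh⟩, ⟨hf0, hla, hdla, hlam, hil, hp, ha, hdf, hf2, hf3,
    hgf, hdg, hfhat, hpg, hgp, hdgp, hq, hg3, hc, hdc, hg5, hh, hdh⟩, hk⟩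

/-- Enclosures of the coefficients of the derivative of the operator. -/
structure Coefs where
  a1 : Ball
  c1 : Ball
  b1 : Ball
  a2 : Ball
  c2 : Ball
  b2 : Ball
  kap : Ball

structure Coefs.Sound (s : Coefs) (F : Y) : Prop where
  a1 : s.a1.Mem (coefA1 F)
  c1 : s.c1.Mem (coefC1 F)
  b1 : s.b1.Mem (coefB1 F)
  a2 : s.a2.Mem (coefA2 F)
  c2 : s.c2.Mem (coefC2 F)
  b2 : s.b2.Mem (coefB2 F)
  kap : s.kap.Mem (cst (dcomp F.fst (laR F) * (5 / 11 * (2 * F.fst 0))))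

def evalCoefs (N : ℕ) (s : Stage) (k : Coefs → Bool) : Bool :=
  (mul N s.il (mul N s.a (s.gf.add (mul N s.f2 s.dg).dbl))).dbl.force fun a1 =>
  (mul N s.il s.f2).force fun c1 =>
  ((mul N a1 (mul N s.df (mul N s.lam.dbl (z.add invS)))).sub (mul N s.il s.fhat)).force fun b1 =>
  (mul N s.il (mul N s.dh (mul N invS.dbl s.c))).force fun a2 =>
  (mul N a2 (mul N s.dc (mul N invS (s.q.sub one)))).force fun w =>
  (mul N w s.pg).force fun c2 =>
  ((mul N w (mul N s.lam.dbl (mul N z (s.gp.add (mul N s.pg s.dgp))))).sub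
    (mul N s.il (mul N s.il s.h))).force fun b2 =>
  (mul N s.dla (mul N invS s.f0.dbl)).force fun kap =>
  k ⟨a1, c1, b1, a2, c2, b2, kap⟩

theorem evalCoefs_sound {N : ℕ} {s : Stage} {k : Coefs → Bool} {F : Y} (hs : s.Sound F)
    (hk : evalCoefs N s k = true) : ∃ c : Coefs, c.Sound F ∧ k c = true := by
  rw [evalCoefs] at hk
  obtain ⟨a1, ha1, hk⟩ := force_sound (a := coefA1 F)
    (hs.il.mul N (hs.a.mul N (hs.gf.add (hs.f2.mul N hs.dg).dbl))).dbl hk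
  obtain ⟨c1, hc1, hk⟩ := force_sound (a := coefC1 F) (hs.il.mul N hs.f2) hk
  obtain ⟨b1, hb1, hk⟩ := force_sound (a := coefB1 F)
    ((ha1.mul N (hs.df.mul N (hs.lam.dbl.mul N (mem_z.add mem_invS)))).sub
      (hs.il.mul N hs.fhat)) hk
  obtain ⟨a2, ha2, hk⟩ := force_sound (a := coefA2 F)
    (hs.il.mul N (hs.dh.mul N (mem_invS.dbl.mul N hs.c))) hk
  obtain ⟨w, hw, hk⟩ := force_sound (a := coefW F)
    (ha2.mul N (hs.dc.mul N (mem_invS.mul N (hs.q.sub mem_one)))) hk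
  obtain ⟨c2, hc2, hk⟩ := force_sound (a := coefC2 F) (hw.mul N hs.pg) hk
  obtain ⟨b2, hb2, hk⟩ := force_sound (a := coefB2 F)
    ((hw.mul N (hs.lam.dbl.mul N (mem_z.mul N (hs.gp.add (hs.pg.mul N hs.dgp))))).sub
      (hs.il.mul N (hs.il.mul N hs.h))) hk
  obtain ⟨kap, hkap, hk⟩ := force_sound
    (a := cst (dcomp F.fst (laR F) * (5 / 11 * (2 * F.fst 0)))) (by
      rw [cst_mul, cst_mul, cst_mul, cst_two]
      exact hs.dla.mul N (mem_invS.mul N hs.f0.dbl)) hk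
  exact ⟨⟨a1, c1, b1, a2, c2, b2, kap⟩, ⟨ha1, hc1, hb1, ha2, hc2, hb2, hkap⟩, hk⟩

/-! ### Columns of the derivative -/

theorem mem_ghatX {s : Stage} {F : Y} (hs : s.Sound F) (N : ℕ) :
    ((mul N s.il s.h).shift.dbl).Mem (ghatX F) := by
  have := (hs.il.mul N hs.h).shift.dbl
  rwa [ghatX, two_smul, ← two_mul]

/-- Enclosures of `k`-th powers. -/
structure Powers where
  p : Ball
  f3 : Ball
  pg : Ball
  g3 : Ball
  g5 : Ball
  la : Ball

structure Powers.Sound (w : Powers) (F : Y) (k : ℕ) : Prop where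
  p : w.p.Mem (pX F ^ k)
  f3 : w.f3.Mem (f3X F ^ k)
  pg : w.pg.Mem (pgX F ^ k)
  g3 : w.g3.Mem (g3X F ^ k)
  g5 : w.g5.Mem (g5X F ^ k)
  la : w.la.Mem (cst (laR F) ^ k)

def Powers.next (N : ℕ) (s : Stage) (w : Powers) (k : Powers → Bool) : Bool :=
  (mul N s.p w.p).force fun p => (mul N s.f3 w.f3).force fun f3 =>
  (mul N s.pg w.pg).force fun pg => (mul N s.g3 w.g3).force fun g3 =>
  (mul N s.g5 w.g5).force fun g5 => (mul N s.la w.la).force fun la => k ⟨p, f3, pg, g3, g5, la⟩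

theorem Powers.next_sound {N : ℕ} {s : Stage} {w : Powers} {k : Powers → Bool} {F : Y} {n : ℕ}
    (hs : s.Sound F) (hw : w.Sound F n) (hk : w.next N s k = true) :
    ∃ w' : Powers, w'.Sound F (n + 1) ∧ k w' = true := by
  rw [next] at hk
  obtain ⟨p, hp, hk⟩ := force_sound (hs.p.mul N hw.p) hk
  obtain ⟨f3, hf3, hk⟩ := force_sound (hs.f3.mul N hw.f3) hk
  obtain ⟨pg, hpg, hk⟩ := force_sound (hs.pg.mul N hw.pg) hk
  obtain ⟨g3, hg3, hk⟩ := force_sound (hs.g3.mul N hw.g3) hk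
  obtain ⟨g5, hg5, hk⟩ := force_sound (hs.g5.mul N hw.g5) hk
  obtain ⟨la, hla, hk⟩ := force_sound (hs.la.mul N hw.la) hk
  rw [← pow_succ'] at hp hf3 hpg hg3 hg5 hla
  exact ⟨⟨p, f3, pg, g3, g5, la⟩, ⟨hp, hf3, hpg, hg3, hg5, hla⟩, hk⟩

def Powers.start : Powers := ⟨one, one, one, one, one, one⟩

theorem Powers.start_sound (F : Y) : Powers.start.Sound F 0 := by
  constructor <;> rw [pow_zero] <;> exact mem_one

/-- The enclosure of the derivative of `λ` in the direction `(z^k, 0)`. -/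
def dlamBall (c : Coefs) (w : Powers) : ℕ → Ball
  | 0 => w.la.neg.sub c.kap
  | _ + 1 => w.la.neg

def colF1 (N : ℕ) (c : Coefs) (w : Powers) (dl : Ball) : Ball :=
  (mul N c.a1 w.p).add (mul N dl c.b1)

def colF2 (N : ℕ) (s : Stage) (c : Coefs) (w : Powers) (dl : Ball) : Ball :=
  (((mul N s.il w.g5).add (mul N c.a2 w.g3)).add (mul N dl c.b2)).shift.dbl

def colG1 (N : ℕ) (c : Coefs) (w : Powers) : Ball := mul N c.c1 w.f3

def colG2 (N : ℕ) (c : Coefs) (w : Powers) : Ball := (mul N c.c2 w.pg).shift.dbl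

/-- The basis vectors. -/
def eF (k : ℕ) : Y := WithLp.toLp 1 (lp.single 1 k 1, 0)

def eG (k : ℕ) : Y := WithLp.toLp 1 (0, lp.single 1 k 1)

theorem eF_fst (k : ℕ) : (eF k).fst = zX ^ k := (zX_pow k).symm

theorem eF_snd (k : ℕ) : (eF k).snd = 0 := rfl

theorem eG_fst (k : ℕ) : (eG k).fst = 0 := rfl

theorem eG_snd (k : ℕ) : (eG k).snd = zX ^ k := (zX_pow k).symm

theorem comp_zero {A : Type*} [NormedCommRing A] [NormedAlgebra ℝ A] [CompleteSpace A]
    [NormOneClass A] (p : A) : comp 0 p = 0 := by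
  simpa using comp_const (A := A) 0 p

theorem cst_dlamR_eF {F : Y} (hF : Good F) (k : ℕ) : cst (dlamR F (eF k)) =
    -cst (laR F) ^ k -
      if k = 0 then cst (dcomp F.fst (laR F) * (5 / 11 * (2 * F.fst 0))) else 0 := by
  have h1 : ‖laR F‖ ≤ 1 := hF.la_lt.le
  have h2 : (zX ^ k : X) 0 = if k = 0 then 1 else 0 := by
    rw [zX_pow, lp.single_apply, Pi.single_apply]; simp only [eq_comm]
  rw [dlamR, dlaR, eF_fst, comp_zX_pow k h1, h2, cst_sub, cst_neg, cst_pow]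
  split_ifs <;> simp

theorem dlamR_eG {F : Y} (k : ℕ) : dlamR F (eG k) = 0 := by
  rw [dlamR, dlaR, eG_fst, comp_zero]; simp

theorem mem_dlam {F : Y} (hF : Good F) {c : Coefs} {w : Powers} {k : ℕ} (hc : c.Sound F)
    (hw : w.Sound F k) : (dlamBall c w k).Mem (cst (dlamR F (eF k))) := by
  rw [cst_dlamR_eF hF]
  cases k with
  | zero => exact hw.la.neg.sub hc.kap
  | succ k => simpa [dlamBall] using hw.la.neg

section Cols

variable {F : Y} (hF : Good F) {s : Stage} {c : Coefs} {w : Powers} {k : ℕ}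

include hF

theorem dfst_eF : dfst F (eF k) = coefA1 F * pX F ^ k + cst (dlamR F (eF k)) * coefB1 F := by
  rw [dfst, eF_fst, eF_snd, comp_zero, comp_zX_pow k hF.p_lt.le]; ring

theorem dsnd_eF : dsnd F (eF k) = 2 * shift (cst (lamR F)⁻¹ * g5X F ^ k + coefA2 F * g3X F ^ k +
    cst (dlamR F (eF k)) * coefB2 F) := by
  rw [dsnd, eF_fst, eF_snd, comp_zero, comp_zX_pow k hF.g5_lt.le, comp_zX_pow k hF.g3_lt.le,
    mul_zero, add_zero, two_smul, ← two_mul]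

theorem dfst_eG : dfst F (eG k) = coefC1 F * f3X F ^ k := by
  rw [dfst, eG_fst, eG_snd, comp_zero, comp_zX_pow k hF.f3_lt.le, dlamR_eG, cst_zero]; ring

theorem dsnd_eG : dsnd F (eG k) = 2 * shift (coefC2 F * pgX F ^ k) := by
  rw [dsnd, eG_fst, eG_snd, comp_zero, comp_zero, comp_zX_pow k hF.pg_lt.le, dlamR_eG, cst_zero,
    two_smul, ← two_mul]
  simp only [mul_zero, zero_add, zero_mul, add_zero]

variable (hs : s.Sound F) (hc : c.Sound F) (hw : w.Sound F k) (N : ℕ)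

include hc hw

theorem mem_colF1 : (colF1 N c w (dlamBall c w k)).Mem (dfst F (eF k)) := by
  rw [dfst_eF hF]
  exact (hc.a1.mul N hw.p).add ((mem_dlam hF hc hw).mul N hc.b1)

theorem mem_colG1 : (colG1 N c w).Mem (dfst F (eG k)) := by
  rw [dfst_eG hF]
  exact hc.c1.mul N hw.f3

theorem mem_colG2 : (colG2 N c w).Mem (dsnd F (eG k)) := by
  rw [dsnd_eG hF]
  exact (hc.c2.mul N hw.pg).shift.dbl

include hs

theorem mem_colF2 : (colF2 N s c w (dlamBall c w k)).Mem (dsnd F (eF k)) := by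
  rw [dsnd_eF hF]
  exact (((hs.il.mul N hw.g5).add (hc.a2.mul N hw.g3)).add
    ((mem_dlam hF hc hw).mul N hc.b2)).shift.dbl

end Cols

end Lorenz
end

noncomputable section

namespace Lorenz

open Ball

/-! ### Finite-rank operators given by integers -/

/-- The linear functional with the given coefficients. -/
def dotL : List ℤ → X →L[ℝ] ℝ
  | [] => 0
  | x :: l => (x : ℝ) • lp.evalCLM ℝ (fun _ : ℕ => ℝ) 1 0 + (dotL l).comp shift

theorem dotL_cons (x : ℤ) (l : List ℤ) (a : X) : dotL (x :: l) a = x * a 0 + dotL l (shift a) := rfl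

def dotZ : List ℤ → List ℤ → ℤ
  | [], _ => 0
  | _ :: _, [] => 0
  | x :: l, y :: c => x * y + dotZ l c

theorem dotL_poly (l c : List ℤ) : dotL l (poly c) = dotZ l c := by
  induction l generalizing c with
  | nil => simp [dotL, dotZ]
  | cons x l ih =>
    rw [dotL_cons, poly_coeff_zero, shift_poly, ih]
    cases c with
    | nil => cases l <;> simp [dotZ]
    | cons y c => simp [dotZ]

theorem norm_eq_abs_add_shift (a : X) : ‖a‖ = |a 0| + ‖shift a‖ := by
  rw [norm_eq_tsum a, norm_eq_tsum (shift a), (summable_norm a).tsum_eq_zero_add]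
  rfl

theorem abs_dotL_le {m : ℕ} {l : List ℤ} (h : ∀ x ∈ l, x.natAbs ≤ m) (a : X) :
    |dotL l a| ≤ m * ‖a‖ := by
  induction l generalizing a with
  | nil => simpa [dotL] using mul_nonneg (Nat.cast_nonneg m) (norm_nonneg a)
  | cons x l ih =>
    rw [dotL_cons, norm_eq_abs_add_shift a, mul_add]
    refine (abs_add_le _ _).trans (add_le_add ?_
      (ih (fun y hy => h y (List.mem_cons_of_mem _ hy)) _))
    rw [abs_mul]
    refine mul_le_mul_of_nonneg_right ?_ (abs_nonneg _)
    have : ((x.natAbs : ℕ) : ℝ) ≤ m := by exact_mod_cast h x List.mem_cons_self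
    rwa [Nat.cast_natAbs, Int.cast_abs] at this

theorem dotL_zX_pow (l : List ℤ) (k : ℕ) : dotL l (zX ^ k) = l.getD k 0 := by
  induction l generalizing k with
  | nil => simp [dotL]
  | cons x l ih =>
    rw [dotL_cons]
    cases k with
    | zero =>
      have h0 : shift (1 : X) = 0 := by simpa using shift_const 1
      rw [pow_zero, h0, one_coeff]; simp
    | succ k => rw [pow_succ', zX_mul_zero, shift_zX_mul, ih]; simp

/-- The square root of the common denominator. -/
def halfScale : ℕ := 4294967296

theorem halfScale_pos : (0 : ℝ) < halfScale := by norm_num [halfScale]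

theorem halfScale_mul_self : (halfScale : ℝ) * halfScale = scale := by norm_num [halfScale, scale]

/-- A rank-one operator: the coefficients in `2⁻³² ℤ` of a vector `(u₁, u₂)` and of a functional
`(v₁, v₂)`, a bound `vmax` for the latter, and the dominance `mu` of the corresponding row. -/
structure Row where
  u1 : List ℤ
  u2 : List ℤ
  v1 : List ℤ
  v2 : List ℤ
  vmax : ℕ
  mu : ℕ

namespace Row

def fn (r : Row) : Y →L[ℝ] ℝ :=
  (halfScale : ℝ)⁻¹ • ((dotL r.v1).comp (WithLp.fstL 1 ℝ X X) +
    (dotL r.v2).comp (WithLp.sndL 1 ℝ X X))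

theorem fn_apply (r : Row) (y : Y) :
    r.fn y = (halfScale : ℝ)⁻¹ * (dotL r.v1 y.fst + dotL r.v2 y.snd) := rfl

def vec (r : Row) : Y :=
  WithLp.toLp 1 ((halfScale : ℝ)⁻¹ • poly r.u1, (halfScale : ℝ)⁻¹ • poly r.u2)

def entry (r r' : Row) : ℤ := dotZ r.v1 r'.u1 + dotZ r.v2 r'.u2

theorem fn_vec (r r' : Row) : r.fn r'.vec = r.entry r' / scale := by
  change (halfScale : ℝ)⁻¹ * (dotL r.v1 ((halfScale : ℝ)⁻¹ • poly r'.u1) +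
    dotL r.v2 ((halfScale : ℝ)⁻¹ • poly r'.u2)) = _
  rw [map_smul, map_smul, dotL_poly, dotL_poly, ← halfScale_mul_self, entry]
  have := halfScale_pos.ne'
  push_cast
  simp only [smul_eq_mul]
  field_simp

def unorm (r : Row) : ℕ := nrm r.u1 + nrm r.u2

theorem norm_vec_le (r : Row) : ‖r.vec‖ ≤ r.unorm / halfScale := by
  rw [vec, norm_pair, norm_smul, norm_smul, norm_inv, Real.norm_of_nonneg halfScale_pos.le,
    ← mul_add, div_eq_inv_mul, unorm, Nat.cast_add]
  exact mul_le_mul_of_nonneg_left (add_le_add (norm_poly_le _) (norm_poly_le _))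
    (inv_nonneg.2 halfScale_pos.le)

theorem fn_eF (r : Row) (k : ℕ) : r.fn (eF k) = (halfScale : ℝ)⁻¹ * r.v1.getD k 0 := by
  rw [fn_apply, eF_fst, eF_snd, dotL_zX_pow]; simp

theorem fn_eG (r : Row) (k : ℕ) : r.fn (eG k) = (halfScale : ℝ)⁻¹ * r.v2.getD k 0 := by
  rw [fn_apply, eG_fst, eG_snd, dotL_zX_pow]; simp

/-- The contribution of a row to the resolvent estimate for a vector in `(b₁, b₂)`. -/
def coef (b1 b2 : Ball) (r : Row) : ℕ :=
  ((dotZ r.v1 b1.c + dotZ r.v2 b2.c).natAbs + r.vmax * (b1.e + b2.e)) * halfScale / r.mu + 1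

/-- The row is well formed. -/
def Ok (r : Row) : Prop :=
  r.u1.length ≤ 13 ∧ r.u2.length ≤ 13 ∧ r.v1.length ≤ 13 ∧ r.v2.length ≤ 13 ∧
    (∀ x ∈ r.v1, x.natAbs ≤ r.vmax) ∧ (∀ x ∈ r.v2, x.natAbs ≤ r.vmax) ∧ 0 < r.mu

theorem abs_fn_le {r : Row} (hr : r.Ok) {b1 b2 : Ball} {y : Y} (h1 : b1.Mem y.fst)
    (h2 : b2.Mem y.snd) : |r.fn y| ≤ (r.coef b1 b2 : ℝ) / scale * (r.mu / scale) := by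
  obtain ⟨-, -, -, -, hv1, hv2, hmu⟩ := hr
  have hS := scale_pos
  have hH := halfScale_pos
  set n := (dotZ r.v1 b1.c + dotZ r.v2 b2.c).natAbs + r.vmax * (b1.e + b2.e) with hn
  have key : |dotL r.v1 ((scale : ℝ) • y.fst) + dotL r.v2 ((scale : ℝ) • y.snd)| ≤ n := by
    have e1 : dotL r.v1 ((scale : ℝ) • y.fst) =
        dotZ r.v1 b1.c + dotL r.v1 ((scale : ℝ) • y.fst - poly b1.c) := by
      rw [map_sub (dotL r.v1), dotL_poly]; ring
    have e2 : dotL r.v2 ((scale : ℝ) • y.snd) =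
        dotZ r.v2 b2.c + dotL r.v2 ((scale : ℝ) • y.snd - poly b2.c) := by
      rw [map_sub (dotL r.v2), dotL_poly]; ring
    have k1 := (abs_dotL_le hv1 ((scale : ℝ) • y.fst - poly b1.c)).trans
      (mul_le_mul_of_nonneg_left h1 (Nat.cast_nonneg _))
    have k2 := (abs_dotL_le hv2 ((scale : ℝ) • y.snd - poly b2.c)).trans
      (mul_le_mul_of_nonneg_left h2 (Nat.cast_nonneg _))
    rw [e1, e2, add_add_add_comm]
    refine (abs_add_le _ _).trans ?_
    rw [hn, Nat.cast_add, Nat.cast_natAbs, Int.cast_abs, Int.cast_add]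
    refine add_le_add le_rfl ((abs_add_le _ _).trans ?_)
    push_cast
    linarith
  have hc : (n : ℝ) * halfScale ≤ r.coef b1 b2 * r.mu := by
    have := div_le_natDiv (n * halfScale) r.mu
    rw [div_le_iff₀ (by exact_mod_cast hmu)] at this
    push_cast at this ⊢
    simpa [coef, ← hn] using this
  have e3 : r.fn y = (dotL r.v1 ((scale : ℝ) • y.fst) + dotL r.v2 ((scale : ℝ) • y.snd)) /
      (scale * halfScale) := by
    rw [fn_apply, map_smul, map_smul, smul_eq_mul, smul_eq_mul, ← mul_add]
    field_simp
  rw [e3, abs_div, abs_of_pos (mul_pos hS hH), div_mul_div_comm,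
    div_le_div_iff₀ (mul_pos hS hH) (mul_pos hS hS)]
  calc _ ≤ (n : ℝ) * (scale * scale) := mul_le_mul_of_nonneg_right key (by positivity)
    _ = (n * halfScale) * (scale * halfScale) := by
        nth_rewrite 2 [← halfScale_mul_self]; ring
    _ ≤ _ := mul_le_mul_of_nonneg_right hc (by positivity)

end Row

def maxCoef (b1 b2 : Ball) : List Row → ℕ
  | [] => 0
  | r :: l => max (r.coef b1 b2) (maxCoef b1 b2 l)

theorem coef_le_maxCoef (b1 b2 : Ball) {rows : List Row} {r : Row} (h : r ∈ rows) :
    r.coef b1 b2 ≤ maxCoef b1 b2 rows := by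
  induction rows with
  | nil => simp at h
  | cons r' l ih =>
    rcases List.mem_cons.1 h with rfl | h
    · exact le_max_left _ _
    · exact (ih h).trans (le_max_right _ _)

/-- The bound for the resolvent, applied to a vector in `(b₁, b₂)`. -/
def resBound (rows : List Row) (su : ℕ) (b1 b2 : Ball) : ℕ :=
  b1.norm + b2.norm + (maxCoef b1 b2 rows * su / halfScale + 1)

/-- The data of the finite-rank operator is consistent. -/
structure RowsOk (rows : List Row) (su : ℕ) : Prop where
  ok : ∀ r ∈ rows, r.Ok
  unorm : ∑ i : Fin rows.length, rows[i].unorm ≤ su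
  dom : ∀ i : Fin rows.length, rows[i].mu +
    ∑ j : Fin rows.length, (if j = i then 0 else (rows[i].entry rows[j]).natAbs) ≤
      (Int.ofNat scale - Int.ofNat (rows[i].entry rows[i]).natAbs).natAbs

variable {rows : List Row} {su : ℕ}

/-- The operator `∑ vᵢ ⊗ uᵢ`. -/
def gam (rows : List Row) : Y →L[ℝ] Y :=
  finRank (fun i : Fin rows.length => rows[i].vec) (fun i : Fin rows.length => rows[i].fn)

theorem RowsOk.rowDominant (h : RowsOk rows su) :
    RowDominant (Matrix.of fun i j : Fin rows.length => rows[i].fn rows[j].vec)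
      (fun i => (rows[i].mu : ℝ) / scale) := by
  intro i
  have hS := scale_pos
  have hmu : 0 < rows[i].mu := (h.ok _ (List.getElem_mem _)).2.2.2.2.2.2
  refine ⟨div_pos (by exact_mod_cast hmu) hS, ?_⟩
  have habs : ∀ j : Fin rows.length, ‖rows[i].fn rows[j].vec‖ =
      ((rows[i].entry rows[j]).natAbs : ℕ) / (scale : ℝ) := fun j => by
    rw [Row.fn_vec, norm_div, Real.norm_of_nonneg hS.le, Nat.cast_natAbs, Int.cast_abs]; rfl
  have hd : ((rows[i].mu + ∑ j : Fin rows.length,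
      (if j = i then 0 else (rows[i].entry rows[j]).natAbs) : ℕ) : ℝ) ≤
      ((Int.ofNat scale - Int.ofNat (rows[i].entry rows[i]).natAbs).natAbs : ℕ) := by
    exact_mod_cast h.dom i
  have h1 : (1 : ℝ) - ((rows[i].entry rows[i]).natAbs : ℕ) / (scale : ℝ) =
      (scale - ((rows[i].entry rows[i]).natAbs : ℕ)) / scale := by field_simp
  have h2 : ∑ j ∈ Finset.univ.erase i, ‖rows[i].fn rows[j].vec‖ =
      ((∑ j : Fin rows.length,
        (if j = i then 0 else (rows[i].entry rows[j]).natAbs) : ℕ) : ℝ) / scale := by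
    rw [Nat.cast_sum, Finset.sum_div, ← Finset.add_sum_erase _ _ (Finset.mem_univ i), if_pos rfl,
      Nat.cast_zero, zero_div, zero_add]
    refine Finset.sum_congr rfl fun j hj => ?_
    rw [habs, if_neg (Finset.ne_of_mem_erase hj)]
  simp only [Matrix.of_apply]
  rw [h2, habs i, h1, abs_div, abs_of_pos hS, ← add_div]
  refine div_le_div_of_nonneg_right ?_ hS.le
  rw [Nat.cast_natAbs (Int.ofNat scale - _), Nat.cast_add] at hd
  simpa only [Int.cast_abs, Int.cast_sub, Int.ofNat_eq_natCast, Int.cast_natCast] using hd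

theorem RowsOk.sum_norm_le (h : RowsOk rows su) :
    ∑ i : Fin rows.length, ‖rows[i].vec‖ ≤ su / halfScale := by
  refine (Finset.sum_le_sum fun i _ => rows[i].norm_vec_le).trans ?_
  rw [← Finset.sum_div, ← Nat.cast_sum]
  exact div_le_div_of_nonneg_right (by exact_mod_cast h.unorm) halfScale_pos.le

theorem RowsOk.estimate (h : RowsOk rows su) {b1 b2 : Ball} {y : Y} (h1 : b1.Mem y.fst)
    (h2 : b2.Mem y.snd) {lim : ℕ} (hl : resBound rows su b1 b2 ≤ lim) :
    ∃ c : ℝ, (∀ i : Fin rows.length, |rows[i].fn y| ≤ c * (rows[i].mu / scale)) ∧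
      ‖y‖ + c * ∑ i : Fin rows.length, ‖rows[i].vec‖ ≤ lim / scale := by
  have hS := scale_pos
  set m := maxCoef b1 b2 rows
  refine ⟨m / scale, fun i => ?_, ?_⟩
  · refine (Row.abs_fn_le (h.ok _ (List.getElem_mem _)) h1 h2).trans ?_
    have : ((rows[i].coef b1 b2 : ℕ) : ℝ) ≤ m := by
      exact_mod_cast coef_le_maxCoef b1 b2 (List.getElem_mem _)
    exact mul_le_mul_of_nonneg_right (div_le_div_of_nonneg_right this hS.le) (by positivity)
  · have k1 : (m : ℝ) * (su / halfScale) ≤ ((m * su / halfScale + 1 : ℕ) : ℝ) := by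
      have := div_le_natDiv (m * su) halfScale
      rwa [Nat.cast_mul, mul_div_assoc] at this
    have k2 : ((resBound rows su b1 b2 : ℕ) : ℝ) ≤ lim := by exact_mod_cast hl
    rw [resBound, Nat.cast_add, Nat.cast_add] at k2
    have k3 := h1.norm_le
    have k4 := h2.norm_le
    have k5 : (m : ℝ) * ∑ i : Fin rows.length, ‖rows[i].vec‖ ≤ m * (su / halfScale) :=
      mul_le_mul_of_nonneg_left h.sum_norm_le (Nat.cast_nonneg _)
    rw [le_div_iff₀ hS, WithLp.prod_norm_eq_of_L1, add_mul, div_mul_eq_mul_div,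
      div_mul_cancel₀ _ hS.ne']
    linarith

/-- The matrix of the operator `gam`. -/
def gamMatrix (rows : List Row) : Matrix (Fin 13 ⊕ Fin 13) (Fin 13 ⊕ Fin 13) ℝ :=
  Matrix.of fun a b => ∑ i : Fin rows.length,
    Sum.elim (fun k : Fin 13 => (halfScale : ℝ)⁻¹ * rows[i].u1.getD k 0)
      (fun k : Fin 13 => (halfScale : ℝ)⁻¹ * rows[i].u2.getD k 0) a *
    Sum.elim (fun k : Fin 13 => (halfScale : ℝ)⁻¹ * rows[i].v1.getD k 0)
      (fun k : Fin 13 => (halfScale : ℝ)⁻¹ * rows[i].v2.getD k 0) b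

theorem dotL_eq_sum {n : ℕ} {l : List ℤ} (h : l.length ≤ n) (a : X) :
    dotL l a = ∑ k : Fin n, (l.getD k 0 : ℝ) * a k := by
  induction n generalizing l a with
  | zero =>
    rw [List.length_eq_zero_iff.1 (Nat.le_zero.1 h)]; simp [dotL]
  | succ n ih =>
    cases l with
    | nil => simp [dotL]
    | cons x l =>
      rw [dotL_cons, Fin.sum_univ_succ, ih (Nat.le_of_succ_le_succ h)]
      simp [shift_coeff]

theorem poly_coeff (l : List ℤ) (k : ℕ) : poly l k = l.getD k 0 := by
  induction l generalizing k with
  | nil => simp [poly]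
  | cons x l ih =>
    cases k with
    | zero => rw [poly_coeff_zero]; simp
    | succ k => rw [← shift_coeff, shift_poly, List.tail_cons, ih]; simp

theorem sum_single_eq {n : ℕ} {l : List ℤ} (h : l.length ≤ n) (c : ℝ) :
    ∑ k : Fin n, (lp.single 1 (k : ℕ) (c * l.getD k 0) : X) = c • poly l := by
  refine lp.ext (funext fun m => ?_)
  rw [smul_coeff, poly_coeff]
  have e : (∑ k : Fin n, (lp.single 1 (k : ℕ) (c * l.getD k 0) : X)) m =
      ∑ k : Fin n, (lp.single 1 (k : ℕ) (c * l.getD k 0) : X) m :=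
    map_sum (lp.evalCLM ℝ (fun _ : ℕ => ℝ) 1 m) _ _
  rw [e]
  simp only [lp.single_apply, Pi.single_apply]
  by_cases hm : m < n
  · rw [Finset.sum_eq_single (⟨m, hm⟩ : Fin n)]
    · simp
    · intro k _ hk
      exact if_neg fun h => hk (Fin.ext h.symm)
    · simp
  · rw [List.getD_eq_default _ _ (h.trans (not_lt.1 hm)), Finset.sum_eq_zero]
    · simp
    · intro k _
      exact if_neg fun h' => hm (by rw [h']; exact k.2)

theorem RowsOk.matrixOp_eq (h : RowsOk rows su) : matrixOp (gamMatrix rows) = gam rows := by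
  ext1 y
  rw [gam, finRank_apply]
  change ofCoeffs 13 ((gamMatrix rows).mulVec (coeffs 13 y)) = _
  have e1 : (gamMatrix rows).mulVec (coeffs 13 y) = ∑ i : Fin rows.length, rows[i].fn y •
      Sum.elim (fun k : Fin 13 => (halfScale : ℝ)⁻¹ * rows[i].u1.getD k 0)
      (fun k : Fin 13 => (halfScale : ℝ)⁻¹ * rows[i].u2.getD k 0) := by
    funext a
    rw [Finset.sum_apply]
    simp only [Matrix.mulVec, dotProduct, gamMatrix, Matrix.of_apply, Finset.sum_mul]
    rw [Finset.sum_comm]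
    refine Finset.sum_congr rfl fun i _ => ?_
    obtain ⟨-, -, l1, l2, -, -, -⟩ := h.ok rows[i] (List.getElem_mem _)
    rw [Pi.smul_apply, smul_eq_mul, Row.fn_apply, dotL_eq_sum l1, dotL_eq_sum l2,
      Fintype.sum_sum_type]
    simp only [Sum.elim_inl, Sum.elim_inr, mul_add, add_mul, Finset.mul_sum, Finset.sum_mul]
    congr 1
    · refine Finset.sum_congr rfl fun k _ => ?_
      change _ * y.fst k = _
      ring
    · refine Finset.sum_congr rfl fun k _ => ?_
      change _ * y.snd k = _
      ring
  rw [e1, map_sum]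
  refine Finset.sum_congr rfl fun i _ => ?_
  obtain ⟨l1, l2, -, -, -, -, -⟩ := h.ok rows[i] (List.getElem_mem _)
  rw [map_smul]
  congr 1
  refine WithLp.ofLp_injective 1 (Prod.ext ?_ ?_)
  · exact sum_single_eq l1 _
  · exact sum_single_eq l2 _

/-- A combination of the vectors of the rows. -/
def combine (sel : Row → ℤ) (u : Row → List ℤ) : List Row → List ℤ
  | [] => []
  | r :: l => addL (smulL (sel r) (u r)) (combine sel u l)

theorem poly_combine (sel : Row → ℤ) (u : Row → List ℤ) (rows : List Row) :
    poly (combine sel u rows) = ∑ i : Fin rows.length, (sel rows[i] : ℝ) • poly (u rows[i]) := by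
  induction rows with
  | nil => simp [combine, poly]
  | cons r l ih =>
    have : ∑ i : Fin (r :: l).length, (sel (r :: l)[i] : ℝ) • poly (u (r :: l)[i]) =
        (sel r : ℝ) • poly (u r) + ∑ i : Fin l.length, (sel l[i] : ℝ) • poly (u l[i]) :=
      Fin.sum_univ_succ (n := l.length) _
    rw [this, combine, poly_addL, poly_smulL, ih, Algebra.smul_def]

theorem mem_combine {sel : Row → ℤ} {u : Row → List ℤ} {a : X}
    (h : a = ∑ i : Fin rows.length,
      ((halfScale : ℝ)⁻¹ * sel rows[i]) • ((halfScale : ℝ)⁻¹ • poly (u rows[i]))) :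
    (⟨combine sel u rows, 0⟩ : Ball).Mem a := by
  have e : (scale : ℝ) • a = poly (combine sel u rows) := by
    rw [h, poly_combine, Finset.smul_sum]
    refine Finset.sum_congr rfl fun i _ => ?_
    rw [smul_smul, smul_smul]
    congr 1
    rw [← halfScale_mul_self]
    have := halfScale_pos.ne'
    field_simp
  simp [Mem, e]

theorem gam_eF (rows : List Row) (k : ℕ) : gam rows (eF k) = ∑ i : Fin rows.length,
    ((halfScale : ℝ)⁻¹ * rows[i].v1.getD k 0) • rows[i].vec := by
  rw [gam, finRank_apply]; simp only [Row.fn_eF]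

theorem gam_eG (rows : List Row) (k : ℕ) : gam rows (eG k) = ∑ i : Fin rows.length,
    ((halfScale : ℝ)⁻¹ * rows[i].v2.getD k 0) • rows[i].vec := by
  rw [gam, finRank_apply]; simp only [Row.fn_eG]

theorem fst_sum {ι : Type*} (t : Finset ι) (f : ι → Y) : (∑ i ∈ t, f i).fst = ∑ i ∈ t, (f i).fst :=
  map_sum (WithLp.fstL 1 ℝ X X) _ _

theorem snd_sum {ι : Type*} (t : Finset ι) (f : ι → Y) : (∑ i ∈ t, f i).snd = ∑ i ∈ t, (f i).snd :=
  map_sum (WithLp.sndL 1 ℝ X X) _ _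

theorem mem_gam_eF_fst (k : ℕ) :
    (⟨combine (fun r => r.v1.getD k 0) Row.u1 rows, 0⟩ : Ball).Mem (gam rows (eF k)).fst :=
  mem_combine (by rw [gam_eF, fst_sum]; rfl)

theorem mem_gam_eF_snd (k : ℕ) :
    (⟨combine (fun r => r.v1.getD k 0) Row.u2 rows, 0⟩ : Ball).Mem (gam rows (eF k)).snd :=
  mem_combine (by rw [gam_eF, snd_sum]; rfl)

theorem mem_gam_eG_fst (k : ℕ) :
    (⟨combine (fun r => r.v2.getD k 0) Row.u1 rows, 0⟩ : Ball).Mem (gam rows (eG k)).fst :=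
  mem_combine (by rw [gam_eG, fst_sum]; rfl)

theorem mem_gam_eG_snd (k : ℕ) :
    (⟨combine (fun r => r.v2.getD k 0) Row.u2 rows, 0⟩ : Ball).Mem (gam rows (eG k)).snd :=
  mem_combine (by rw [gam_eG, snd_sum]; rfl)

theorem RowsOk.gam_eF_of_le (h : RowsOk rows su) {k : ℕ} (hk : 13 ≤ k) : gam rows (eF k) = 0 := by
  rw [gam_eF]
  refine Finset.sum_eq_zero fun i _ => ?_
  obtain ⟨-, -, l1, -, -, -, -⟩ := h.ok rows[i] (List.getElem_mem _)
  rw [List.getD_eq_default _ _ (l1.trans hk)]; simp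

theorem RowsOk.gam_eG_of_le (h : RowsOk rows su) {k : ℕ} (hk : 13 ≤ k) : gam rows (eG k) = 0 := by
  rw [gam_eG]
  refine Finset.sum_eq_zero fun i _ => ?_
  obtain ⟨-, -, -, l2, -, -, -⟩ := h.ok rows[i] (List.getElem_mem _)
  rw [List.getD_eq_default _ _ (l2.trans hk)]; simp

end Lorenz
end

noncomputable section

namespace Lorenz

open Ball

/-! ### Checking all columns -/

/-- Checks the resolvent estimate for vectors in `(x₁, x₂)`. -/
def boundOk (rows : List Row) (su lim : ℕ) (x1 x2 : Ball) : Bool :=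
  x1.force fun b1 => x2.force fun b2 => Nat.ble (resBound rows su b1 b2) lim

/-- The conclusion of the resolvent estimate. -/
def Estimate (rows : List Row) (lim : ℕ) (y : Y) : Prop :=
  ∃ c : ℝ, (∀ i : Fin rows.length, |rows[i].fn y| ≤ c * (rows[i].mu / scale)) ∧
    ‖y‖ + c * ∑ i : Fin rows.length, ‖rows[i].vec‖ ≤ lim / scale

variable {rows : List Row} {su lim : ℕ}

theorem RowsOk.of_boundOk (h : RowsOk rows su) {b1 b2 : Ball} {y : Y} (h1 : b1.Mem y.fst)
    (h2 : b2.Mem y.snd) (hk : boundOk rows su lim b1 b2 = true) : Estimate rows lim y := by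
  rw [boundOk, force_eq, force_eq, Nat.ble_eq] at hk
  exact h.estimate h1 h2 hk

/-- Checks the columns of index `k`. -/
def colOk (N : ℕ) (rows : List Row) (su lim : ℕ) (s : Stage) (c : Coefs) (k : ℕ) (w : Powers) :
    Bool :=
  boundOk rows su lim
    ((⟨combine (fun r => r.v1.getD k 0) Row.u1 rows, 0⟩ : Ball).sub
      (colF1 N c w (dlamBall c w k)))
    ((⟨combine (fun r => r.v1.getD k 0) Row.u2 rows, 0⟩ : Ball).sub
      (colF2 N s c w (dlamBall c w k))) &&
  boundOk rows su lim
    ((⟨combine (fun r => r.v2.getD k 0) Row.u1 rows, 0⟩ : Ball).sub (colG1 N c w))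
    ((⟨combine (fun r => r.v2.getD k 0) Row.u2 rows, 0⟩ : Ball).sub (colG2 N c w))

/-- A bound for the product of two norms. -/
def mulBound (m n : ℕ) : ℕ := m * n / scale + 1

/-- Checks the columns of all indices starting with the one of `w`. -/
def tailOk (rows : List Row) (su lim : ℕ) (s : Stage) (c : Coefs) (w : Powers) : Bool :=
  boundOk rows su lim
    ⟨[], mulBound c.a1.norm w.p.norm + mulBound w.la.norm c.b1.norm⟩
    ⟨[], 2 * (mulBound s.il.norm w.g5.norm + mulBound c.a2.norm w.g3.norm +
      mulBound w.la.norm c.b2.norm)⟩ &&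
  boundOk rows su lim ⟨[], mulBound c.c1.norm w.f3.norm⟩ ⟨[], 2 * mulBound c.c2.norm w.pg.norm⟩

/-- Checks the columns of indices `k, …, k + n - 1` one by one, and the others together. -/
def colsOk (N : ℕ) (rows : List Row) (su lim : ℕ) (s : Stage) (c : Coefs) :
    ℕ → ℕ → Powers → Bool
  | 0, k, w => Nat.ble 13 k && tailOk rows su lim s c w
  | n + 1, k, w => colOk N rows su lim s c k w &&
      w.next N s fun w' => colsOk N rows su lim s c n (k + 1) w'

section Sound

variable {F : Y} (hF : Good F) {s : Stage} {c : Coefs} {w : Powers} {k N : ℕ}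
  (hr : RowsOk rows su) (hs : s.Sound F) (hc : c.Sound F) (hw : w.Sound F k)

include hF hr hs hc hw

theorem colOk_sound (hk : colOk N rows su lim s c k w = true) :
    Estimate rows lim ((gam rows - fderiv ℝ T F) (eF k)) ∧
      Estimate rows lim ((gam rows - fderiv ℝ T F) (eG k)) := by
  rw [colOk, Bool.and_eq_true] at hk
  obtain ⟨h1, h2⟩ := hk
  rw [sub_apply, sub_apply, hF.fderiv_T_apply,
    hF.fderiv_T_apply]
  exact ⟨hr.of_boundOk ((mem_gam_eF_fst k).sub (mem_colF1 hF hc hw N))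
      ((mem_gam_eF_snd k).sub (mem_colF2 hF hs hc hw N)) h1,
    hr.of_boundOk ((mem_gam_eG_fst k).sub (mem_colG1 hF hc hw N))
      ((mem_gam_eG_snd k).sub (mem_colG2 hF hc hw N)) h2⟩

omit hF hr hs hc hw in
theorem mul_pow_le_mulBound {A : Type*} [NormedRing A] [NormOneClass A] {a b : A} {m n j : ℕ}
    (ha : (scale : ℝ) * ‖a‖ ≤ m) (hb : (scale : ℝ) * ‖b ^ k‖ ≤ n) (h1 : ‖b‖ < 1) (hj : k ≤ j) :
    (scale : ℝ) * ‖a * b ^ j‖ ≤ mulBound m n := by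
  have hS := scale_pos
  have hbj : ‖b ^ j‖ ≤ ‖b ^ k‖ := by
    obtain ⟨i, rfl⟩ := Nat.exists_eq_add_of_le hj
    rw [pow_add]
    refine (norm_mul_le _ _).trans (mul_le_of_le_one_right (norm_nonneg _) ?_)
    exact (norm_pow_le _ _).trans (pow_le_one₀ (norm_nonneg _) h1.le)
  calc (scale : ℝ) * ‖a * b ^ j‖ ≤ scale * (‖a‖ * ‖b ^ k‖) := by
        refine mul_le_mul_of_nonneg_left ((norm_mul_le _ _).trans ?_) hS.le
        exact mul_le_mul_of_nonneg_left hbj (norm_nonneg _)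
    _ = (scale * ‖a‖) * (scale * ‖b ^ k‖) / scale := by field_simp
    _ ≤ (m * n : ℕ) / scale := by
        rw [Nat.cast_mul]
        exact div_le_div_of_nonneg_right (mul_le_mul ha hb (by positivity) (by positivity)) hS.le
    _ ≤ _ := div_le_natDiv _ _

omit hF hr hs hc hw in
theorem scale_mul_norm_two_shift_le {a : X} {m : ℝ} (ha : (scale : ℝ) * ‖a‖ ≤ m) :
    (scale : ℝ) * ‖2 * shift a‖ ≤ 2 * m := by
  have hS := scale_pos
  have h1 : ‖2 * shift a‖ ≤ 2 * ‖a‖ := by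
    rw [two_mul, two_mul]
    exact (norm_add_le _ _).trans (add_le_add (norm_shift_le a) (norm_shift_le a))
  nlinarith [mul_le_mul_of_nonneg_left h1 hS.le]

theorem tailOk_sound (hk13 : 13 ≤ k) (hk : tailOk rows su lim s c w = true) {j : ℕ} (hj : k ≤ j) :
    Estimate rows lim ((gam rows - fderiv ℝ T F) (eF j)) ∧
      Estimate rows lim ((gam rows - fderiv ℝ T F) (eG j)) := by
  rw [tailOk, Bool.and_eq_true] at hk
  obtain ⟨h1, h2⟩ := hk
  have hS := scale_pos
  have hj0 : j ≠ 0 := by omega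
  have hla : ‖cst (laR F)‖ < 1 := by rw [norm_cst]; exact hF.la_lt
  have hdl : cst (dlamR F (eF j)) = -cst (laR F) ^ j := by
    rw [cst_dlamR_eF hF, if_neg hj0, sub_zero]
  rw [sub_apply, sub_apply, hF.fderiv_T_apply,
    hF.fderiv_T_apply, hr.gam_eF_of_le (hk13.trans hj), hr.gam_eG_of_le (hk13.trans hj), zero_sub,
    zero_sub]
  have split2 : ∀ {a b : X} {m n : ℝ}, (scale : ℝ) * ‖a‖ ≤ m → (scale : ℝ) * ‖b‖ ≤ n →
      (scale : ℝ) * ‖a + b‖ ≤ m + n := fun {a b} _ _ ha hb => by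
    linarith [mul_le_mul_of_nonneg_left (norm_add_le a b) hS.le]
  have hlaB : ∀ {b : X} {x : Ball}, x.Mem b → (scale : ℝ) * ‖cst (dlamR F (eF j)) * b‖ ≤
      mulBound w.la.norm x.norm := fun {b x} hb => by
    rw [hdl, neg_mul, norm_neg, mul_comm (cst (laR F) ^ j), mulBound, mul_comm w.la.norm]
    exact mul_pow_le_mulBound hb.norm_le hw.la.norm_le hla hj
  refine ⟨hr.of_boundOk (mem_of_norm_le ?_) (mem_of_norm_le ?_) h1,
    hr.of_boundOk (mem_of_norm_le ?_) (mem_of_norm_le ?_) h2⟩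
  · change (scale : ℝ) * ‖-dfst F (eF j)‖ ≤ _
    rw [norm_neg, dfst_eF hF, Nat.cast_add]
    exact split2 (mul_pow_le_mulBound hc.a1.norm_le hw.p.norm_le hF.p_lt hj) (hlaB hc.b1)
  · change (scale : ℝ) * ‖-dsnd F (eF j)‖ ≤ _
    rw [norm_neg, dsnd_eF hF, Nat.cast_mul, Nat.cast_add, Nat.cast_add, Nat.cast_ofNat]
    exact scale_mul_norm_two_shift_le (split2 (split2
      (mul_pow_le_mulBound hs.il.norm_le hw.g5.norm_le hF.g5_lt hj)
      (mul_pow_le_mulBound hc.a2.norm_le hw.g3.norm_le hF.g3_lt hj)) (hlaB hc.b2))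
  · change (scale : ℝ) * ‖-dfst F (eG j)‖ ≤ _
    rw [norm_neg, dfst_eG hF]
    exact mul_pow_le_mulBound hc.c1.norm_le hw.f3.norm_le hF.f3_lt hj
  · change (scale : ℝ) * ‖-dsnd F (eG j)‖ ≤ _
    rw [norm_neg, dsnd_eG hF, Nat.cast_mul, Nat.cast_ofNat]
    exact scale_mul_norm_two_shift_le
      (mul_pow_le_mulBound hc.c2.norm_le hw.pg.norm_le hF.pg_lt hj)

omit hw in
theorem colsOk_sound {n : ℕ} (hw : w.Sound F k) (hk : colsOk N rows su lim s c n k w = true)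
    {j : ℕ} (hj : k ≤ j) :
    Estimate rows lim ((gam rows - fderiv ℝ T F) (eF j)) ∧
      Estimate rows lim ((gam rows - fderiv ℝ T F) (eG j)) := by
  induction n generalizing k w with
  | zero =>
    rw [colsOk, Bool.and_eq_true, Nat.ble_eq] at hk
    exact tailOk_sound hF hr hs hc hw hk.1 hk.2 hj
  | succ n ih =>
    rw [colsOk, Bool.and_eq_true] at hk
    obtain ⟨h1, h2⟩ := hk
    rcases hj.eq_or_lt with rfl | hj
    · exact colOk_sound hF hr hs hc hw h1
    · obtain ⟨w', hw', h3⟩ := Powers.next_sound hs hw h2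
      exact ih hw' h3 hj

end Sound

/-- Checks that the derivative of the operator is close to `gam rows` at all pairs within `ε` of
the pair of polynomials `(fc, gc)`. -/
def derivOk (N n : ℕ) (fc gc : List ℤ) (ε : ℕ) (rows : List Row) (su lim : ℕ) : Bool :=
  evalStages N fc gc ε fun s => evalCoefs N s fun c => colsOk N rows su lim s c n 0 Powers.start

theorem derivOk_sound {N n : ℕ} {fc gc : List ℤ} {ε : ℕ} (hr : RowsOk rows su)
    (hk : derivOk N n fc gc ε rows su lim = true) {F : Y}
    (hf : (⟨fc, ε⟩ : Ball).Mem F.fst) (hg : (⟨gc, ε⟩ : Ball).Mem F.snd) :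
    Good F ∧ ‖Ring.inverse (gam rows - 1) * (gam rows - fderiv ℝ T F)‖ ≤ lim / scale ∧
      ∀ z : ℂ, ‖z‖ = 1 → IsUnit (complexify (gam rows) - z • 1) ∧
        ‖Ring.inverse (complexify (gam rows) - z • 1) *
          complexify (gam rows - fderiv ℝ T F)‖ ≤ lim / scale := by
  obtain ⟨hF, s, hs, hk⟩ := evalStages_sound hf hg hk
  obtain ⟨c, hc, hk⟩ := evalCoefs_sound hs hk
  refine ⟨hF, norm_resolvent_mul_le _ _ hr.rowDominant
    (div_nonneg (Nat.cast_nonneg _) scale_pos.le) ?_⟩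
  rintro e ⟨k, rfl | rfl⟩
  · exact (colsOk_sound hF hr hs hc (Powers.start_sound F) hk (Nat.zero_le k)).1
  · exact (colsOk_sound hF hr hs hc (Powers.start_sound F) hk (Nat.zero_le k)).2

/-- Checks that the pair of polynomials `(fc, gc)` is close to a fixed point. -/
def residualOk (N : ℕ) (fc gc : List ℤ) (rows : List Row) (su lim : ℕ) : Bool :=
  evalStages N fc gc 0 fun s => boundOk rows su lim ((⟨fc, 0⟩ : Ball).sub s.fhat)
    ((⟨gc, 0⟩ : Ball).sub (mul N s.il s.h).shift.dbl)

theorem residualOk_sound {N : ℕ} {fc gc : List ℤ} (hr : RowsOk rows su)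
    (hk : residualOk N fc gc rows su lim = true) {F : Y}
    (hf : (⟨fc, 0⟩ : Ball).Mem F.fst) (hg : (⟨gc, 0⟩ : Ball).Mem F.snd) :
    IsUnit (gam rows - 1) ∧ ‖newtonOp (gam rows) F - F‖ ≤ lim / scale := by
  obtain ⟨hF, s, hs, hk⟩ := evalStages_sound hf hg hk
  have hres := resolvent_bound (fun i : Fin rows.length => rows[i].vec)
    (fun i : Fin rows.length => rows[i].fn) hr.rowDominant (z := (1 : ℝ)) (by simp)
  rw [one_smul] at hres
  obtain ⟨hu, hres⟩ := hres
  change IsUnit (gam rows - 1) at hu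
  refine ⟨hu, ?_⟩
  have e : newtonOp (gam rows) F - F = Ring.inverse (gam rows - 1) (F - T F) := by
    have h1 : Ring.inverse (gam rows - 1) ((gam rows - 1) F) = F := by
      rw [← mul_apply_eq_comp, Ring.inverse_mul_cancel _ hu]; rfl
    nth_rewrite 2 [← h1]
    rw [newtonOp, ← map_sub]
    congr 1
    change _ - _ - (gam rows F - F) = _
    abel
  obtain ⟨C, h1, h2⟩ : Estimate rows lim (F - T F) := by
    refine hr.of_boundOk ?_ ?_ hk
    · rw [hF.T_eq]; exact hf.sub hs.fhat
    · rw [hF.T_eq]; exact hg.sub (mem_ghatX hs N)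
  rw [e]
  exact (hres _ C h1).trans h2

end Lorenz
end

noncomputable section

namespace Lorenz

open Ball

/-! ### The approximate fixed point and the approximate derivative -/

/-- The coefficients of the approximate fixed point, multiplied by `2⁶⁴`. -/
def fCoeffs : List ℤ :=
  [-13870924242792132608, -46760709014699204608, 5499931227177539584, 1666267223684086272,
   -133551356515623296, -16304915414629914, 1961100808461992, -7610642146510, -19971532634569,
   1428693703217, 193465013814, -19108007525, -1956294128]

def gCoeffs : List ℤ :=
  [115164666654426447872, -39219645569262559232, 3036010820624359424, 969658618144892800,
   -341679171502352384, 59711450326604504, -5223191320438527, -602379250409911, 327046299770442,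
   -61095743804555, 4810634532607, 569541450515, -249261311530]

/-- An approximation of the derivative of the operator at the fixed point. -/
def gamRows : List Row :=
  [⟨[-2280877916, -2132497553, 1307236595, 465426540, -61157752, -8040157, 1288573, -16085,
     -17131, 1577, 207, -26, -2],
    [8166193788, -7152188570, 840255189, 433312968, -189465357, 39806675, -3973601, -587452,
     341840, -70164, 5922, 834, -381],
    [-189225580886, 5785550146, 2310202231, -2510253468, 1623589977, -918123358, 490223243,
     -253595196, 128502424, -64143130, 31645880, -15466399, 7500198],
    [2634378375, 1750609438, 983200389, 488040394, 227228538, 101969050, 44718939, 19317020,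
     8258272, 3504832, 1479639, 622235, 260901],
    189225580886, 209178755026687530050⟩,
   ⟨[1071470043, -222270476, -161626202, -4546171, 4178558, 36751, -47656, 4239, 349, -105, -3,
     2],
    [343080748, 81077058, -43601844, -2108641, 3381413, -935587, 144048, -942, -6339, 1796,
     -231, -3, 8],
    [185370567512, -127867428757, 60170676911, -28097338989, 13036516470, -6030638904,
     2785882944, -1285902686, 593153175, -273430610, 125963169, -57989967, 26679465],
    [16055451459, 6820046194, 2977337894, 1280206480, 543966727, 229250203, 96067202, 40095313,
     16686281, 6929717, 2873434, 1190103, 492472],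
    185370567512, 204980498304624693982⟩,
   ⟨[26639300, 185673202, -401440748, 63917262, 16841636, -3683070, -168112, 72290, -2012, -812,
     79, 7, -1],
    [4469373701, -4480935711, 1108754028, 44094107, -88207216, 27405034, -4631769, 176628,
     146217, -47474, 7271, -253, -169],
    [-37238997, 1364630617, -7684390636, 5069255873, -3086521415, 1760451085, -967633297,
     521079573, -276951192, 145689264, -75929079, 39222883, -20090438],
    [-1936287669, -4106698385, -3059856777, -1925613045, -1080295635, -564184607, -281057550,
     -135499218, -63798134, -29514763, -13472311, -6085496, -2725950],
    7684390636, 8492365647588467872⟩,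
   ⟨[1916844, 39002499, 62388216, -23415108, -12035262, 2866350, 2137834, -1815263, 897268,
     -360025, 127311, -41070, 12279],
    [128151522, -346316214, 260550426, -66950246, -3353563, 7117581, -3251967, 1612147, -695030,
     149994, 19907, -21606, 4328],
    [-3533117750, 915117919, -7874275788, 1882040444, 1753383388, 882196917, 818894276,
     -1595065813, 1201782197, -603615360, 235528740, -72051121, 13930391],
    [5984315946, 5493774481, -4888330139, -5392501092, -1199838277, 1920288765, 2908150160,
     2596814070, 1864323166, 1176893485, 680644252, 369055829, 190360608],
    7874275788, 8752296988418711845⟩,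
   ⟨[3682039, 41425574, 44462941, 52812314, -11052420, 918874, -182212, 135290, -73496, 29826,
     -10650, 3494, -1062],
    [302161737, -272649249, 229281417, -85356771, 15750843, -2472150, 1097158, -625466, 221818,
     -26495, -13788, 6941, -731],
    [-968551637, -10165902977, -10975236234, 749436864, -1235546907, -675636742, 6591185,
     529975672, -525359694, 322914755, -160153036, 70641718, -29190452],
    [-7244140428, -7066853641, -1626149796, 76416111, 92957524, -185749260, -316238087,
     -300873255, -225013017, -146181731, -86344789, -47560178, -24818998],
    10975236234, 12372575224122387827⟩,
   ⟨[-8212795, -103097548, -65726247, 77869223, -19493833, -1475794, 2954235, -1651027, 706988,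
     -261189, 87174, -26929, 7790],
    [-536219702, 521079140, -26259011, -147143134, 78132938, -16763547, 50292, 1008209, -319223,
     43749, 7281, -6244, 1559],
    [1201275862, 749823429, 2980145254, -12375544060, 2828014918, -44216862, 145670565,
     -314860661, 159996222, -8745488, -47529122, 48955066, -34420102],
    [-2022639406, -4314809462, -7541504530, -3660205838, 764469263, 2837150656, 3003082272,
     2338072718, 1551117253, 928397120, 516378316, 271684337, 136805997],
    12375544060, 14115522631504753522⟩,
   ⟨[-80742, -12812299, -20182482, 54760132, -6739587, -3359922, 2716429, -1363018, 558441,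
     -201550, 66282, -20272, 5825],
    [6264312, 270140911, -319104928, 170848111, -43815839, -3280447, 6992763, -2387630, 172953,
     142873, -50251, 1538, 3245],
    [3265059199, 4527291482, 5311159107, 12330996167, -11168485132, -784916616, 3999886503,
     -2610052430, 954591430, -194199436, -29349772, 58994815, -42958196],
    [-4098137893, -6492288787, -8954427938, -3325900883, 2373167490, 4824493826, 4719432681,
     3565725340, 2329308340, 1381316142, 763640203, 400094399, 200868760],
    12330996167, 15775427804619294567⟩,
   ⟨[-67343, 4293724, 2045707, -36811540, 13115265, -5385877, 2341631, -853676, 271503, -79424,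
     21994, -5817, 1472],
    [-10770179, -157348806, 167977617, -37954305, -31598814, 20873850, -1601337, -2507120,
     935923, -10842, -75157, 17910, 1278],
    [165583017, -442559302, 210188074, 2235124208, 9608212371, -15734036844, 10213785356,
     -4135505927, 1161497623, -234267552, 28751247, -1461750, 2214242],
    [-547429069, -72410211, 1841123023, 3765551620, 4110541326, 3219689218, 2073946998,
     1177158381, 611012847, 296544273, 136517344, 60200546, 25606653],
    15734036844, 17603181627415614952⟩,
   ⟨[3361247, 40136025, 10536633, -54303066, 30053928, -12960662, 5282868, -1990904, 689807,
     -222592, 67844, -19681, 5444],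
    [214242126, -273642763, 105770264, -25536781, 13412875, -7207718, 1674847, 222822, -241161,
     49486, 6567, -5521, 941],
    [-1701962772, -2343448985, -3598276776, -5376148472, -7490726013, 6369314093, -2162277277,
     -75336640, 448806174, -296009903, 148808015, -73124885, 39209980],
    [2148830305, 4213359289, 8335682412, 13735700114, 15550709378, 13630524540, 10079236882,
     6614225327, 3974891196, 2233093235, 1189516793, 606901213, 298818686],
    15550709378, 18187302723439718134⟩,
   ⟨[35655, -4776399, -11820026, 15091290, 3675572, -4781715, 2468657, -1040130, 391734,
     -135330, 43469, -13124, 3745],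
    [7681148, 73170664, -79301011, 46385086, -32478584, 25718072, -14497144, 4761826, -553097,
     -214114, 101587, -9798, -4885],
    [1553131329, 645402139, 2228175067, 8964929548, 15701690656, 6145123375, -8636974532,
     4702749766, -1588051451, 418834737, -100225597, 29688404, -13072784],
    [-2915047562, -3398595329, -1936314902, 954183042, 2953424042, 3456639330, 2964536875,
     2135191974, 1368953240, 806820595, 445965381, 234321566, 118156888],
    15701690656, 18440124551818851571⟩]

/-- The sum of the norms of the vectors, multiplied by `2³²`. -/
def gamSum : ℕ := 42135608922

instance (r : Row) : Decidable r.Ok := by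
  unfold Row.Ok
  infer_instance

theorem gamRows_ok : RowsOk gamRows gamSum where
  ok := by decide +kernel
  unorm := by decide +kernel
  dom := by decide +kernel

/-- The radius `10⁻⁷`, multiplied by `2⁶⁴` and rounded up. -/
def radius : ℕ := 1844674407371

/-- The bound `0.19` for the derivative of the Newton operator, multiplied by `2⁶⁴`. -/
def derivBound : ℕ := 3504881374004814807

/-- The bound `4.9 · 10⁻⁹` for the first Newton step, multiplied by `2⁶⁴`. -/
def stepBound : ℕ := 90389045961

theorem derivOk_gamRows :
    derivOk 14 17 fCoeffs gCoeffs radius gamRows gamSum derivBound = true := by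
  decide +kernel

theorem residualOk_gamRows : residualOk 26 fCoeffs gCoeffs gamRows gamSum stepBound = true := by
  decide +kernel

end Lorenz
end

noncomputable section

namespace Lorenz

/-! ### The Lorenz map -/

/-- The value of the polynomial with the given integer coefficients. -/
def evalP {R : Type*} [CommRing R] : List ℤ → R → R
  | [], _ => 0
  | a :: l, x => a + x * evalP l x

theorem map_evalP {R S : Type*} [CommRing R] [CommRing S] (φ : R →+* S) (l : List ℤ) (x : R) :
    φ (evalP l x) = evalP l (φ x) := by
  induction l with
  | nil => simp [evalP]
  | cons a l ih => simp [evalP, ih]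

theorem differentiable_evalP {𝕜 : Type*} [NontriviallyNormedField 𝕜] (l : List ℤ) :
    Differentiable 𝕜 (evalP l : 𝕜 → 𝕜) := by
  induction l with
  | nil => exact differentiable_const 0
  | cons a l ih => exact (differentiable_const _).add (differentiable_id.mul ih)

theorem hasSum_evalP (l : List ℤ) (w : ℂ) :
    HasSum (fun k => ((l.getD k 0 : ℤ) : ℂ) * w ^ k) (evalP l w) := by
  induction l with
  | nil => simp [evalP]
  | cons a l ih =>
    rw [← hasSum_nat_add_iff' 1]
    simpa [evalP, pow_succ', mul_left_comm] using ih.mul_left w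

theorem ev_smul_poly (c : ℝ) (l : List ℤ) (w : ℂ) : ev (c • poly l) w = c * evalP l w := by
  rw [ev, ← ((hasSum_evalP l w).mul_left (c : ℂ)).tsum_eq]
  refine tsum_congr fun k => ?_
  rw [smul_coeff, poly_coeff]
  push_cast
  ring

/-- A bound for the polynomial on `[-1/2, 1/2]`. -/
def supBound : List ℤ → ℝ
  | [] => 0
  | a :: l => |(a : ℝ)| + 1 / 2 * supBound l

/-- A Lipschitz constant for the polynomial on `[-1/2, 1/2]`. -/
def lipBound : List ℤ → ℝ
  | [] => 0
  | _ :: l => supBound l + 1 / 2 * lipBound l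

theorem abs_evalP_le {x : ℝ} (hx : |x| ≤ 1 / 2) (l : List ℤ) : |evalP l x| ≤ supBound l := by
  induction l with
  | nil => simp [evalP, supBound]
  | cons a l ih =>
    refine (abs_add_le _ _).trans (add_le_add le_rfl ?_)
    rw [abs_mul]
    exact mul_le_mul hx ih (abs_nonneg _) (by norm_num)

theorem abs_evalP_sub_le {x y : ℝ} (hx : |x| ≤ 1 / 2) (hy : |y| ≤ 1 / 2) (l : List ℤ) :
    |evalP l y - evalP l x| ≤ lipBound l * |y - x| := by
  induction l with
  | nil => simp [evalP, lipBound]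
  | cons a l ih =>
    have e : evalP (a :: l) y - evalP (a :: l) x =
        (y - x) * evalP l y + x * (evalP l y - evalP l x) := by simp only [evalP]; ring
    rw [e, lipBound, add_mul, mul_assoc]
    refine (abs_add_le _ _).trans (add_le_add ?_ ?_)
    · rw [abs_mul, mul_comm]
      exact mul_le_mul_of_nonneg_right (abs_evalP_le hy l) (abs_nonneg _)
    · rw [abs_mul]
      exact mul_le_mul hx ih (abs_nonneg _) (by norm_num)

theorem evalP_cons_cons_sub (a b : ℤ) (l : List ℤ) (x y : ℝ) :
    evalP (a :: b :: l) y - evalP (a :: b :: l) x =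
      b * (y - x) + (evalP (0 :: 0 :: l) y - evalP (0 :: 0 :: l) x) := by
  simp only [evalP]; push_cast; ring

theorem strictMonoOn_evalP {a b : ℤ} {l : List ℤ} (h : lipBound (0 :: 0 :: l) < b) :
    StrictMonoOn (evalP (a :: b :: l) : ℝ → ℝ) (Icc (-(1 / 2)) (1 / 2)) := by
  intro x hx y hy hxy
  have h1 := abs_evalP_sub_le (abs_le.2 hx) (abs_le.2 hy) (0 :: 0 :: l)
  rw [abs_of_pos (sub_pos.2 hxy)] at h1
  rw [← sub_pos, evalP_cons_cons_sub]
  nlinarith [(abs_le.1 h1).1, mul_pos (sub_pos.2 h) (sub_pos.2 hxy)]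

theorem strictAntiOn_evalP {a b : ℤ} {l : List ℤ} (h : lipBound (0 :: 0 :: l) < -b) :
    StrictAntiOn (evalP (a :: b :: l) : ℝ → ℝ) (Icc (-(1 / 2)) (1 / 2)) := by
  intro x hx y hy hxy
  have h1 := abs_evalP_sub_le (abs_le.2 hx) (abs_le.2 hy) (0 :: 0 :: l)
  rw [abs_of_pos (sub_pos.2 hxy)] at h1
  rw [← sub_neg, evalP_cons_cons_sub]
  nlinarith [(abs_le.1 h1).2, mul_pos (sub_pos.2 h) (sub_pos.2 hxy)]

/-- The pair of polynomials with the given coefficients. -/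
def pairP (fc gc : List ℤ) : Y :=
  WithLp.toLp 1 ((scale : ℝ)⁻¹ • poly fc, (scale : ℝ)⁻¹ • poly gc)

/-- The branches of the map, as functions on the line. -/
def leftP (l : List ℤ) (x : ℝ) : ℝ := (scale : ℝ)⁻¹ * evalP l ((x ^ 2 - 1) * (5 / 11))

def rightP (l : List ℤ) (x : ℝ) : ℝ := -1 + (scale : ℝ)⁻¹ / 2 * evalP (0 :: l) (2 * x ^ 2)

variable (fc gc : List ℤ)

theorem phi_pairP (w : ℂ) :
    phi (pairP fc gc) w = (scale : ℂ)⁻¹ * evalP fc ((w - 1) * (5 / 11)) := by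
  change ev ((scale : ℝ)⁻¹ • poly fc) _ = _
  rw [ev_smul_poly, s]
  push_cast
  congr 2
  field_simp

theorem psi_pairP (w : ℂ) :
    psi (pairP fc gc) w = -1 + (scale : ℂ)⁻¹ / 2 * evalP (0 :: gc) (2 * w) := by
  change -1 + w * ev ((scale : ℝ)⁻¹ • poly gc) _ = _
  have : w / t = 2 * w := by rw [t]; field_simp
  rw [ev_smul_poly, this, evalP]
  push_cast
  ring

theorem phi_pairP_ofReal (x : ℝ) : phi (pairP fc gc) ((x : ℂ) ^ 2) = leftP fc x := by
  rw [phi_pairP, leftP]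
  push_cast
  rw [← Complex.ofRealHom_eq_coe (evalP _ _), map_evalP]
  simp

theorem psi_pairP_ofReal (x : ℝ) : psi (pairP fc gc) ((x : ℂ) ^ 2) = rightP gc x := by
  rw [psi_pairP, rightP]
  push_cast
  rw [← Complex.ofRealHom_eq_coe (evalP _ _), map_evalP]
  simp

theorem toMap_of_neg {x : ℝ} (hx : x < 0) : toMap (pairP fc gc) x = leftP fc x := by
  rw [toMap, if_pos hx, phi_pairP_ofReal, Complex.ofReal_re]

theorem toMap_of_nonneg {x : ℝ} (hx : 0 ≤ x) : toMap (pairP fc gc) x = rightP gc x := by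
  rw [toMap, if_neg hx.not_gt, psi_pairP_ofReal, Complex.ofReal_re]

theorem continuous_leftP : Continuous (leftP fc) := by
  have := (differentiable_evalP (𝕜 := ℝ) fc).continuous
  unfold leftP
  fun_prop

theorem continuous_rightP : Continuous (rightP gc) := by
  have := (differentiable_evalP (𝕜 := ℝ) (0 :: gc)).continuous
  unfold rightP
  fun_prop

theorem symmAnalyticNear_phi (K : Set ℝ) : SymmAnalyticNear (phi (pairP fc gc)) K := by
  have e : phi (pairP fc gc) = fun w => (scale : ℂ)⁻¹ * evalP fc ((w - 1) * (5 / 11)) :=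
    funext (phi_pairP fc gc)
  refine ⟨univ, isOpen_univ, fun _ _ => mem_univ _, ?_, fun w _ => ⟨mem_univ _, ?_⟩⟩
  · have := differentiable_evalP (𝕜 := ℂ) fc
    rw [e]
    fun_prop
  · rw [phi_pairP, phi_pairP, map_mul, map_evalP]
    simp [Complex.conj_ofNat]

theorem symmAnalyticNear_psi (K : Set ℝ) : SymmAnalyticNear (psi (pairP fc gc)) K := by
  have e : psi (pairP fc gc) = fun w => -1 + (scale : ℂ)⁻¹ / 2 * evalP (0 :: gc) (2 * w) :=
    funext (psi_pairP fc gc)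
  refine ⟨univ, isOpen_univ, fun _ _ => mem_univ _, ?_, fun w _ => ⟨mem_univ _, ?_⟩⟩
  · have := differentiable_evalP (𝕜 := ℂ) (0 :: gc)
    rw [e]
    fun_prop
  · rw [psi_pairP, psi_pairP, map_add, map_mul, map_evalP]
    simp [Complex.conj_ofNat]

variable {fc gc}

theorem strictMonoOn_leftP
    (h : StrictAntiOn (evalP fc : ℝ → ℝ) (Icc (-(1 / 2)) (1 / 2))) :
    StrictMonoOn (leftP fc) (Icc (-1) 0) := by
  have hS : (0 : ℝ) < (scale : ℝ)⁻¹ := inv_pos.2 scale_pos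
  intro x hx y hy hxy
  refine mul_lt_mul_of_pos_left (h ?_ ?_ ?_) hS
  · constructor <;> nlinarith [hy.1, hy.2]
  · constructor <;> nlinarith [hx.1, hx.2]
  · nlinarith [hy.1, hy.2, hx.1]

theorem strictMonoOn_rightP
    (h : StrictMonoOn (evalP (0 :: gc) : ℝ → ℝ) (Icc (-(1 / 2)) (1 / 2))) :
    StrictMonoOn (rightP gc) (Icc 0 (1 / 2)) := by
  have hS : (0 : ℝ) < (scale : ℝ)⁻¹ / 2 := half_pos (inv_pos.2 scale_pos)
  intro x hx y hy hxy
  refine add_lt_add_right (mul_lt_mul_of_pos_left (h ?_ ?_ ?_) hS) _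
  · constructor <;> nlinarith [hx.1, hx.2]
  · constructor <;> nlinarith [hy.1, hy.2]
  · nlinarith [hy.1, hy.2, hx.1]

theorem isLorenzMap_pairP (hL : StrictMonoOn (leftP fc) (Icc (-1) 0))
    (hR : StrictMonoOn (rightP gc) (Icc 0 (1 / 2))) (h1 : -1 ≤ leftP fc (-1))
    (h0 : 0 < leftP fc 0) (h2 : leftP fc 0 ≤ 1 / 2) (h3 : rightP gc (leftP fc 0) ≤ leftP fc 0) :
    IsLorenzMap (-1) (leftP fc 0) 2 (toMap (pairP fc gc)) := by
  have hR0 : rightP gc 0 = -1 := by simp [rightP, evalP]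
  have sq : ∀ x : ℝ, |x| ^ (2 : ℝ) = x ^ 2 := fun x => by
    rw [Real.rpow_two, sq_abs]
  refine ⟨by norm_num, h0, by norm_num, ?_, ?_, ?_, ?_, ?_, ?_, ?_, ?_⟩
  · rintro x ⟨hx, hx0⟩
    rcases lt_or_gt_of_ne (show x ≠ 0 from hx0) with h | h
    · rw [toMap_of_neg _ _ h]
      exact ⟨h1.trans (hL.monotoneOn ⟨le_rfl, by norm_num⟩ ⟨hx.1, h.le⟩ hx.1),
        hL.monotoneOn ⟨hx.1, h.le⟩ ⟨by norm_num, le_rfl⟩ h.le⟩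
    · rw [toMap_of_nonneg _ _ h.le, ← hR0]
      exact ⟨hR.monotoneOn ⟨le_rfl, by norm_num⟩ ⟨h.le, hx.2.trans h2⟩ h.le,
        (hR.monotoneOn ⟨h.le, hx.2.trans h2⟩ ⟨h0.le, h2⟩ hx.2).trans h3⟩
  · rintro x ⟨-, hx0⟩
    refine ContinuousAt.continuousWithinAt ?_
    rcases lt_or_gt_of_ne (show x ≠ 0 from hx0) with h | h
    · exact (continuous_leftP fc).continuousAt.congr
        (eventually_of_mem (Iio_mem_nhds h) fun y hy => (toMap_of_neg _ _ hy).symm)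
    · exact (continuous_rightP gc).continuousAt.congr
        (eventually_of_mem (Ioi_mem_nhds h) fun y hy => (toMap_of_nonneg _ _ (le_of_lt hy)).symm)
  · exact (hL.mono Ico_subset_Icc_self).congr fun x hx => (toMap_of_neg _ _ hx.2).symm
  · exact (hR.mono fun x hx => ⟨hx.1.le, hx.2.trans h2⟩).congr
      fun x hx => (toMap_of_nonneg _ _ hx.1.le).symm
  · exact ((continuous_leftP fc).continuousAt.mono_left nhdsWithin_le_nhds).congr'
      (eventually_of_mem self_mem_nhdsWithin fun y hy => (toMap_of_neg _ _ hy).symm)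
  · rw [← hR0]
    exact ((continuous_rightP gc).continuousAt.mono_left nhdsWithin_le_nhds).congr'
      (eventually_of_mem self_mem_nhdsWithin fun y hy =>
        (toMap_of_nonneg _ _ (le_of_lt hy)).symm)
  · refine ⟨_, symmAnalyticNear_phi fc gc _, fun x hx => ?_⟩
    rw [toMap_of_neg _ _ hx.2, sq, Complex.ofReal_pow, phi_pairP_ofReal]
  · refine ⟨_, symmAnalyticNear_psi fc gc _, fun x hx => ?_⟩
    rw [toMap_of_nonneg _ _ hx.1.le, sq, Complex.ofReal_pow, psi_pairP_ofReal]

theorem isLorenzMap_approx :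
    IsLorenzMap (-1) (leftP fCoeffs 0) 2 (toMap (pairP fCoeffs gCoeffs)) := by
  have hL : StrictMonoOn (leftP fCoeffs) (Icc (-1) 0) :=
    strictMonoOn_leftP (strictAntiOn_evalP (by norm_num [lipBound, supBound]))
  have hR : StrictMonoOn (rightP gCoeffs) (Icc 0 (1 / 2)) :=
    strictMonoOn_rightP (strictMonoOn_evalP (by norm_num [lipBound, supBound]))
  have b1 : 45 / 100 ≤ leftP fCoeffs 0 := by norm_num [leftP, evalP, fCoeffs, scale]
  have b2 : leftP fCoeffs 0 ≤ 46 / 100 := by norm_num [leftP, evalP, fCoeffs, scale]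
  refine isLorenzMap_pairP hL hR ?_ (by linarith) (by linarith) ?_
  · norm_num [leftP, evalP, fCoeffs, scale]
  · have : rightP gCoeffs (46 / 100) ≤ 45 / 100 := by norm_num [rightP, evalP, gCoeffs, scale]
    exact ((hR.monotoneOn ⟨by linarith, by linarith⟩ ⟨by norm_num, by norm_num⟩ b2).trans
      this).trans b1

/-! ### The estimates -/

theorem mem_of_norm_sub_le {l : List ℤ} {a : X} (h : ‖a - (scale : ℝ)⁻¹ • poly l‖ ≤ 1 / 10 ^ 7) :
    (⟨l, radius⟩ : Ball).Mem a := by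
  have hS := scale_pos
  have e : (scale : ℝ) • a - poly l = (scale : ℝ) • (a - (scale : ℝ)⁻¹ • poly l) := by
    rw [smul_sub, smul_smul, mul_inv_cancel₀ hS.ne', one_smul]
  have hr : (scale : ℝ) * (1 / 10 ^ 7) ≤ radius := by norm_num [scale, radius]
  rw [Ball.Mem, e, norm_smul, Real.norm_of_nonneg hS.le]
  exact (mul_le_mul_of_nonneg_left h hS.le).trans hr

theorem mem_smul_poly (l : List ℤ) : (⟨l, 0⟩ : Ball).Mem ((scale : ℝ)⁻¹ • poly l) := by
  rw [Ball.Mem, smul_smul, mul_inv_cancel₀ scale_pos.ne', one_smul, sub_self, norm_zero]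
  simp

theorem estimates {F : Y} (h : ‖F - pairP fCoeffs gCoeffs‖ ≤ 1 / 10 ^ 7) :
    Good F ∧ ‖Ring.inverse (gam gamRows - 1) * (gam gamRows - fderiv ℝ T F)‖ ≤ 19 / 100 ∧
      ∀ z : ℂ, ‖z‖ = 1 → IsUnit (complexify (gam gamRows) - z • 1) ∧
        ‖Ring.inverse (complexify (gam gamRows) - z • 1) *
          complexify (gam gamRows - fderiv ℝ T F)‖ ≤ 19 / 100 := by
  have hb : (derivBound : ℝ) / scale ≤ 19 / 100 := by norm_num [derivBound, scale]
  rw [WithLp.prod_norm_eq_of_L1] at h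
  have h1 : ‖F.fst - (scale : ℝ)⁻¹ • poly fCoeffs‖ ≤ 1 / 10 ^ 7 :=
    (le_add_of_nonneg_right (norm_nonneg _)).trans h
  have h2 : ‖F.snd - (scale : ℝ)⁻¹ • poly gCoeffs‖ ≤ 1 / 10 ^ 7 :=
    (le_add_of_nonneg_left (norm_nonneg _)).trans h
  obtain ⟨hF, k1, k2⟩ := derivOk_sound gamRows_ok derivOk_gamRows (mem_of_norm_sub_le h1)
    (mem_of_norm_sub_le h2)
  exact ⟨hF, k1.trans hb, fun z hz => ⟨(k2 z hz).1, (k2 z hz).2.trans hb⟩⟩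

theorem hasFDerivAt_newtonOp (Γ : Y →L[ℝ] Y) {F : Y} (hF : DifferentiableAt ℝ T F) :
    HasFDerivAt (newtonOp Γ) (Ring.inverse (Γ - 1) * (Γ - fderiv ℝ T F)) F :=
  (Ring.inverse (Γ - 1)).hasFDerivAt.comp F (Γ.hasFDerivAt.sub hF.hasFDerivAt)

theorem smul_poly_coeff_of_le (c : ℝ) {l : List ℤ} {k : ℕ} (h : l.length ≤ k) :
    (c • poly l) k = 0 := by
  rw [smul_coeff, poly_coeff, List.getD_eq_default _ _ h]; simp

end Lorenz
end

theorem theorem5p3 :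
    ∃ (F₀ : Lorenz.Y) (M : Matrix (Fin 13 ⊕ Fin 13) (Fin 13 ⊕ Fin 13) ℝ),
      (∀ k : ℕ, 13 ≤ k → F₀.fst k = 0 ∧ F₀.snd k = 0) ∧
      (∃ r : ℝ, Lorenz.IsLorenzMap (-1) r 2 (Lorenz.toMap F₀)) ∧
      IsUnit (Lorenz.matrixOp M - 1) ∧
      (∀ F : Lorenz.Y, ‖F - F₀‖ ≤ 1 / 10 ^ 7 →
        F ∈ interior Lorenz.domT ∧ DifferentiableAt ℝ Lorenz.T F ∧
        DifferentiableAt ℝ (Lorenz.newtonOp (Lorenz.matrixOp M)) F ∧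
        ‖fderiv ℝ (Lorenz.newtonOp (Lorenz.matrixOp M)) F‖ < 0.2) ∧
      ‖Lorenz.newtonOp (Lorenz.matrixOp M) F₀ - F₀‖ < 5 / 10 ^ 9 ∧
      (∀ θ : ℝ,
        IsUnit (Lorenz.complexify (Lorenz.matrixOp M) - Complex.exp (θ * Complex.I) • 1) ∧
        ∀ F : Lorenz.Y, ‖F - F₀‖ ≤ 1 / 10 ^ 7 →
          ‖Ring.inverse (Lorenz.complexify (Lorenz.matrixOp M) - Complex.exp (θ * Complex.I) • 1) *
            Lorenz.complexify (Lorenz.matrixOp M - fderiv ℝ Lorenz.T F)‖ < 0.9) := by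
  have hres := Lorenz.residualOk_sound (F := Lorenz.pairP Lorenz.fCoeffs Lorenz.gCoeffs)
    Lorenz.gamRows_ok Lorenz.residualOk_gamRows (Lorenz.mem_smul_poly _) (Lorenz.mem_smul_poly _)
  have hstep : (Lorenz.stepBound : ℝ) / Lorenz.scale < 5 / 10 ^ 9 := by
    norm_num [Lorenz.stepBound, Lorenz.scale]
  have hexp : ∀ θ : ℝ, ‖Complex.exp (θ * Complex.I)‖ = 1 := Complex.norm_exp_ofReal_mul_I
  refine ⟨Lorenz.pairP Lorenz.fCoeffs Lorenz.gCoeffs, Lorenz.gamMatrix Lorenz.gamRows,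
    fun k hk => ⟨Lorenz.smul_poly_coeff_of_le _ hk, Lorenz.smul_poly_coeff_of_le _ hk⟩,
    ⟨_, Lorenz.isLorenzMap_approx⟩, ?_⟩
  rw [Lorenz.gamRows_ok.matrixOp_eq]
  refine ⟨hres.1, fun F hF => ?_, hres.2.trans_lt hstep, fun θ => ⟨?_, fun F hF => ?_⟩⟩
  · obtain ⟨hG, hn, -⟩ := Lorenz.estimates hF
    have hd := Lorenz.hasFDerivAt_newtonOp (Lorenz.gam Lorenz.gamRows) hG.differentiableAt_T
    refine ⟨hG.mem_interior, hG.differentiableAt_T, hd.differentiableAt, ?_⟩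
    rw [hd.fderiv]
    exact hn.trans_lt (by norm_num)
  · have h0 : ‖Lorenz.pairP Lorenz.fCoeffs Lorenz.gCoeffs -
        Lorenz.pairP Lorenz.fCoeffs Lorenz.gCoeffs‖ ≤ 1 / 10 ^ 7 := by
      rw [sub_self, norm_zero]; norm_num
    exact ((Lorenz.estimates h0).2.2 _ (hexp θ)).1
  · exact ((Lorenz.estimates hF).2.2 _ (hexp θ)).2.trans_lt (by norm_num)
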